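/- **Conventions.** A *supercommutative superring* is a ring with unity $A=A_0\oplus A_1$ graded by $\mathbb Z/2$ with $ab=(-1)^{|a||b|}ba$ for all homogeneous $a,b\in A$. It is *local* if it has exactly one maximal homogeneous ideal, i.e. exactly one ideal that is maximal among the proper homogeneous ideals. A *right $A$-supermodule* is a right $A$-module $M=M_0\oplus M_1$ with $M_iA_j\subseteq M_{i+j}$; homomorphisms are the right $A$-linear maps preserving the grading. Let $\Pi A$ be the right $A$-module $A$ with the two homogeneous components interchanged. For sets $I,J$ (possibly empty) put $A^{(I|J)}=\bigl(\bigoplus_I A\bigr)\oplus\bigl(\bigoplus_J\Pi A\bigr)$. A right $A$-supermodule is *superprojective* if it is a direct summand, as a supermodule, of some $A^{(I|J)}$. A *locally ringed superspace* $(X,\mathcal O_X)$ is a topological space $X$ with a sheaf $\mathcal O_X$ of supercommutative superrings (with grading-preserving restriction maps) all of whose stalks are local superrings. A *supersheaf* on $X$ is a sheaf $\mathcal F$ of right $\mathcal O_X$-supermodules, i.e. each $\mathcal F(U)$ is a right $\mathcal O_X(U)$-supermodule and the restriction maps are additive, preserve the grading and are compatible with the scalar multiplications; morphisms are the morphisms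 of sheaves that are right $\mathcal O_X(U)$-linear and grading-preserving on every open set $U$. It is *locally free of bounded rank* if there is an $n\in\mathbb N$ such that every point of $X$ has an open neighbourhood $U$ with $\mathcal F|_U\cong\mathcal O_X^{(I|J)}|_U$ as $\mathcal O_X|_U$-supermodules for some finite sets $I,J$ with $|I|+|J|\le n$, where $\mathcal O_X^{(I|J)}(V)=\mathcal O_X(V)^{(I|J)}$. It is *acyclic* if $H^k(X,\mathcal F)=0$ for all $k>0$ (cohomology of the underlying sheaf of abelian groups). It is *generated by finitely many global sections* if there are $s_1,\dots,s_m\in\mathcal F(X)$ whose germs at $x$ generate the $\mathcal O_{X,x}$-module $\mathcal F_x$ for every $x\in X$. **Theorem.** Let $(X,\mathcal O_X)$ be a locally ringed superspace and $A=\Gamma(X,\mathcal O_X)$. For a right $A$-supermodule $M$ let $\mathcal S(M)$ be the supersheaf associated with the presheaf $U\mapsto M\otimes_A\mathcal O_X(U)$ of right $\mathcal O_X$-supermodules (where $|m\otimes s|=|m|+|s|$ for homogeneous $m,s$); this defines a functor $\mathcal S$ from right $A$-supermodules to supersheaves on $X$. Assume that every supersheaf on $X$ that is locally free of bounded rank is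 acyclic and generated by finitely many global sections. Then $\mathcal S(P)$ is locally free of bounded rank for every finitely generated superprojective right $A$-supermodule $P$, and $\mathcal S$ restricts to an equivalence of categories from the full subcategory of finitely generated superprojective right $A$-supermodules to the full subcategory of supersheaves on $X$ that are locally free of bounded rank. -/

import Mathlib

open CategoryTheory TopologicalSpace Opposite MulOpposite
open scoped TensorProduct

universe u

noncomputable section

namespace Super

section Gradings

variable {M : Type*} [AddCommGroup M] {gr : ZMod 2 → AddSubgroup M}

theorem isInternal_iff_isCompl (gr : ZMod 2 → AddSubgroup M) :
    DirectSum.IsInternal gr ↔ IsCompl (gr 0) (gr 1) := by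
  have h := DirectSum.isInternal_submodule_iff_isCompl (R := ℤ)
    (fun i => AddSubgroup.toIntSubmodule (gr i)) (i := 0) (j := 1) (by decide)
    (by ext i; revert i; simp only [Set.mem_univ, Set.mem_insert_iff, Set.mem_singleton_iff]; decide)
  refine Iff.trans (Iff.trans ?_ h) ?_
  · rfl
  · exact (OrderIso.isCompl_iff AddSubgroup.toIntSubmodule).symm

theorem isInternal_of_forall (h : ∀ x : M, ∃ y ∈ gr 0, ∃ z ∈ gr 1, y + z = x)
    (h' : ∀ x ∈ gr 0, x ∈ gr 1 → x = 0) : DirectSum.IsInternal gr := by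
  rw [isInternal_iff_isCompl, isCompl_iff, codisjoint_iff]
  refine ⟨AddSubgroup.disjoint_def.2 fun {x} h0 h1 => h' x h0 h1, ?_⟩
  rw [eq_top_iff]
  intro x _
  exact AddSubgroup.mem_sup.2 (h x)

theorem exists_add (h : DirectSum.IsInternal gr) (x : M) :
    ∃ y ∈ gr 0, ∃ z ∈ gr 1, y + z = x := by
  rw [isInternal_iff_isCompl] at h
  exact AddSubgroup.mem_sup.1 (h.sup_eq_top ▸ AddSubgroup.mem_top x)

theorem eq_zero_of_mem (h : DirectSum.IsInternal gr) {x : M} (h0 : x ∈ gr 0) (h1 : x ∈ gr 1) :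
    x = 0 := by
  rw [isInternal_iff_isCompl] at h
  exact AddSubgroup.disjoint_def.1 h.disjoint h0 h1

theorem add_unique (h : DirectSum.IsInternal gr) {y y' z z' : M} (hy : y ∈ gr 0) (hy' : y' ∈ gr 0)
    (hz : z ∈ gr 1) (hz' : z' ∈ gr 1) (e : y + z = y' + z') : y = y' ∧ z = z' := by
  have e1 : y - y' = z' - z := by
    rw [sub_eq_sub_iff_add_eq_add, e, add_comm]
  have := eq_zero_of_mem h (sub_mem hy hy') (e1 ▸ sub_mem hz' hz)
  have e2 : y = y' := sub_eq_zero.1 this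
  subst e2
  exact ⟨rfl, add_left_cancel e⟩

/-- The projection onto the even component. -/
def evenPart (h : DirectSum.IsInternal gr) : M →+ M :=
  AddMonoidHom.mk' (fun x => (exists_add h x).choose) (by
    intro a b
    obtain ⟨ha, za, hza, ea⟩ := (exists_add h a).choose_spec
    obtain ⟨hb, zb, hzb, eb⟩ := (exists_add h b).choose_spec
    obtain ⟨hc, zc, hzc, ec⟩ := (exists_add h (a + b)).choose_spec
    refine (add_unique h hc (add_mem ha hb) hzc (add_mem hza hzb) ?_).1
    rw [ec]
    nth_rewrite 1 [← ea, ← eb]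
    exact add_add_add_comm _ _ _ _)

theorem evenPart_even (h : DirectSum.IsInternal gr) {x : M} (hx : x ∈ gr 0) :
    evenPart h x = x := by
  obtain ⟨ha, za, hza, ea⟩ := (exists_add h x).choose_spec
  exact (add_unique h ha hx hza (zero_mem _) (by rw [ea, add_zero])).1

theorem evenPart_odd (h : DirectSum.IsInternal gr) {x : M} (hx : x ∈ gr 1) :
    evenPart h x = 0 := by
  obtain ⟨ha, za, hza, ea⟩ := (exists_add h x).choose_spec
  exact (add_unique h ha (zero_mem _) hza hx (by rw [ea, zero_add])).1

end Gradings

/-! ### Supercommutative superrings and right supermodules -/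

/-- `gr` makes the ring `A` into a supercommutative superring: `A = A₀ ⊕ A₁`, `1 ∈ A₀`,
`Aᵢ Aⱼ ⊆ Aᵢ₊ⱼ`, and `a b = (-1)^(|a||b|) b a` for homogeneous `a`, `b`. -/
structure IsSuperRing {A : Type*} [Ring A] (gr : ZMod 2 → AddSubgroup A) : Prop
    extends SetLike.GradedMonoid gr where
  isInternal : DirectSum.IsInternal gr
  supercomm : ∀ {i j : ZMod 2} {a b : A}, a ∈ gr i → b ∈ gr j →
    a * b = (-1) ^ (i.val * j.val) * (b * a)

/-- `gr` makes the right `A`-module `M` (a module over the opposite ring) into a right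
supermodule: `M = M₀ ⊕ M₁` and `Mᵢ Aⱼ ⊆ Mᵢ₊ⱼ`. -/
structure IsSuperModule {A : Type*} [Ring A] (grA : ZMod 2 → AddSubgroup A)
    {M : Type*} [AddCommGroup M] [Module Aᵐᵒᵖ M] (gr : ZMod 2 → AddSubgroup M) : Prop where
  isInternal : DirectSum.IsInternal gr
  smul_mem : ∀ {i j : ZMod 2} {m : M} {a : A}, m ∈ gr i → a ∈ grA j →
    MulOpposite.op a • m ∈ gr (i + j)

/-- A supercommutative superring. -/
structure SuperRing where
  carrier : Type u
  [ring : Ring carrier]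
  gr : ZMod 2 → AddSubgroup carrier
  isSuperRing : IsSuperRing gr

instance : CoeSort SuperRing.{u} (Type u) := ⟨SuperRing.carrier⟩

attribute [instance] SuperRing.ring

/-- A (left) ideal is homogeneous if it is the sum of its even and its odd part. In a
supercommutative superring a homogeneous left ideal is two-sided. -/
def SuperRing.IsHomogeneous (A : SuperRing.{u}) (I : Ideal A) : Prop :=
  ∀ a ∈ I, ∃ b ∈ A.gr 0, ∃ c ∈ A.gr 1, b ∈ I ∧ c ∈ I ∧ b + c = a

/-- A local superring has exactly one maximal homogeneous ideal, i.e. exactly one ideal that is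
maximal among the proper homogeneous ideals. -/
def SuperRing.IsLocal (A : SuperRing.{u}) : Prop :=
  ∃! m : Ideal A, Maximal (fun I : Ideal A => A.IsHomogeneous I ∧ I ≠ ⊤) m

/-- A right supermodule over the superring `A`. -/
structure SuperModule (A : SuperRing.{u}) where
  carrier : Type u
  [addCommGroup : AddCommGroup carrier]
  [module : Module (A.carrier)ᵐᵒᵖ carrier]
  gr : ZMod 2 → AddSubgroup carrier
  isSuperModule : IsSuperModule A.gr gr

namespace SuperModule

instance (A : SuperRing.{u}) : CoeSort (SuperModule A) (Type u) := ⟨SuperModule.carrier⟩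

attribute [instance] SuperModule.addCommGroup SuperModule.module

variable {A : SuperRing.{u}}

/-- Homomorphisms of right supermodules: right linear maps that preserve the parity. -/
@[ext]
structure Hom (M N : SuperModule A) where
  hom : M →ₗ[Aᵐᵒᵖ] N
  map_mem : ∀ {i : ZMod 2} {m : M}, m ∈ M.gr i → hom m ∈ N.gr i

instance : Category (SuperModule A) where
  Hom := Hom
  id M := ⟨LinearMap.id, fun h => h⟩
  comp f g := ⟨g.hom.comp f.hom, fun h => g.map_mem (f.map_mem h)⟩

/-- The free right supermodule `A^(I|J) = (⨁_I A) ⊕ (⨁_J ΠA)`, where `ΠA` is `A` with the two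
homogeneous components interchanged. -/
def free (A : SuperRing.{u}) (I J : Type u) : SuperModule A where
  carrier := (I →₀ A) × (J →₀ A)
  gr k :=
    { carrier := {v | (∀ i, v.1 i ∈ A.gr k) ∧ ∀ j, v.2 j ∈ A.gr (k + 1)}
      zero_mem' := ⟨fun _ => zero_mem _, fun _ => zero_mem _⟩
      add_mem' := fun h h' =>
        ⟨fun i => add_mem (h.1 i) (h'.1 i), fun j => add_mem (h.2 j) (h'.2 j)⟩
      neg_mem' := fun h => ⟨fun i => neg_mem (h.1 i), fun j => neg_mem (h.2 j)⟩ }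
  isSuperModule :=
    { isInternal := by
        have hA := A.isSuperRing.isInternal
        refine isInternal_of_forall ?_ ?_
        · rintro ⟨v, w⟩
          have key : ∀ x : A, x - evenPart hA x ∈ A.gr 1 ∧ evenPart hA x ∈ A.gr 0 := by
            intro x
            obtain ⟨y, hy, z, hz, rfl⟩ := exists_add hA x
            rw [map_add, evenPart_even hA hy, evenPart_odd hA hz]
            simpa using ⟨hz, hy⟩
          refine ⟨(Finsupp.mapRange.addMonoidHom (evenPart hA) v, 
            w - Finsupp.mapRange.addMonoidHom (evenPart hA) w), ⟨fun i => ?_, fun j => ?_⟩,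
            (v - Finsupp.mapRange.addMonoidHom (evenPart hA) v, 
            Finsupp.mapRange.addMonoidHom (evenPart hA) w), ⟨fun i => ?_, fun j => ?_⟩, ?_⟩
          · exact (key _).2
          · exact (key _).1
          · exact (key _).1
          · exact (key _).2
          · simp
        · rintro ⟨v, w⟩ ⟨h1, h2⟩ ⟨h3, h4⟩
          refine Prod.ext (Finsupp.ext fun i => eq_zero_of_mem hA (h1 i) (h3 i))
            (Finsupp.ext fun j => eq_zero_of_mem hA (h4 j) (h2 j))
      smul_mem := by
        rintro i j ⟨v, w⟩ a ⟨h1, h2⟩ ha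
        refine ⟨fun k => A.isSuperRing.mul_mem (h1 k) ha, fun k => ?_⟩
        have := A.isSuperRing.mul_mem (h2 k) ha
        rwa [add_right_comm] at this }

/-- A right supermodule is superprojective if it is a direct summand (a retract, in the category
of right supermodules) of a free right supermodule. -/
def IsSuperprojective (M : SuperModule A) : Prop :=
  ∃ I J : Type u, Nonempty (Retract M (free A I J))

variable (A) in
/-- The finitely generated superprojective right supermodules. -/
def fgsp : ObjectProperty (SuperModule A) := fun M =>
  Module.Finite Aᵐᵒᵖ M ∧ M.IsSuperprojective

end SuperModule

/-! ### Tensor products over a noncommutative ring -/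

section Tensor

variable {A B B' B'' M M' M'' : Type u} [Ring A] [Ring B] [Ring B'] [Ring B'']
  [AddCommGroup M] [Module Aᵐᵒᵖ M] [AddCommGroup M'] [Module Aᵐᵒᵖ M']
  [AddCommGroup M''] [Module Aᵐᵒᵖ M'']

/-- The subgroup of `M ⊗_ℤ B` (with the factors written in the order `B`, `M`) generated by the
elements `(m a) ⊗ b - m ⊗ (φ(a) b)`. It is stable under the right action of `B`. -/
def tensorRel (M : Type u) [AddCommGroup M] [Module Aᵐᵒᵖ M] (φ : A →+* B) :
    Submodule Bᵐᵒᵖ (B ⊗[ℤ] M) where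
  toAddSubmonoid := (AddSubgroup.closure
    {t | ∃ (m : M) (a : A) (b : B), t = b ⊗ₜ (MulOpposite.op a • m) - (φ a * b) ⊗ₜ m}).toAddSubmonoid
  smul_mem' := by
    intro c x hx
    change c • x ∈ AddSubgroup.closure _
    induction hx using AddSubgroup.closure_induction with
    | mem x hx =>
      obtain ⟨m, a, b, rfl⟩ := hx
      refine AddSubgroup.subset_closure ⟨m, a, c • b, ?_⟩
      rw [smul_sub, TensorProduct.smul_tmul', TensorProduct.smul_tmul', mul_smul_comm]
    | zero => rw [smul_zero]; exact zero_mem _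
    | add x y _ _ hx hy => rw [smul_add]; exact add_mem hx hy
    | neg x _ hx => rw [smul_neg]; exact neg_mem hx

/-- The tensor product `M ⊗_A B` of a right `A`-module `M` with a ring `B` that is regarded as a
left `A`-module through `φ : A → B`; it is a right `B`-module. -/
abbrev Tensor (M : Type u) [AddCommGroup M] [Module Aᵐᵒᵖ M] (φ : A →+* B) : Type u :=
  (B ⊗[ℤ] M) ⧸ tensorRel M φ

/-- The pure tensor `m ⊗ b` in `M ⊗_A B`. -/
def tmk (φ : A →+* B) (m : M) (b : B) : Tensor M φ := Submodule.Quotient.mk (b ⊗ₜ[ℤ] m)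

theorem tmk_smul (φ : A →+* B) (m : M) (b c : B) :
    MulOpposite.op c • tmk φ m b = tmk φ m (b * c) := rfl

theorem smul_tmk (φ : A →+* B) (m : M) (a : A) (b : B) :
    tmk φ (MulOpposite.op a • m) b = tmk φ m (φ a * b) :=
  (Submodule.Quotient.eq _).2 (AddSubgroup.subset_closure ⟨m, a, b, rfl⟩)

theorem tmk_add (φ : A →+* B) (m : M) (b b' : B) :
    tmk φ m (b + b') = tmk φ m b + tmk φ m b' := by
  unfold tmk; rw [TensorProduct.add_tmul]; rfl

theorem add_tmk (φ : A →+* B) (m m' : M) (b : B) :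
    tmk φ (m + m') b = tmk φ m b + tmk φ m' b := by
  unfold tmk; rw [TensorProduct.tmul_add]; rfl

theorem tensor_induction {φ : A →+* B} {p : Tensor M φ → Prop} (h0 : p 0)
    (hadd : ∀ x y, p x → p y → p (x + y)) (h : ∀ m b, p (tmk φ m b)) (x : Tensor M φ) : p x := by
  obtain ⟨x, rfl⟩ := Submodule.Quotient.mk_surjective _ x
  induction x using TensorProduct.induction_on with
  | zero => exact h0
  | tmul b m => exact h m b
  | add x y hx hy => exact hadd _ _ hx hy

theorem tensor_hom_ext {φ : A →+* B} {N : Type*} [AddCommGroup N] {f g : Tensor M φ →+ N}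
    (h : ∀ m b, f (tmk φ m b) = g (tmk φ m b)) : f = g := by
  ext x
  induction x using tensor_induction with
  | h0 => rw [map_zero, map_zero]
  | hadd x y hx hy => rw [map_add, map_add, hx, hy]
  | h m b => exact h m b

/-- Additive maps out of `M ⊗_A B`. -/
def tensorLift (φ : A →+* B) {N : Type*} [AddCommGroup N] (f : B ⊗[ℤ] M →+ N)
    (hf : ∀ (m : M) (a : A) (b : B), f (b ⊗ₜ (MulOpposite.op a • m)) = f ((φ a * b) ⊗ₜ m)) :
    Tensor M φ →+ N :=
  QuotientAddGroup.lift (tensorRel M φ).toAddSubgroup f (by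
    change AddSubgroup.closure _ ≤ f.ker
    rw [AddSubgroup.closure_le]
    rintro _ ⟨m, a, b, rfl⟩
    change f _ = 0
    rw [map_sub, hf, sub_self])

theorem tensorLift_tmk (φ : A →+* B) {N : Type*} [AddCommGroup N] (f : B ⊗[ℤ] M →+ N)
    (hf : ∀ (m : M) (a : A) (b : B), f (b ⊗ₜ (MulOpposite.op a • m)) = f ((φ a * b) ⊗ₜ m))
    (m : M) (b : B) : tensorLift φ f hf (tmk φ m b) = f (b ⊗ₜ m) := rfl

/-- The map `f ⊗ g : M ⊗_A B → M' ⊗_A B'`. -/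
def tensorMap {φ : A →+* B} {φ' : A →+* B'} (f : M →ₗ[Aᵐᵒᵖ] M') (g : B →+* B')
    (h : g.comp φ = φ') : Tensor M φ →+ Tensor M' φ' :=
  tensorLift φ (((tensorRel M' φ').mkQ.toAddMonoidHom).comp
    (TensorProduct.map g.toAddMonoidHom.toIntLinearMap
      f.toAddMonoidHom.toIntLinearMap).toAddMonoidHom) (by
    subst h
    intro m a b
    have := smul_tmk (g.comp φ) (f m) a (g b)
    rw [← f.map_smul, RingHom.comp_apply, ← g.map_mul] at this
    exact this)

theorem tensorMap_tmk {φ : A →+* B} {φ' : A →+* B'} (f : M →ₗ[Aᵐᵒᵖ] M') (g : B →+* B')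
    (h : g.comp φ = φ') (m : M) (b : B) :
    tensorMap f g h (tmk φ m b) = tmk φ' (f m) (g b) := rfl

theorem tensorMap_smul {φ : A →+* B} {φ' : A →+* B'} (f : M →ₗ[Aᵐᵒᵖ] M') (g : B →+* B')
    (h : g.comp φ = φ') (c : B) (x : Tensor M φ) :
    tensorMap f g h (MulOpposite.op c • x) = MulOpposite.op (g c) • tensorMap f g h x := by
  induction x using tensor_induction with
  | h0 => simp
  | hadd x y hx hy => rw [smul_add, map_add, hx, hy, map_add, smul_add]
  | h m b => rw [tmk_smul, tensorMap_tmk, tensorMap_tmk, tmk_smul, g.map_mul]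

/-- The grading of `M ⊗_A B`: the component of degree `k` is generated by the elements `m ⊗ b` with
`m`, `b` homogeneous and `|m| + |b| = k`. -/
def tensorGr (φ : A →+* B) (grM : ZMod 2 → AddSubgroup M) (grB : ZMod 2 → AddSubgroup B)
    (k : ZMod 2) : AddSubgroup (Tensor M φ) :=
  AddSubgroup.closure {t | ∃ i j, i + j = k ∧ ∃ m ∈ grM i, ∃ b ∈ grB j, t = tmk φ m b}

theorem tmk_mem_tensorGr (φ : A →+* B) {grM : ZMod 2 → AddSubgroup M}
    {grB : ZMod 2 → AddSubgroup B} {i j k : ZMod 2} (hk : i + j = k) {m : M} {b : B}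
    (hm : m ∈ grM i) (hb : b ∈ grB j) : tmk φ m b ∈ tensorGr φ grM grB k :=
  AddSubgroup.subset_closure ⟨i, j, hk, m, hm, b, hb, rfl⟩

theorem isSuperModule_tensor {φ : A →+* B} {grA : ZMod 2 → AddSubgroup A}
    {grB : ZMod 2 → AddSubgroup B} {grM : ZMod 2 → AddSubgroup M}
    (hA : IsSuperRing grA) (hB : IsSuperRing grB) (hM : IsSuperModule grA grM)
    (hφ : ∀ {i a}, a ∈ grA i → φ a ∈ grB i) :
    IsSuperModule grB (tensorGr φ grM grB) where
  isInternal := by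
    refine isInternal_of_forall ?_ ?_
    · intro x
      induction x using tensor_induction with
      | h0 => exact ⟨0, zero_mem _, 0, zero_mem _, add_zero _⟩
      | hadd x y hx hy =>
        obtain ⟨y1, hy1, z1, hz1, rfl⟩ := hx
        obtain ⟨y2, hy2, z2, hz2, rfl⟩ := hy
        exact ⟨_, add_mem hy1 hy2, _, add_mem hz1 hz2, add_add_add_comm _ _ _ _⟩
      | h m b =>
        obtain ⟨m0, hm0, m1, hm1, rfl⟩ := exists_add hM.isInternal m
        obtain ⟨b0, hb0, b1, hb1, rfl⟩ := exists_add hB.isInternal b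
        refine ⟨tmk φ m0 b0 + tmk φ m1 b1, add_mem (tmk_mem_tensorGr φ (by decide) hm0 hb0)
          (tmk_mem_tensorGr φ (by decide) hm1 hb1), tmk φ m0 b1 + tmk φ m1 b0,
          add_mem (tmk_mem_tensorGr φ (by decide) hm0 hb1)
          (tmk_mem_tensorGr φ (by decide) hm1 hb0), ?_⟩
        rw [tmk_add, add_tmk, add_tmk]
        abel
    · let eM := evenPart hM.isInternal
      let eB := evenPart hB.isInternal
      let f : B ⊗[ℤ] M →+ Tensor M φ := ((tensorRel M φ).mkQ.toAddMonoidHom).comp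
        (TensorProduct.map eB.toIntLinearMap eM.toIntLinearMap +
        TensorProduct.map (AddMonoidHom.id B - eB).toIntLinearMap
          (AddMonoidHom.id M - eM).toIntLinearMap).toAddMonoidHom
      have hf : ∀ m b, f (b ⊗ₜ m) = tmk φ (eM m) (eB b) + tmk φ (m - eM m) (b - eB b) :=
        fun m b => rfl
      have e0M : ∀ {m}, m ∈ grM 0 → eM m = m := evenPart_even hM.isInternal
      have e1M : ∀ {m}, m ∈ grM 1 → eM m = 0 := evenPart_odd hM.isInternal
      have e0B : ∀ {m}, m ∈ grB 0 → eB m = m := evenPart_even hB.isInternal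
      have e1B : ∀ {m}, m ∈ grB 1 → eB m = 0 := evenPart_odd hB.isInternal
      have z1 : ∀ b, tmk φ (0 : M) b = 0 := fun b => by
        have := add_tmk φ (0 : M) 0 b
        simpa using this
      have z2 : ∀ m : M, tmk φ m (0 : B) = 0 := fun b => by
        have := tmk_add φ b (0 : B) 0
        simpa using this
      have hfrel : ∀ (m : M) (a : A) (b : B),
          f (b ⊗ₜ (MulOpposite.op a • m)) = f ((φ a * b) ⊗ₜ m) := by
        intro m a b
        obtain ⟨m0, hm0, m1, hm1, rfl⟩ := exists_add hM.isInternal m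
        obtain ⟨b0, hb0, b1, hb1, rfl⟩ := exists_add hB.isInternal b
        obtain ⟨a0, ha0, a1, ha1, rfl⟩ := exists_add hA.isInternal a
        have key : ∀ {i j k : ZMod 2} {m : M} {a : A} {b : B}, m ∈ grM i → a ∈ grA j → b ∈ grB k →
            f (b ⊗ₜ (MulOpposite.op a • m)) = f ((φ a * b) ⊗ₜ m) := by
          intro i j k m a b hm ha hb
          have h1 := hM.smul_mem hm ha
          have h2 := hB.mul_mem (hφ ha) hb
          rw [hf, hf]
          have c : ∀ i : ZMod 2, i = 0 ∨ i = 1 := by decide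
          rcases c i with rfl | rfl <;> rcases c j with rfl | rfl <;> rcases c k with rfl | rfl <;>
            simp only [add_zero, zero_add, show (1 : ZMod 2) + 1 = 0 from by decide] at h1 h2 <;>
            simp only [e0M, e1M, e0B, e1B, hm, hb, h1, h2, sub_self, sub_zero, z1, z2, smul_tmk,
              add_zero, zero_add]
        simp only [MulOpposite.op_add, add_smul, smul_add, map_add, add_mul, mul_add,
          TensorProduct.add_tmul, TensorProduct.tmul_add]
        rw [key hm0 ha0 hb0, key hm0 ha0 hb1, key hm0 ha1 hb0, key hm0 ha1 hb1,
          key hm1 ha0 hb0, key hm1 ha0 hb1, key hm1 ha1 hb0, key hm1 ha1 hb1]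
        abel
      let p := tensorLift φ f hfrel
      have hp : ∀ m b, p (tmk φ m b) = tmk φ (eM m) (eB b) + tmk φ (m - eM m) (b - eB b) := hf
      have c : ∀ i : ZMod 2, i = 0 ∨ i = 1 := by decide
      have p0 : ∀ x ∈ tensorGr φ grM grB 0, p x = x := by
        intro x hx
        induction hx using AddSubgroup.closure_induction with
        | mem x hx =>
          obtain ⟨i, j, hij, m, hm, b, hb, rfl⟩ := hx
          rw [hp]
          rcases c i with rfl | rfl <;> rcases c j with rfl | rfl
          · simp [e0M hm, e0B hb, z1]
          · exact absurd hij (by decide)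
          · exact absurd hij (by decide)
          · simp [e1M hm, e1B hb, z1]
        | zero => exact map_zero p
        | add x y _ _ hx hy => rw [map_add, hx, hy]
        | neg x _ hx => rw [map_neg, hx]
      have p1 : ∀ x ∈ tensorGr φ grM grB 1, p x = 0 := by
        intro x hx
        induction hx using AddSubgroup.closure_induction with
        | mem x hx =>
          obtain ⟨i, j, hij, m, hm, b, hb, rfl⟩ := hx
          rw [hp]
          rcases c i with rfl | rfl <;> rcases c j with rfl | rfl
          · exact absurd hij (by decide)
          · simp [e0M hm, e1B hb, z1, z2]
          · simp [e1M hm, e0B hb, z1, z2]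
          · exact absurd hij (by decide)
        | zero => exact map_zero p
        | add x y _ _ hx hy => rw [map_add, hx, hy, add_zero]
        | neg x _ hx => rw [map_neg, hx, neg_zero]
      intro x h0 h1
      rw [← p0 x h0, p1 x h1]
  smul_mem := by
    intro k l x c hx hc
    induction hx using AddSubgroup.closure_induction with
    | mem x hx =>
      obtain ⟨i, j, rfl, m, hm, b, hb, rfl⟩ := hx
      rw [tmk_smul, add_assoc]
      exact tmk_mem_tensorGr φ rfl hm (hB.mul_mem hb hc)
    | zero => rw [smul_zero]; exact zero_mem _
    | add x y _ _ hx hy => rw [smul_add]; exact add_mem hx hy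
    | neg x _ hx => rw [smul_neg]; exact neg_mem hx

theorem tensorMap_mem {φ : A →+* B} {φ' : A →+* B'} (f : M →ₗ[Aᵐᵒᵖ] M') (g : B →+* B')
    (h : g.comp φ = φ') {grM : ZMod 2 → AddSubgroup M} {grB : ZMod 2 → AddSubgroup B}
    {grM' : ZMod 2 → AddSubgroup M'} {grB' : ZMod 2 → AddSubgroup B'}
    (hf : ∀ {i m}, m ∈ grM i → f m ∈ grM' i) (hg : ∀ {i b}, b ∈ grB i → g b ∈ grB' i)
    {k : ZMod 2} {x : Tensor M φ} (hx : x ∈ tensorGr φ grM grB k) :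
    tensorMap f g h x ∈ tensorGr φ' grM' grB' k := by
  induction hx using AddSubgroup.closure_induction with
  | mem x hx =>
    obtain ⟨i, j, hij, m, hm, b, hb, rfl⟩ := hx
    rw [tensorMap_tmk]
    exact tmk_mem_tensorGr φ' hij (hf hm) (hg hb)
  | zero => rw [map_zero]; exact zero_mem _
  | add x y _ _ hx hy => rw [map_add]; exact add_mem hx hy
  | neg x _ hx => rw [map_neg]; exact neg_mem hx

end Tensor

/-! ### Ringed superspaces and sheaves of supermodules -/

/-- The functor that sends a ring to its opposite ring. -/
def ringOp : RingCat.{u} ⥤ RingCat.{u} where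
  obj R := RingCat.of Rᵐᵒᵖ
  map f := RingCat.ofHom (RingHom.op f.hom)

instance : ringOp.{u}.IsEquivalence :=
  (CategoryTheory.Equivalence.mk ringOp ringOp
    (NatIso.ofComponents (fun R => (RingEquiv.opOp R).toRingCatIso) (fun _ => rfl))
    (NatIso.ofComponents (fun R => (RingEquiv.opOp R).symm.toRingCatIso)
      (fun _ => rfl))).isEquivalence_functor

/-- A ringed superspace: a topological space with a sheaf of supercommutative superrings, i.e. a
sheaf of rings whose rings of sections are superrings, with parity-preserving restrictions. -/
structure RingedSuperspace where
  space : TopCat.{u}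
  ringSheaf : TopCat.Sheaf RingCat.{u} space
  gr : ∀ U : (Opens space)ᵒᵖ, ZMod 2 → AddSubgroup (ringSheaf.presheaf.obj U)
  isSuperRing : ∀ U, IsSuperRing (gr U)
  map_mem : ∀ {U V : (Opens space)ᵒᵖ} (f : U ⟶ V) {i : ZMod 2} {a : ringSheaf.presheaf.obj U},
    a ∈ gr U i → ringSheaf.presheaf.map f a ∈ gr V i

namespace RingedSuperspace

variable (X : RingedSuperspace.{u})

/-- The structure sheaf, as a presheaf. -/
abbrev O : TopCat.Presheaf RingCat.{u} X.space := X.ringSheaf.presheaf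

/-- The superring of sections of the structure sheaf over an open set. -/
def sections (U : (Opens X.space)ᵒᵖ) : SuperRing.{u} where
  carrier := X.O.obj U
  gr := X.gr U
  isSuperRing := X.isSuperRing U

/-- The superring `A = Γ(X, O_X)` of global sections. -/
abbrev globalSections : SuperRing.{u} := X.sections (op ⊤)

/-- The homogeneous components of the stalk `O_{X,x}`: the germs of homogeneous sections. -/
def stalkGr (x : X.space) (i : ZMod 2) : AddSubgroup (X.O.stalk x) where
  carrier := {t | ∃ (U : Opens X.space) (hx : x ∈ U) (a : X.O.obj (op U)),
    a ∈ X.gr (op U) i ∧ X.O.germ U x hx a = t}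
  zero_mem' := ⟨⊤, trivial, 0, zero_mem _, map_zero _⟩
  add_mem' := by
    rintro _ _ ⟨U, hU, a, ha, rfl⟩ ⟨V, hV, b, hb, rfl⟩
    have hUV : x ∈ U ⊓ V := ⟨hU, hV⟩
    refine ⟨U ⊓ V, hUV, X.O.map (Opens.infLELeft U V).op a + X.O.map (Opens.infLERight U V).op b,
      add_mem (X.map_mem _ ha) (X.map_mem _ hb), ?_⟩
    rw [map_add, TopCat.Presheaf.germ_res_apply, TopCat.Presheaf.germ_res_apply]
  neg_mem' := by
    rintro _ ⟨U, hU, a, ha, rfl⟩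
    exact ⟨U, hU, -a, neg_mem ha, map_neg _ _⟩

theorem germ_mem_stalkGr {x : X.space} (U : Opens X.space) (hx : x ∈ U) {i : ZMod 2}
    {a : X.O.obj (op U)} (ha : a ∈ X.gr (op U) i) : X.O.germ U x hx a ∈ X.stalkGr x i :=
  ⟨U, hx, a, ha, rfl⟩

theorem exists_common {x : X.space} {i j : ZMod 2} {s t : X.O.stalk x} (hs : s ∈ X.stalkGr x i)
    (ht : t ∈ X.stalkGr x j) : ∃ (U : Opens X.space) (hx : x ∈ U) (a b : X.O.obj (op U)),
      a ∈ X.gr (op U) i ∧ b ∈ X.gr (op U) j ∧ X.O.germ U x hx a = s ∧ X.O.germ U x hx b = t := by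
  obtain ⟨U, hU, a, ha, rfl⟩ := hs
  obtain ⟨V, hV, b, hb, rfl⟩ := ht
  have hUV : x ∈ U ⊓ V := ⟨hU, hV⟩
  exact ⟨U ⊓ V, hUV, X.O.map (Opens.infLELeft U V).op a, X.O.map (Opens.infLERight U V).op b,
    X.map_mem _ ha, X.map_mem _ hb, TopCat.Presheaf.germ_res_apply _ _ _ _ _,
    TopCat.Presheaf.germ_res_apply _ _ _ _ _⟩

theorem isSuperRing_stalk (x : X.space) : IsSuperRing (X.stalkGr x) where
  one_mem := ⟨⊤, trivial, 1, (X.isSuperRing _).one_mem, map_one _⟩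
  mul_mem := by
    intro i j s t hs ht
    obtain ⟨U, hx, a, b, ha, hb, rfl, rfl⟩ := X.exists_common hs ht
    exact ⟨U, hx, a * b, (X.isSuperRing _).mul_mem ha hb, map_mul _ _ _⟩
  isInternal := by
    refine isInternal_of_forall ?_ ?_
    · intro t
      obtain ⟨U, hx, s, rfl⟩ := X.O.exists_germ_eq t
      obtain ⟨a, ha, b, hb, rfl⟩ := exists_add (X.isSuperRing (op U)).isInternal s
      exact ⟨_, ⟨U, hx, a, ha, rfl⟩, _, ⟨U, hx, b, hb, rfl⟩, (map_add _ _ _).symm⟩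
    · intro t h0 h1
      obtain ⟨U, hx, a, b, ha, hb, rfl, hba⟩ := X.exists_common h0 h1
      obtain ⟨W, hW, i, i', e⟩ := X.O.germ_eq x hx hx _ _ hba
      have h2 := X.map_mem i.op hb
      rw [e] at h2
      have := eq_zero_of_mem (X.isSuperRing _).isInternal (X.map_mem i'.op ha) h2
      rw [← TopCat.Presheaf.germ_res_apply X.O i' x hW, this, map_zero]
  supercomm := by
    intro i j s t hs ht
    obtain ⟨U, hx, a, b, ha, hb, rfl, rfl⟩ := X.exists_common hs ht
    rw [← map_mul, (X.isSuperRing _).supercomm ha hb]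
    simp only [map_mul, map_pow, map_neg, map_one]

/-- The stalk `O_{X,x}`, as a superring. -/
def stalk (x : X.space) : SuperRing.{u} where
  carrier := X.O.stalk x
  gr := X.stalkGr x
  isSuperRing := X.isSuperRing_stalk x

/-- A locally ringed superspace is a ringed superspace all of whose stalks are local superrings. -/
def IsLocallyRinged : Prop := ∀ x : X.space, (X.stalk x).IsLocal

end RingedSuperspace

/-- A presheaf of right supermodules over the structure sheaf of a ringed superspace. -/
structure SuperPresheaf (X : RingedSuperspace.{u}) where
  presheaf : TopCat.Presheaf AddCommGrpCat.{u} X.space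
  [module : ∀ U : (Opens X.space)ᵒᵖ, Module (X.O.obj U)ᵐᵒᵖ (presheaf.obj U)]
  map_smul : ∀ {U V : (Opens X.space)ᵒᵖ} (f : U ⟶ V) (a : X.O.obj U) (s : presheaf.obj U),
    presheaf.map f (MulOpposite.op a • s) = MulOpposite.op (X.O.map f a) • presheaf.map f s
  gr : ∀ U : (Opens X.space)ᵒᵖ, ZMod 2 → AddSubgroup (presheaf.obj U)
  isSuperModule : ∀ U, IsSuperModule (X.gr U) (gr U)
  map_mem : ∀ {U V : (Opens X.space)ᵒᵖ} (f : U ⟶ V) {i : ZMod 2} {s : presheaf.obj U},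
    s ∈ gr U i → presheaf.map f s ∈ gr V i

attribute [instance] SuperPresheaf.module

namespace SuperPresheaf

variable {X : RingedSuperspace.{u}}

/-- A homomorphism of presheaves of right supermodules: a morphism of presheaves that is right
linear and parity-preserving over every open set. -/
@[ext]
structure Hom (F G : SuperPresheaf X) where
  hom : F.presheaf ⟶ G.presheaf
  map_smul : ∀ (U : (Opens X.space)ᵒᵖ) (a : X.O.obj U) (s : F.presheaf.obj U),
    hom.app U (MulOpposite.op a • s) = MulOpposite.op a • hom.app U s
  map_mem : ∀ {U : (Opens X.space)ᵒᵖ} {i : ZMod 2} {s : F.presheaf.obj U},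
    s ∈ F.gr U i → hom.app U s ∈ G.gr U i

instance : Category (SuperPresheaf X) where
  Hom := Hom
  id F := ⟨𝟙 _, fun _ _ _ => rfl, fun h => h⟩
  comp f g := ⟨f.hom ≫ g.hom, fun U a s => by
      rw [NatTrans.comp_app, AddCommGrpCat.comp_apply, AddCommGrpCat.comp_apply, f.map_smul,
        g.map_smul],
    fun h => g.map_mem (f.map_mem h)⟩

/-- The supermodule of sections over an open set. -/
def sections (F : SuperPresheaf X) (U : (Opens X.space)ᵒᵖ) : SuperModule (X.sections U) where
  carrier := F.presheaf.obj U
  module := F.module U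
  gr := F.gr U
  isSuperModule := F.isSuperModule U

/-- The presheaf `O_X^(I|J)` with sections `O_X^(I|J)(U) = O_X(U)^(I|J)`; it is a sheaf if `I` and
`J` are finite. -/
def free (X : RingedSuperspace.{u}) (I J : Type u) : SuperPresheaf X where
  presheaf :=
    { obj := fun U => AddCommGrpCat.of (SuperModule.free (X.sections U) I J)
      map := fun {U V} f => AddCommGrpCat.ofHom (AddMonoidHom.prodMap
        (Finsupp.mapRange.addMonoidHom (X.O.map f).hom.toAddMonoidHom)
        (Finsupp.mapRange.addMonoidHom (X.O.map f).hom.toAddMonoidHom))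
      map_id := by
        intro U
        ext x
        refine Prod.ext (Finsupp.ext fun i => ?_) (Finsupp.ext fun i => ?_)
        · exact congrArg (fun g : X.O.obj U ⟶ X.O.obj U => g (x.1 i)) (X.O.map_id U)
        · exact congrArg (fun g : X.O.obj U ⟶ X.O.obj U => g (x.2 i)) (X.O.map_id U)
      map_comp := by
        intro U V W f g
        ext x
        refine Prod.ext (Finsupp.ext fun i => ?_) (Finsupp.ext fun i => ?_)
        · exact congrArg (fun g : X.O.obj U ⟶ X.O.obj W => g (x.1 i)) (X.O.map_comp f g)
        · exact congrArg (fun g : X.O.obj U ⟶ X.O.obj W => g (x.2 i)) (X.O.map_comp f g) }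
  module U := (SuperModule.free (X.sections U) I J).module
  map_smul {U V} f a s := Prod.ext (Finsupp.ext fun i => map_mul (X.O.map f).hom (s.1 i) a)
    (Finsupp.ext fun i => map_mul (X.O.map f).hom (s.2 i) a)
  gr U := (SuperModule.free (X.sections U) I J).gr
  isSuperModule U := (SuperModule.free (X.sections U) I J).isSuperModule
  map_mem f _ _ h := ⟨fun i => X.map_mem f (h.1 i), fun j => X.map_mem f (h.2 j)⟩

/-- An isomorphism `F|_U ≅ G|_U` of presheaves of right `O_X|_U`-supermodules: isomorphisms
`F(V) ≅ G(V)` of right `O_X(V)`-supermodules for all open `V ⊆ U`, compatible with the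
restrictions. -/
structure IsoOn (U : Opens X.space) (F G : SuperPresheaf X) where
  iso : ∀ V : Opens X.space, V ≤ U → (F.sections (op V) ≅ G.sections (op V))
  map_iso : ∀ {V W : Opens X.space} (hV : V ≤ U) (i : W ⟶ V) (s : F.presheaf.obj (op V)),
    G.presheaf.map i.op ((iso V hV).hom.hom s) =
      (iso W (i.le.trans hV)).hom.hom (F.presheaf.map i.op s)

/-! #### Stalks -/

/-- The right `O_{X,x}`-module structure on the stalk of a presheaf of supermodules. -/
instance stalkModule (F : SuperPresheaf X) (x : X.space) :
    Module (X.O.stalk x)ᵐᵒᵖ (F.presheaf.stalk x) :=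
  letI (i : (OpenNhds x)ᵒᵖ) : Module ((((OpenNhds.inclusion x).op ⋙ X.O) ⋙ ringOp).obj i)
      (((OpenNhds.inclusion x).op ⋙ F.presheaf).obj i) := F.module _
  Limits.IsColimit.module (((OpenNhds.inclusion x).op ⋙ X.O) ⋙ ringOp)
    ((OpenNhds.inclusion x).op ⋙ F.presheaf)
    (fun f r m => F.map_smul ((OpenNhds.inclusion x).op.map f) r.unop m)
    (Limits.isColimitOfPreserves ringOp (Limits.colimit.isColimit _)) (Limits.colimit.isColimit _)

theorem germ_smul (F : SuperPresheaf X) {x : X.space} (U : Opens X.space) (hx : x ∈ U)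
    (a : X.O.obj (op U)) (s : F.presheaf.obj (op U)) :
    F.presheaf.germ U x hx (MulOpposite.op a • s) =
      MulOpposite.op (X.O.germ U x hx a) • F.presheaf.germ U x hx s :=
  letI (i : (OpenNhds x)ᵒᵖ) : Module ((((OpenNhds.inclusion x).op ⋙ X.O) ⋙ ringOp).obj i)
      (((OpenNhds.inclusion x).op ⋙ F.presheaf).obj i) := F.module _
  Limits.IsColimit.ι_smul (((OpenNhds.inclusion x).op ⋙ X.O) ⋙ ringOp)
    ((OpenNhds.inclusion x).op ⋙ F.presheaf)
    (fun f r m => F.map_smul ((OpenNhds.inclusion x).op.map f) r.unop m)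
    (Limits.isColimitOfPreserves ringOp (Limits.colimit.isColimit _)) (Limits.colimit.isColimit _)
    (op ⟨U, hx⟩) (MulOpposite.op a) s

/-- The homogeneous components of the stalk: the germs of homogeneous sections. -/
def stalkGr (F : SuperPresheaf X) (x : X.space) (i : ZMod 2) :
    AddSubgroup (F.presheaf.stalk x) where
  carrier := {t | ∃ (U : Opens X.space) (hx : x ∈ U) (a : F.presheaf.obj (op U)),
    a ∈ F.gr (op U) i ∧ F.presheaf.germ U x hx a = t}
  zero_mem' := ⟨⊤, trivial, 0, zero_mem _, map_zero _⟩
  add_mem' := by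
    rintro _ _ ⟨U, hU, a, ha, rfl⟩ ⟨V, hV, b, hb, rfl⟩
    have hUV : x ∈ U ⊓ V := ⟨hU, hV⟩
    refine ⟨U ⊓ V, hUV, F.presheaf.map (Opens.infLELeft U V).op a +
      F.presheaf.map (Opens.infLERight U V).op b,
      add_mem (F.map_mem _ ha) (F.map_mem _ hb), ?_⟩
    rw [map_add, TopCat.Presheaf.germ_res_apply, TopCat.Presheaf.germ_res_apply]
  neg_mem' := by
    rintro _ ⟨U, hU, a, ha, rfl⟩
    exact ⟨U, hU, -a, neg_mem ha, map_neg _ _⟩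

theorem germ_mem_stalkGr (F : SuperPresheaf X) {x : X.space} (U : Opens X.space) (hx : x ∈ U)
    {i : ZMod 2} {s : F.presheaf.obj (op U)} (hs : s ∈ F.gr (op U) i) :
    F.presheaf.germ U x hx s ∈ F.stalkGr x i := ⟨U, hx, s, hs, rfl⟩

theorem isSuperModule_stalk (F : SuperPresheaf X) (x : X.space) :
    IsSuperModule (X.stalkGr x) (F.stalkGr x) where
  isInternal := by
    refine isInternal_of_forall ?_ ?_
    · intro t
      obtain ⟨U, hx, s, rfl⟩ := F.presheaf.exists_germ_eq t
      obtain ⟨a, ha, b, hb, rfl⟩ := exists_add (F.isSuperModule (op U)).isInternal s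
      exact ⟨_, ⟨U, hx, a, ha, rfl⟩, _, ⟨U, hx, b, hb, rfl⟩, (map_add _ _ _).symm⟩
    · rintro t ⟨U, hU, a, ha, rfl⟩ ⟨V, hV, b, hb, hba⟩
      obtain ⟨W, hW, i, i', e⟩ := F.presheaf.germ_eq x hV hU _ _ hba
      have h2 := F.map_mem i.op hb
      rw [e] at h2
      have := eq_zero_of_mem (F.isSuperModule _).isInternal (F.map_mem i'.op ha) h2
      rw [← TopCat.Presheaf.germ_res_apply F.presheaf i' x hW, this, map_zero]
  smul_mem := by
    rintro i j _ _ ⟨U, hU, s, hs, rfl⟩ ⟨V, hV, a, ha, rfl⟩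
    have hUV : x ∈ U ⊓ V := ⟨hU, hV⟩
    refine ⟨U ⊓ V, hUV, MulOpposite.op (X.O.map (Opens.infLERight U V).op a) •
      F.presheaf.map (Opens.infLELeft U V).op s,
      (F.isSuperModule _).smul_mem (F.map_mem _ hs) (X.map_mem _ ha), ?_⟩
    rw [germ_smul, TopCat.Presheaf.germ_res_apply, TopCat.Presheaf.germ_res_apply]

/-- The map on stalks induced by a homomorphism. -/
def stalkMap {F G : SuperPresheaf X} (f : F ⟶ G) (x : X.space) :
    F.presheaf.stalk x →+ G.presheaf.stalk x :=
  ((TopCat.Presheaf.stalkFunctor AddCommGrpCat x).map f.hom).hom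

theorem stalkMap_germ {F G : SuperPresheaf X} (f : F ⟶ G) (U : Opens X.space) (x : X.space)
    (hx : x ∈ U) (s : F.presheaf.obj (op U)) :
    stalkMap f x (F.presheaf.germ U x hx s) = G.presheaf.germ U x hx (f.hom.app (op U) s) :=
  TopCat.Presheaf.stalkFunctor_map_germ_apply U x hx f.hom s

theorem stalkMap_smul {F G : SuperPresheaf X} (f : F ⟶ G) (x : X.space) (a : X.O.stalk x)
    (t : F.presheaf.stalk x) :
    stalkMap f x (MulOpposite.op a • t) = MulOpposite.op a • stalkMap f x t := by
  obtain ⟨U, hU, s, rfl⟩ := F.presheaf.exists_germ_eq t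
  obtain ⟨V, hVU, hV, a, rfl⟩ := X.O.exists_le_germ_eq a hU
  rw [← TopCat.Presheaf.germ_res_apply F.presheaf (homOfLE hVU) x hV, ← germ_smul,
    stalkMap_germ, stalkMap_germ, f.map_smul, germ_smul]

theorem stalkMap_mem {F G : SuperPresheaf X} (f : F ⟶ G) (x : X.space) {i : ZMod 2}
    {t : F.presheaf.stalk x} (ht : t ∈ F.stalkGr x i) :
    stalkMap f x t ∈ G.stalkGr x i := by
  obtain ⟨U, hU, s, hs, rfl⟩ := ht
  rw [stalkMap_germ]
  exact ⟨U, hU, _, f.map_mem hs, rfl⟩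

theorem stalkMap_id (F : SuperPresheaf X) (x : X.space) (t : F.presheaf.stalk x) :
    stalkMap (𝟙 F) x t = t := by
  obtain ⟨U, hU, s, rfl⟩ := F.presheaf.exists_germ_eq t
  rw [stalkMap_germ]
  rfl

theorem stalkMap_comp {F G H : SuperPresheaf X} (f : F ⟶ G) (g : G ⟶ H) (x : X.space)
    (t : F.presheaf.stalk x) : stalkMap (f ≫ g) x t = stalkMap g x (stalkMap f x t) := by
  obtain ⟨U, hU, s, rfl⟩ := F.presheaf.exists_germ_eq t
  rw [stalkMap_germ, stalkMap_germ, stalkMap_germ]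
  rfl

/-! #### Sheafification -/

/-- A family of germs over `U` is locally a germ if every point of `U` has a neighbourhood on which
the family consists of the germs of one section. -/
def IsLocallyGerm (F : SuperPresheaf X) {U : Opens X.space}
    (θ : ∀ x : U, F.presheaf.stalk (x : X.space)) : Prop :=
  ∀ x : U, ∃ (V : Opens X.space) (_ : (x : X.space) ∈ V) (hVU : V ≤ U)
    (s : F.presheaf.obj (op V)),
    ∀ y : V, θ ⟨y, hVU y.2⟩ = F.presheaf.germ V (y : X.space) y.2 s

theorem IsLocallyGerm.add {F : SuperPresheaf X} {U : Opens X.space}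
    {θ η : ∀ x : U, F.presheaf.stalk (x : X.space)} (h : F.IsLocallyGerm θ)
    (h' : F.IsLocallyGerm η) : F.IsLocallyGerm (fun x => θ x + η x) := by
  intro x
  obtain ⟨V, hV, hVU, s, hs⟩ := h x
  obtain ⟨W, hW, hWU, t, ht⟩ := h' x
  refine ⟨V ⊓ W, ⟨hV, hW⟩, inf_le_left.trans hVU,
    F.presheaf.map (Opens.infLELeft V W).op s + F.presheaf.map (Opens.infLERight V W).op t, ?_⟩
  rintro ⟨y, hy⟩
  rw [map_add, TopCat.Presheaf.germ_res_apply, TopCat.Presheaf.germ_res_apply]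
  exact congrArg₂ _ (hs ⟨y, hy.1⟩) (ht ⟨y, hy.2⟩)

theorem IsLocallyGerm.smul {F : SuperPresheaf X} {U : Opens X.space}
    {θ : ∀ x : U, F.presheaf.stalk (x : X.space)} (h : F.IsLocallyGerm θ) (a : X.O.obj (op U)) :
    F.IsLocallyGerm (fun x => MulOpposite.op (X.O.germ U (x : X.space) x.2 a) • θ x) := by
  intro x
  obtain ⟨V, hV, hVU, s, hs⟩ := h x
  refine ⟨V, hV, hVU, MulOpposite.op (X.O.map (homOfLE hVU).op a) • s, fun y => ?_⟩
  rw [germ_smul, TopCat.Presheaf.germ_res_apply]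
  exact congrArg _ (hs y)

/-- The families of germs over `U` that are locally germs of sections. -/
def sheafifySections (F : SuperPresheaf X) (U : Opens X.space) :
    AddSubgroup (∀ x : U, F.presheaf.stalk (x : X.space)) where
  carrier := {θ | F.IsLocallyGerm θ}
  zero_mem' := fun x => ⟨U, x.2, le_rfl, 0, fun y => (map_zero _).symm⟩
  add_mem' := IsLocallyGerm.add
  neg_mem' := by
    intro θ h x
    obtain ⟨V, hV, hVU, s, hs⟩ := h x
    exact ⟨V, hV, hVU, -s, fun y => (congrArg _ (hs y)).trans (map_neg _ _).symm⟩

instance sheafifyModule (F : SuperPresheaf X) (U : Opens X.space) :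
    Module (X.O.obj (op U))ᵐᵒᵖ (F.sheafifySections U) where
  smul a θ := ⟨fun x => MulOpposite.op (X.O.germ U (x : X.space) x.2 a.unop) • θ.1 x,
    IsLocallyGerm.smul θ.2 a.unop⟩
  one_smul θ := Subtype.ext (funext fun x => by
    change MulOpposite.op (X.O.germ U (x : X.space) x.2 1) • θ.1 x = θ.1 x
    rw [map_one, MulOpposite.op_one, one_smul])
  mul_smul a b θ := Subtype.ext (funext fun x => by
    change MulOpposite.op (X.O.germ U (x : X.space) x.2 (b.unop * a.unop)) • θ.1 x =
      MulOpposite.op (X.O.germ U (x : X.space) x.2 a.unop) •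
        MulOpposite.op (X.O.germ U (x : X.space) x.2 b.unop) • θ.1 x
    rw [map_mul, MulOpposite.op_mul, mul_smul])
  smul_zero a := Subtype.ext (funext fun x => smul_zero _)
  smul_add a θ η := Subtype.ext (funext fun x => smul_add _ _ _)
  add_smul a b θ := Subtype.ext (funext fun x => by
    change MulOpposite.op (X.O.germ U (x : X.space) x.2 (a.unop + b.unop)) • θ.1 x =
      MulOpposite.op (X.O.germ U (x : X.space) x.2 a.unop) • θ.1 x +
        MulOpposite.op (X.O.germ U (x : X.space) x.2 b.unop) • θ.1 x
    rw [map_add, MulOpposite.op_add, add_smul])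
  zero_smul θ := Subtype.ext (funext fun x => by
    change MulOpposite.op (X.O.germ U (x : X.space) x.2 0) • θ.1 x = 0
    rw [map_zero, MulOpposite.op_zero, zero_smul])

/-- The homogeneous components of the sheafification: the families of homogeneous germs. -/
def sheafifyGr (F : SuperPresheaf X) (U : Opens X.space) (i : ZMod 2) :
    AddSubgroup (F.sheafifySections U) where
  carrier := {θ | ∀ x : U, θ.1 x ∈ F.stalkGr (x : X.space) i}
  zero_mem' := fun _ => zero_mem _
  add_mem' := fun h h' x => add_mem (h x) (h' x)
  neg_mem' := fun h x => neg_mem (h x)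

theorem isSuperModule_sheafify (F : SuperPresheaf X) (U : Opens X.space) :
    IsSuperModule (X.gr (op U)) (F.sheafifyGr U) where
  isInternal := by
    refine isInternal_of_forall ?_ ?_
    · rintro ⟨θ, hθ⟩
      have h := fun x : U => exists_add (F.isSuperModule_stalk (x : X.space)).isInternal (θ x)
      choose y hy z hz e using h
      have key : ∀ x : U, ∃ (V : Opens X.space) (_ : (x : X.space) ∈ V) (hVU : V ≤ U)
          (s t : F.presheaf.obj (op V)), ∀ w : V,
            y ⟨w, hVU w.2⟩ = F.presheaf.germ V (w : X.space) w.2 s ∧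
            z ⟨w, hVU w.2⟩ = F.presheaf.germ V (w : X.space) w.2 t := by
        intro x
        obtain ⟨V, hV, hVU, s, hs⟩ := hθ x
        obtain ⟨a, ha, b, hb, rfl⟩ := exists_add (F.isSuperModule (op V)).isInternal s
        refine ⟨V, hV, hVU, a, b, fun w => ?_⟩
        have ha' := F.germ_mem_stalkGr V w.2 ha
        have hb' := F.germ_mem_stalkGr V w.2 hb
        have e' : y ⟨w, hVU w.2⟩ + z ⟨w, hVU w.2⟩ =
            F.presheaf.germ V (w : X.space) w.2 a + F.presheaf.germ V (w : X.space) w.2 b :=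
          ((e ⟨w, hVU w.2⟩).trans (hs w)).trans (map_add _ _ _)
        exact add_unique (F.isSuperModule_stalk (w : X.space)).isInternal (hy ⟨w, hVU w.2⟩) ha'
          (hz ⟨w, hVU w.2⟩) hb' e'
      refine ⟨⟨y, fun x => ?_⟩, hy, ⟨z, fun x => ?_⟩, hz, Subtype.ext (funext e)⟩
      · obtain ⟨V, hV, hVU, s, t, h⟩ := key x
        exact ⟨V, hV, hVU, s, fun w => (h w).1⟩
      · obtain ⟨V, hV, hVU, s, t, h⟩ := key x
        exact ⟨V, hV, hVU, t, fun w => (h w).2⟩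
    · intro θ h0 h1
      exact Subtype.ext (funext fun x =>
        eq_zero_of_mem (F.isSuperModule_stalk (x : X.space)).isInternal (h0 x) (h1 x))
  smul_mem := fun hθ ha x =>
    (F.isSuperModule_stalk (x : X.space)).smul_mem (hθ x) (X.germ_mem_stalkGr U x.2 ha)

theorem IsLocallyGerm.res {F : SuperPresheaf X} {U V : Opens X.space} (hVU : V ≤ U)
    {θ : ∀ x : U, F.presheaf.stalk (x : X.space)} (h : F.IsLocallyGerm θ) :
    F.IsLocallyGerm (fun x : V => θ ⟨x, hVU x.2⟩) := by
  intro x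
  obtain ⟨W, hW, hWU, s, hs⟩ := h ⟨x, hVU x.2⟩
  refine ⟨V ⊓ W, ⟨x.2, hW⟩, inf_le_left, F.presheaf.map (Opens.infLERight V W).op s, ?_⟩
  rintro ⟨y, hy⟩
  rw [TopCat.Presheaf.germ_res_apply]
  exact hs ⟨y, hy.2⟩

/-- Being locally a germ is a local predicate. -/
def localPredicate (F : SuperPresheaf X) :
    TopCat.LocalPredicate (fun x : X.space => (F.presheaf.stalk x : Type u)) where
  pred θ := F.IsLocallyGerm θ
  res i _ h := IsLocallyGerm.res i.le h
  locality θ h x := by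
    obtain ⟨V, hV, i, h⟩ := h x
    obtain ⟨W, hW, hWV, s, hs⟩ := h ⟨x, hV⟩
    exact ⟨W, hW, hWV.trans i.le, s, hs⟩

/-- The presheaf underlying the sheafification. -/
def sheafifyPresheaf (F : SuperPresheaf X) : TopCat.Presheaf AddCommGrpCat.{u} X.space where
  obj U := AddCommGrpCat.of (F.sheafifySections U.unop)
  map f := AddCommGrpCat.ofHom
    { toFun := fun θ => ⟨fun x => θ.1 ⟨x, f.unop.le x.2⟩, IsLocallyGerm.res f.unop.le θ.2⟩
      map_zero' := rfl
      map_add' := fun _ _ => rfl }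
  map_id _ := rfl
  map_comp _ _ := rfl

theorem isSheaf_sheafifyPresheaf (F : SuperPresheaf X) : F.sheafifyPresheaf.IsSheaf := by
  rw [TopCat.Presheaf.isSheaf_iff_isSheaf_comp (forget AddCommGrpCat.{u})]
  exact (TopCat.subsheafToTypes F.localPredicate).2

/-- The sheafification of a presheaf of right supermodules. -/
def sheafify (F : SuperPresheaf X) : SuperPresheaf X where
  presheaf := F.sheafifyPresheaf
  module U := F.sheafifyModule U.unop
  map_smul {U V} f a θ := Subtype.ext (funext fun x => by
    change MulOpposite.op (X.O.germ U.unop (x : X.space) _ a) • θ.1 ⟨x, f.unop.le x.2⟩ =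
      MulOpposite.op (X.O.germ V.unop (x : X.space) x.2 (X.O.map f.unop.op a)) •
        θ.1 ⟨x, f.unop.le x.2⟩
    rw [TopCat.Presheaf.germ_res_apply])
  gr U := F.sheafifyGr U.unop
  isSuperModule U := F.isSuperModule_sheafify U.unop
  map_mem f _ _ h := fun x => h ⟨x, f.unop.le x.2⟩

/-- The homomorphism of sheafifications induced by a homomorphism of presheaves. -/
def sheafifyMap {F G : SuperPresheaf X} (f : F ⟶ G) : F.sheafify ⟶ G.sheafify where
  hom :=
    { app := fun U => AddCommGrpCat.ofHom
        { toFun := fun θ => ⟨fun x => stalkMap f (x : X.space) (θ.1 x), fun x => by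
            obtain ⟨V, hV, hVU, s, hs⟩ := θ.2 x
            refine ⟨V, hV, hVU, f.hom.app (op V) s, fun y => ?_⟩
            rw [← stalkMap_germ]
            exact congrArg _ (hs y)⟩
          map_zero' := Subtype.ext (funext fun x => map_zero _)
          map_add' := fun _ _ => Subtype.ext (funext fun x => map_add _ _ _) }
      naturality := fun _ _ _ => rfl }
  map_smul _ _ _ := Subtype.ext (funext fun _ => stalkMap_smul f _ _ _)
  map_mem h := fun x => stalkMap_mem f _ (h x)

end SuperPresheaf

/-- The sheaves of right `O_X`-supermodules, a full subcategory of the presheaves. -/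
abbrev SuperSheaf (X : RingedSuperspace.{u}) :=
  ObjectProperty.FullSubcategory (fun F : SuperPresheaf X => F.presheaf.IsSheaf)

/-- Sheafification as a functor. -/
def sheafification (X : RingedSuperspace.{u}) : SuperPresheaf X ⥤ SuperSheaf X :=
  ObjectProperty.lift _
    { obj := fun F => F.sheafify
      map := fun f => SuperPresheaf.sheafifyMap f
      map_id := fun F => SuperPresheaf.Hom.ext (NatTrans.ext (funext fun U => by
        ext θ
        exact Subtype.ext (funext fun x => SuperPresheaf.stalkMap_id F _ _)))
      map_comp := fun f g => SuperPresheaf.Hom.ext (NatTrans.ext (funext fun U => by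
        ext θ
        exact Subtype.ext (funext fun x => SuperPresheaf.stalkMap_comp f g _ _))) }
    (fun F => F.isSheaf_sheafifyPresheaf)

namespace SuperSheaf

variable {X : RingedSuperspace.{u}}

/-- The underlying sheaf of abelian groups. -/
def toSheaf (F : SuperSheaf X) : TopCat.Sheaf AddCommGrpCat.{u} X.space :=
  ⟨F.obj.presheaf, F.property⟩

/-- A supersheaf is acyclic if the cohomology groups `H^k(X, F)` of the underlying sheaf of abelian
groups vanish for all `k > 0`. -/
def IsAcyclic (F : SuperSheaf X) : Prop :=
  ∀ k : ℕ, 0 < k → Subsingleton (Sheaf.H (toSheaf F) k)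

/-- A supersheaf is generated by finitely many global sections if there is a finite set of global
sections whose germs generate the `O_{X,x}`-module `F_x` for every point `x`. -/
def IsFinitelyGeneratedByGlobalSections (F : SuperSheaf X) : Prop :=
  ∃ S : Set (F.obj.presheaf.obj (op ⊤)), S.Finite ∧ ∀ x : X.space,
    Submodule.span (X.O.stalk x)ᵐᵒᵖ
      ((fun s => F.obj.presheaf.germ ⊤ x trivial s) '' S) = ⊤

variable (X) in
/-- The locally free supersheaves of bounded rank: there is a bound `n` such that every point has an
open neighbourhood `U` with `F|_U ≅ O_X^(I|J)|_U` for finite sets `I`, `J` with `|I| + |J| ≤ n`. -/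
def locallyFreeBounded : ObjectProperty (SuperSheaf X) := fun F =>
  ∃ n : ℕ, ∀ x : X.space, ∃ (U : Opens X.space) (_ : x ∈ U) (I J : Type u) (_ : Finite I)
    (_ : Finite J), Nat.card I + Nat.card J ≤ n ∧
      Nonempty (SuperPresheaf.IsoOn U F.obj (SuperPresheaf.free X I J))

end SuperSheaf

/-! ### The functor `S` -/

section FunctorS

variable (X : RingedSuperspace.{u})

/-- The restriction maps of the structure sheaf. -/
def resHom {U V : (Opens X.space)ᵒᵖ} (f : U ⟶ V) : X.sections U →+* X.sections V :=
  (X.O.map f).hom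

theorem resHom_mem {U V : (Opens X.space)ᵒᵖ} (f : U ⟶ V) {i : ZMod 2} {a : X.sections U}
    (ha : a ∈ (X.sections U).gr i) : resHom X f a ∈ (X.sections V).gr i := X.map_mem f ha

/-- The restriction map `A = Γ(X, O_X) → O_X(U)`. -/
def resTop (U : (Opens X.space)ᵒᵖ) : X.globalSections →+* X.sections U :=
  resHom X (homOfLE le_top : U.unop ⟶ ⊤).op

theorem resHom_comp_resTop {U V : (Opens X.space)ᵒᵖ} (f : U ⟶ V) :
    (resHom X f).comp (resTop X U) = resTop X V := by
  refine RingHom.ext fun a => ?_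
  exact congrArg (fun g => (RingCat.Hom.hom g) a)
    (X.O.map_comp (homOfLE le_top : U.unop ⟶ ⊤).op f).symm

theorem resHom_id (U : (Opens X.space)ᵒᵖ) (b : X.sections U) : resHom X (𝟙 U) b = b :=
  congrArg (fun g : X.O.obj U ⟶ X.O.obj U => g b) (X.O.map_id U)

theorem resHom_comp {U V W : (Opens X.space)ᵒᵖ} (f : U ⟶ V) (g : V ⟶ W) (b : X.sections U) :
    resHom X (f ≫ g) b = resHom X g (resHom X f b) :=
  congrArg (fun g : X.O.obj U ⟶ X.O.obj W => g b) (X.O.map_comp f g)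

/-- The right `O_X(U)`-supermodule `M ⊗_A O_X(U)`. -/
def tensorSections (M : SuperModule X.globalSections) (U : (Opens X.space)ᵒᵖ) :
    SuperModule (X.sections U) where
  carrier := Tensor M (resTop X U)
  gr := tensorGr (resTop X U) M.gr (X.sections U).gr
  isSuperModule := isSuperModule_tensor X.globalSections.isSuperRing (X.sections U).isSuperRing
    M.isSuperModule (resHom_mem X _)

/-- The restriction maps `M ⊗_A O_X(U) → M ⊗_A O_X(V)`. -/
def tensorRes (M : SuperModule X.globalSections) {U V : (Opens X.space)ᵒᵖ} (f : U ⟶ V) :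
    tensorSections X M U →+ tensorSections X M V :=
  tensorMap LinearMap.id (resHom X f) (resHom_comp_resTop X f)

/-- The homomorphism `M ⊗_A O_X(U) → N ⊗_A O_X(U)` induced by `u : M → N`. -/
def tensorSectionsMap {M N : SuperModule X.globalSections} (u : M ⟶ N) (U : (Opens X.space)ᵒᵖ) :
    tensorSections X M U →+ tensorSections X N U :=
  tensorMap u.hom (RingHom.id (X.sections U)) (RingHom.id_comp _)

theorem tensorSections_hom_ext {M : SuperModule X.globalSections} {U : (Opens X.space)ᵒᵖ}
    {N : Type*} [AddCommGroup N] {f g : tensorSections X M U →+ N}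
    (h : ∀ m b, f (tmk (resTop X U) m b) = g (tmk (resTop X U) m b)) : f = g := tensor_hom_ext h

/-- The presheaf of right `O_X`-supermodules `U ↦ M ⊗_A O_X(U)`. -/
def tensorPresheaf (M : SuperModule X.globalSections) : SuperPresheaf X where
  presheaf :=
    { obj := fun U => AddCommGrpCat.of (tensorSections X M U)
      map := fun f => AddCommGrpCat.ofHom (tensorRes X M f)
      map_id := fun U => AddCommGrpCat.hom_ext (tensorSections_hom_ext X fun m b =>
        congrArg (tmk (resTop X U) m) (resHom_id X U b))
      map_comp := fun {_ _ W} f g => AddCommGrpCat.hom_ext (tensorSections_hom_ext X fun m b =>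
        congrArg (tmk (resTop X W) m) (resHom_comp X f g b)) }
  module U := (tensorSections X M U).module
  map_smul f a s := tensorMap_smul LinearMap.id (resHom X f) (resHom_comp_resTop X f) a s
  gr U := (tensorSections X M U).gr
  isSuperModule U := (tensorSections X M U).isSuperModule
  map_mem f _ _ h := tensorMap_mem LinearMap.id (resHom X f) (resHom_comp_resTop X f)
    (fun h => h) (resHom_mem X f) h

/-- The functor `M ↦ (U ↦ M ⊗_A O_X(U))`. -/
def tensorFunctor : SuperModule X.globalSections ⥤ SuperPresheaf X where
  obj M := tensorPresheaf X M
  map u :=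
    { hom :=
        { app := fun U => AddCommGrpCat.ofHom (tensorSectionsMap X u U)
          naturality := fun _ _ _ => AddCommGrpCat.hom_ext
            (tensorSections_hom_ext X fun _ _ => rfl) }
      map_smul := fun U a s =>
        tensorMap_smul u.hom (RingHom.id (X.sections U)) (RingHom.id_comp _) a s
      map_mem := fun {U _ _} h => tensorMap_mem u.hom (RingHom.id (X.sections U))
        (RingHom.id_comp _) u.map_mem (fun h => h) h }
  map_id _ := SuperPresheaf.Hom.ext (NatTrans.ext (funext fun _ =>
    AddCommGrpCat.hom_ext (tensorSections_hom_ext X fun _ _ => rfl)))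
  map_comp _ _ := SuperPresheaf.Hom.ext (NatTrans.ext (funext fun _ =>
    AddCommGrpCat.hom_ext (tensorSections_hom_ext X fun _ _ => rfl)))

/-- The functor `S` from right `A`-supermodules, `A = Γ(X, O_X)`, to right `O_X`-supermodules: `S(M)`
is the sheaf associated with the presheaf `U ↦ M ⊗_A O_X(U)`. -/
def functorS : SuperModule X.globalSections ⥤ SuperSheaf X :=
  tensorFunctor X ⋙ sheafification X

end FunctorS

end Super

end

/-! The proof rests on finite homogeneous dual bases: homogeneous sections v_k and natural right
linear functionals f_k with s = Σ v_k f_k(s). Over an open set U such data present F as the direct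
summand of a free supersheaf O^K (with parities) cut out by the Gram matrix g = (f_k(v_l)), an
idempotent of even degree, and they determine F|_U up to isomorphism by g
(`SuperPresheaf.DualBasis.isoOn`). Three conditions on F are then compared: having a dual basis over
X, being S(P) for a finitely generated superprojective P, and being locally free of bounded rank.

From modules to sheaves: a finitely generated superprojective P has a dual basis over A, and this
induces one for the presheaf U ↦ P ⊗_A O(U) with the same Gram matrix. As a retract of O^K this
presheaf is already a sheaf, so sheafification changes nothing and full faithfulness reduces to P
⊗_A A = P. Since the stalks are local, an even idempotent matrix splits near each point by pivoting
on a diagonal entry α, where α or 1 - α is a unit (`exists_local_splitting`). Hence a dual basis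
over X makes F locally free with rank at most |K|.

From sheaves to modules: let F be locally free of bounded rank. The homogeneous parts p_k of
finitely many generating global sections give an epimorphism π : O^K → F with kernel N. Where F is
free, π has a right inverse σ, and g = σπ is a local Gram matrix. Two local Gram matrices differ by
a section of the supersheaf Hom(F, N), realised as `relationHom`. It has local dual bases, all
indexed by K × K, so it is itself locally free of bounded rank and therefore acyclic. The vanishing
of H¹ corrects the local matrices to a global one (`exists_isGram_top`), which gives a dual basis of
F over X. The tensor presheaf on F(X) has the same Gram matrix as F, so F ≅ S(F(X)); this is
essential surjectivity. -/

noncomputable section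

namespace Super

/-! ### Homogeneous components and signs in superrings. -/

section

theorem zmod_two_cases (i : ZMod 2) : i = 0 ∨ i = 1 := by revert i; decide

theorem zmod_two_add_self (i : ZMod 2) : i + i = 0 := by revert i; decide

theorem zmod_two_add_add_cancel (i j : ZMod 2) : i + j + j = i := by
  rw [add_assoc, zmod_two_add_self, add_zero]

section Components

variable {M : Type*} [AddCommGroup M] {gr : ZMod 2 → AddSubgroup M}

/-- The projection onto the homogeneous component of degree `i`. -/
def homPart (h : DirectSum.IsInternal gr) (i : ZMod 2) : M →+ M :=
  if i = 0 then evenPart h else AddMonoidHom.id M - evenPart h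

theorem homPart_zero_add_one (h : DirectSum.IsInternal gr) (x : M) :
    homPart h 0 x + homPart h 1 x = x := by
  simp [homPart]

theorem homPart_mem (h : DirectSum.IsInternal gr) (i : ZMod 2) (x : M) :
    homPart h i x ∈ gr i := by
  obtain ⟨y, hy, z, hz, rfl⟩ := exists_add h x
  rcases zmod_two_cases i with rfl | rfl
  · simpa [homPart, evenPart_even h hy, evenPart_odd h hz] using hy
  · simpa [homPart, evenPart_even h hy, evenPart_odd h hz] using hz

theorem homPart_of_mem (h : DirectSum.IsInternal gr) {i : ZMod 2} {x : M} (hx : x ∈ gr i) :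
    homPart h i x = x := by
  rcases zmod_two_cases i with rfl | rfl
  · simp [homPart, evenPart_even h hx]
  · simp [homPart, evenPart_odd h hx]

theorem homPart_of_mem_ne (h : DirectSum.IsInternal gr) {i j : ZMod 2} {x : M} (hx : x ∈ gr j)
    (hij : i ≠ j) : homPart h i x = 0 := by
  rcases zmod_two_cases i with rfl | rfl <;> rcases zmod_two_cases j with rfl | rfl
  · exact absurd rfl hij
  · simp [homPart, evenPart_odd h hx]
  · simp [homPart, evenPart_even h hx]
  · exact absurd rfl hij

theorem homPart_eq_ite (h : DirectSum.IsInternal gr) {i j : ZMod 2} {x : M} (hx : x ∈ gr j) :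
    homPart h i x = if i = j then x else 0 := by
  split_ifs with hij
  · subst hij; exact homPart_of_mem h hx
  · exact homPart_of_mem_ne h hx hij

theorem homogeneous_induction (h : DirectSum.IsInternal gr) {p : M → Prop}
    (hadd : ∀ x y, p x → p y → p (x + y)) (hp : ∀ i, ∀ x ∈ gr i, p x) (x : M) : p x := by
  rw [← homPart_zero_add_one h x]
  exact hadd _ _ (hp _ _ (homPart_mem h 0 x)) (hp _ _ (homPart_mem h 1 x))

theorem map_homPart {N : Type*} [AddCommGroup N] {gr' : ZMod 2 → AddSubgroup N}
    (h : DirectSum.IsInternal gr) (h' : DirectSum.IsInternal gr') (f : M →+ N)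
    (hf : ∀ i, ∀ x ∈ gr i, f x ∈ gr' i) (i : ZMod 2) (x : M) :
    f (homPart h i x) = homPart h' i (f x) := by
  induction x using homogeneous_induction h with
  | hadd x y hx hy => simp only [map_add, hx, hy]
  | hp j x hx =>
    rw [homPart_eq_ite h hx, homPart_eq_ite h' (hf j x hx)]
    split_ifs <;> simp

/-- A parity-preserving injective additive map reflects parity. -/
theorem mem_of_map_mem {N : Type*} [AddCommGroup N] {gr' : ZMod 2 → AddSubgroup N}
    (h : DirectSum.IsInternal gr) (h' : DirectSum.IsInternal gr') (f : M →+ N)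
    (hf : ∀ i, ∀ x ∈ gr i, f x ∈ gr' i) (hinj : Function.Injective f) {i : ZMod 2} {x : M}
    (hx : f x ∈ gr' i) : x ∈ gr i := by
  have := map_homPart h h' f hf i x
  rw [homPart_of_mem h' hx] at this
  rw [← hinj this]
  exact homPart_mem h i x

end Components

section Multiplication

variable {A : Type*} [Ring A] {gr : ZMod 2 → AddSubgroup A} (hA : IsSuperRing gr)

theorem zmod_two_eq_add_iff {i j k : ZMod 2} : i = j + k ↔ i + j = k := by
  revert i j k; decide

/-- Acting on a homogeneous element only shifts degrees. Modulo 2 the shift is its own inverse,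
which is why the index on the right is `i + j` rather than a difference. -/
theorem homPart_smul {M : Type*} [AddCommGroup M] [Module Aᵐᵒᵖ M] {grM : ZMod 2 → AddSubgroup M}
    (hM : IsSuperModule gr grM) {i j : ZMod 2} {m : M} (hm : m ∈ grM j) (a : A) :
    homPart hM.isInternal i (MulOpposite.op a • m) =
      MulOpposite.op (homPart hA.isInternal (i + j) a) • m := by
  induction a using homogeneous_induction hA.isInternal with
  | hadd a b ha hb => simp only [MulOpposite.op_add, add_smul, map_add, ha, hb]
  | hp k a ha =>
    rw [homPart_eq_ite _ (hM.smul_mem hm ha), homPart_eq_ite _ ha]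
    by_cases h : i = j + k
    · rw [if_pos h, if_pos (zmod_two_eq_add_iff.1 h)]
    · rw [if_neg h, if_neg (fun h' => h (zmod_two_eq_add_iff.2 h')), MulOpposite.op_zero, zero_smul]

theorem homPart_mul_of_mem {i j : ZMod 2} (a : A) {b : A} (hb : b ∈ gr j) :
    homPart hA.isInternal i (a * b) = homPart hA.isInternal (i + j) a * b := by
  induction a using homogeneous_induction hA.isInternal with
  | hadd a c ha hc => simp only [add_mul, map_add, ha, hc]
  | hp k a ha =>
    rw [homPart_eq_ite _ (hA.mul_mem ha hb), homPart_eq_ite _ ha]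
    by_cases h : i = k + j
    · rw [if_pos h, if_pos (zmod_two_eq_add_iff.1 (h.trans (add_comm _ _)))]
    · rw [if_neg h, if_neg (fun h' => h ((zmod_two_eq_add_iff.2 h').trans (add_comm _ _))),
        zero_mul]

theorem mul_comm_of_even (hA : IsSuperRing gr) {a : A} (ha : a ∈ gr 0) (b : A) : a * b = b * a := by
  induction b using homogeneous_induction hA.isInternal with
  | hadd b c hb hc => rw [mul_add, add_mul, hb, hc]
  | hp j b hb => simpa using hA.supercomm ha hb

/-- The sign `(-1)^(ij)`. -/
def sgn (A : Type*) [Ring A] (i j : ZMod 2) : A := (-1) ^ (i.val * j.val)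

theorem sgn_comm (i j : ZMod 2) : sgn A i j = sgn A j i := by rw [sgn, sgn, mul_comm]

theorem sgn_mul_self (i j : ZMod 2) : sgn A i j * sgn A i j = 1 := by
  rw [sgn, ← pow_add, ← two_mul, pow_mul]; simp

theorem sgn_add (i j k : ZMod 2) : sgn A i (j + k) = sgn A i j * sgn A i k := by
  rcases zmod_two_cases i with rfl | rfl <;> rcases zmod_two_cases j with rfl | rfl <;>
    rcases zmod_two_cases k with rfl | rfl <;> simp [sgn, zmod_two_add_self, ZMod.val_one]

theorem sgn_mul_comm (i j : ZMod 2) (a : A) : sgn A i j * a = a * sgn A i j :=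
  ((Commute.neg_one_left a).pow_left _).eq

theorem sgn_zero (j : ZMod 2) : sgn A 0 j = 1 := by simp [sgn]

theorem sgn_mul_mem {i j k : ZMod 2} {a : A} (ha : a ∈ gr k) : sgn A i j * a ∈ gr k := by
  unfold sgn
  rcases neg_one_pow_eq_or A (i.val * j.val) with h | h <;> rw [h] <;> simpa using ha

/-- The automorphism `a ↦ (-1)^(ε|a|) a` of a superring. -/
def twist (ε : ZMod 2) : A →+* A where
  toFun a := homPart hA.isInternal 0 a + sgn A ε 1 * homPart hA.isInternal 1 a
  map_zero' := by simp
  map_add' a b := by simp only [map_add, mul_add]; abel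
  map_one' := by
    rw [homPart_of_mem _ hA.one_mem, homPart_of_mem_ne _ hA.one_mem (by decide), mul_zero,
      add_zero]
  -- Multiplicativity holds because a ↦ (-1)^(ε|a|) is a character of the grading group; it is
  -- enough to take the second factor homogeneous.
  map_mul' := by
    have key : ∀ (a : A), ∀ j, ∀ b ∈ gr j, homPart hA.isInternal 0 (a * b) +
        sgn A ε 1 * homPart hA.isInternal 1 (a * b) =
        (homPart hA.isInternal 0 a + sgn A ε 1 * homPart hA.isInternal 1 a) *
          (sgn A ε j * b) := by
      intro a j b hb
      rw [homPart_mul_of_mem hA a hb, homPart_mul_of_mem hA a hb]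
      rcases zmod_two_cases j with rfl | rfl
      · simp [sgn, add_mul, mul_assoc]
      · rw [zero_add, zmod_two_add_self, ← mul_assoc (_ + _) (sgn A ε 1) b, ← sgn_mul_comm ε 1,
          mul_add (sgn A ε 1), ← mul_assoc (sgn A ε 1) (sgn A ε 1), sgn_mul_self, one_mul, add_mul,
          add_comm, mul_assoc]
    intro a b
    nth_rewrite 1 2 [← homPart_zero_add_one hA.isInternal b]
    rw [mul_add, map_add, map_add, mul_add, add_add_add_comm,
      key a 0 _ (homPart_mem hA.isInternal 0 b), key a 1 _ (homPart_mem hA.isInternal 1 b),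
      ← mul_add, sgn_comm ε 0, sgn_zero, one_mul]

theorem twist_of_mem {ε j : ZMod 2} {a : A} (ha : a ∈ gr j) :
    twist hA ε a = sgn A ε j * a := by
  change homPart hA.isInternal 0 a + sgn A ε 1 * homPart hA.isInternal 1 a = _
  rcases zmod_two_cases j with rfl | rfl
  · rw [homPart_of_mem _ ha, homPart_of_mem_ne _ ha (by decide), sgn_comm ε 0, sgn_zero]; simp
  · rw [homPart_of_mem _ ha, homPart_of_mem_ne _ ha (by decide), zero_add]

theorem twist_mem {ε j : ZMod 2} {a : A} (ha : a ∈ gr j) : twist hA ε a ∈ gr j := by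
  rw [twist_of_mem hA ha]
  exact sgn_mul_mem ha

theorem twist_twist (ε δ : ZMod 2) (a : A) : twist hA ε (twist hA δ a) = twist hA (ε + δ) a := by
  induction a using homogeneous_induction hA.isInternal with
  | hadd a b ha hb => simp only [map_add, ha, hb]
  | hp j a ha =>
    rw [twist_of_mem hA ha, twist_of_mem hA (sgn_mul_mem ha), twist_of_mem hA ha, ← mul_assoc,
      sgn_comm, sgn_comm δ, sgn_comm _ j, sgn_add]

theorem twist_zero (a : A) : twist hA 0 a = a := by
  change homPart hA.isInternal 0 a + sgn A 0 1 * homPart hA.isInternal 1 a = _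
  rw [sgn_zero, one_mul, homPart_zero_add_one]

/-- Supercommutativity when only one factor is homogeneous: the signs of the two components of `a`
are absorbed by the automorphism. All later sign bookkeeping goes through this rule together with
`twist_twist`. -/
theorem mul_eq_mul_twist (a : A) {j : ZMod 2} {b : A} (hb : b ∈ gr j) :
    a * b = b * twist hA j a := by
  induction a using homogeneous_induction hA.isInternal with
  | hadd a c ha hc => rw [map_add, mul_add, add_mul, ha, hc]
  | hp i a ha => rw [twist_of_mem hA ha, hA.supercomm ha hb, ← mul_assoc b, ← sgn_mul_comm,
      mul_assoc, sgn_comm]; rfl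

theorem map_twist {B : Type*} [Ring B] {gr' : ZMod 2 → AddSubgroup B} (hB : IsSuperRing gr')
    (f : A →+* B) (hf : ∀ i, ∀ x ∈ gr i, f x ∈ gr' i) (ε : ZMod 2) (a : A) :
    f (twist hA ε a) = twist hB ε (f a) := by
  induction a using homogeneous_induction hA.isInternal with
  | hadd a b ha hb => simp only [map_add, ha, hb]
  | hp j a ha => rw [twist_of_mem hA ha, twist_of_mem hB (hf j a ha)]; simp [sgn]

end Multiplication

/-! ### Units in local superrings. -/

section Local

variable {A : SuperRing.{u}}

theorem SuperRing.isUnit_of_mul_eq_one {a c : A} (ha : a ∈ A.gr 0) (h : c * a = 1) : IsUnit a :=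
  ⟨⟨a, c, (mul_comm_of_even A.isSuperRing ha c).trans h, h⟩, rfl⟩

/-- Zorn's lemma applies because the union of a nonempty chain of proper homogeneous ideals is again
proper and homogeneous. -/
theorem SuperRing.exists_maximal_ge {I : Ideal A} (hI : A.IsHomogeneous I) (hI' : I ≠ ⊤) :
    ∃ m, I ≤ m ∧ Maximal (fun I : Ideal A => A.IsHomogeneous I ∧ I ≠ ⊤) m := by
  refine zorn_le_nonempty₀ {I : Ideal A | A.IsHomogeneous I ∧ I ≠ ⊤} ?_ I ⟨hI, hI'⟩
  intro c hc hchain J hJ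
  have hmem : ∀ {z : A}, z ∈ sSup c ↔ ∃ K ∈ c, z ∈ K :=
    Submodule.mem_sSup_of_directed ⟨J, hJ⟩ hchain.directedOn
  refine ⟨sSup c, ⟨?_, ?_⟩, fun K hK => le_sSup hK⟩
  · intro a ha
    obtain ⟨K, hK, haK⟩ := hmem.1 ha
    obtain ⟨y, hy, z, hz, hyK, hzK, e⟩ := (hc hK).1 a haK
    exact ⟨y, hy, z, hz, hmem.2 ⟨K, hK, hyK⟩, hmem.2 ⟨K, hK, hzK⟩, e⟩
  · rw [Ne, Ideal.eq_top_iff_one, hmem]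
    rintro ⟨K, hK, h1⟩
    exact (hc hK).2 ((Ideal.eq_top_iff_one K).2 h1)

/-- An even non-unit generates a homogeneous left ideal, which is proper because even elements are
central and so a left inverse would be two-sided. It therefore lies in the unique maximal
homogeneous ideal, which cannot contain both a and 1 - a. -/
theorem SuperRing.IsLocal.isUnit_or_isUnit_one_sub (h : A.IsLocal) {a : A} (ha : a ∈ A.gr 0) :
    IsUnit a ∨ IsUnit (1 - a) := by
  obtain ⟨m, hm, huniq⟩ := h
  have key : ∀ b ∈ A.gr 0, ¬ IsUnit b → b ∈ m := by
    intro b hb hunit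
    have h1 : A.IsHomogeneous (Ideal.span {b}) := by
      intro x hx
      obtain ⟨c, rfl⟩ := Ideal.mem_span_singleton'.1 hx
      obtain ⟨y, hy, z, hz, rfl⟩ := exists_add A.isSuperRing.isInternal c
      refine ⟨y * b, ?_, z * b, ?_, Ideal.mem_span_singleton'.2 ⟨y, rfl⟩,
        Ideal.mem_span_singleton'.2 ⟨z, rfl⟩, (add_mul _ _ _).symm⟩
      · simpa using A.isSuperRing.mul_mem hy hb
      · simpa using A.isSuperRing.mul_mem hz hb
    have h2 : (Ideal.span {b} : Ideal A) ≠ ⊤ := by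
      rw [Ne, Ideal.eq_top_iff_one, Ideal.mem_span_singleton']
      rintro ⟨c, hc⟩
      exact hunit (SuperRing.isUnit_of_mul_eq_one hb hc)
    obtain ⟨m', hle, hmax⟩ := SuperRing.exists_maximal_ge h1 h2
    rw [← huniq m' hmax]
    exact hle (Ideal.subset_span rfl)
  by_contra hcon
  push Not at hcon
  refine hm.prop.2 ((Ideal.eq_top_iff_one m).2 ?_)
  rw [← add_sub_cancel a 1]
  exact add_mem (key a ha hcon.1) (key _ (sub_mem A.isSuperRing.one_mem ha) hcon.2)

end Local

/-! ### Diagonal projections and parity-preserving matrices. -/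

section Matrices

variable {K : Type*} [DecidableEq K]

/-- The diagonal projection onto the coordinates in `T`. -/
def diagProj (R : Type*) [Ring R] (T : Finset K) : Matrix K K R :=
  Matrix.diagonal fun k => if k ∈ T then 1 else 0

variable {R : Type*} [Ring R]

theorem diagProj_apply (T : Finset K) (i j : K) :
    diagProj R T i j = if i = j ∧ i ∈ T then 1 else 0 := by
  by_cases h : i = j
  · subst h; simp [diagProj]
  · simp [diagProj, h]

theorem diagProj_map {S : Type*} [Ring S] (f : R →+* S) (T : Finset K) :
    (diagProj R T).map f = diagProj S T := by
  ext i j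
  simp [diagProj_apply, apply_ite f]

theorem diagProj_insert {k : K} {T : Finset K} (hk : k ∉ T) :
    diagProj R (insert k T) = diagProj R T + diagProj R {k} := by
  ext i j
  simp only [diagProj_apply, Matrix.add_apply, Finset.mem_insert, Finset.mem_singleton]
  by_cases h : i = j
  · subst h
    by_cases h' : i = k
    · subst h'; simp [hk]
    · simp [h']
  · simp [h]

theorem diagProj_singleton (k : K) : diagProj R {k} = Matrix.single k k 1 := by
  ext i j
  simp only [diagProj_apply, Matrix.single_apply, Finset.mem_singleton]
  congr 1
  ext; constructor
  · rintro ⟨rfl, rfl⟩; exact ⟨rfl, rfl⟩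
  · rintro ⟨rfl, rfl⟩; exact ⟨rfl, rfl⟩

variable [Fintype K]

theorem diagProj_mul (S T : Finset K) :
    diagProj R S * diagProj R T = diagProj R (S ∩ T) := by
  rw [diagProj, diagProj, Matrix.diagonal_mul_diagonal, diagProj]
  congr 1
  ext k
  by_cases h : k ∈ S <;> simp [h]

theorem diagProj_mul_singleton_of_notMem {k : K} {T : Finset K} (hk : k ∉ T) :
    diagProj R T * diagProj R {k} = 0 := by
  rw [diagProj_mul, Finset.inter_singleton_of_notMem hk]
  ext i j; simp [diagProj_apply]

theorem singleton_mul_diagProj_of_notMem {k : K} {T : Finset K} (hk : k ∉ T) :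
    diagProj R {k} * diagProj R T = 0 := by
  rw [diagProj_mul, Finset.singleton_inter_of_notMem hk]
  ext i j; simp [diagProj_apply]

theorem diagProj_mul_mul_single (e : Matrix K K R) (k : K) :
    diagProj R {k} * e * diagProj R {k} = Matrix.single k k (e k k) := by
  ext i j
  simp only [diagProj, Matrix.mul_diagonal, Matrix.diagonal_mul, Finset.mem_singleton,
    Matrix.single_apply]
  by_cases h : i = k
  · subst h
    by_cases h' : j = i
    · subst h'; simp
    · simp [h', Ne.symm h']
  · simp [h, Ne.symm h]

/-- The subring of matrices that define parity-preserving endomorphisms of a free supermodule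
whose `k`-th basis element has parity `ε k`. -/
def gradedMatrix {gr : ZMod 2 → AddSubgroup R} (hR : IsSuperRing gr) (ε : K → ZMod 2) :
    Subring (Matrix K K R) where
  carrier := {m | ∀ i j, m i j ∈ gr (ε i + ε j)}
  zero_mem' _ _ := zero_mem _
  add_mem' h h' i j := add_mem (h i j) (h' i j)
  neg_mem' h i j := neg_mem (h i j)
  one_mem' i j := by
    rw [Matrix.one_apply]
    split_ifs with h
    · subst h; rw [zmod_two_add_self]; exact hR.one_mem
    · exact zero_mem _
  mul_mem' := by
    intro a b ha hb i j
    rw [Matrix.mul_apply]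
    refine sum_mem fun k _ => ?_
    have := hR.mul_mem (ha i k) (hb k j)
    rwa [← add_assoc, zmod_two_add_add_cancel] at this

theorem single_mem_gradedMatrix {gr : ZMod 2 → AddSubgroup R} (hR : IsSuperRing gr)
    (ε : K → ZMod 2) (k : K) {r : R} (hr : r ∈ gr 0) :
    Matrix.single k k r ∈ gradedMatrix hR ε := by
  intro i j
  rw [Matrix.single_apply]
  split_ifs with h
  · rw [← h.1, ← h.2, zmod_two_add_self]; exact hr
  · exact zero_mem _

theorem diagProj_mem_gradedMatrix {gr : ZMod 2 → AddSubgroup R} (hR : IsSuperRing gr)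
    (ε : K → ZMod 2) (T : Finset K) : diagProj R T ∈ gradedMatrix hR ε := by
  intro i j
  rw [diagProj_apply]
  split_ifs with h
  · rw [← h.1, zmod_two_add_self]; exact hR.one_mem
  · exact zero_mem _

end Matrices

/-! ### Ring identities for one elimination step on an idempotent. -/

section Idempotents

variable {M : Type*} [Ring M] {e h B : M}

/-- Here h is a coordinate projection and B inverts 1 - e in that coordinate. Dropping the
coordinate is then injective on the image of e: for v = e v one has e(1 - h)v = v - e h v, and the
term with B restores e h v. -/
theorem factor_of_one_sub_pivot (he : e * e = e) (hh : h * h = h) (hB : B - B * e * h = h) :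
    ((1 + e * B) * e * (1 - h)) * ((1 - h) * e) = e := by
  have h1 : (1 - h) * (1 - h) = 1 - h := by
    rw [mul_sub, sub_mul, sub_mul, hh]; simp
  calc ((1 + e * B) * e * (1 - h)) * ((1 - h) * e)
      = (1 + e * B) * e * ((1 - h) * (1 - h)) * e := by simp only [mul_assoc]
    _ = e * e - e * h * e + e * B * (e * e) - e * B * e * h * e := by rw [h1]; noncomm_ring
    _ = e - e * h * e + e * (B - B * e * h) * e := by rw [he]; noncomm_ring
    _ = e := by rw [hB, sub_add_cancel]

/-- With z the first factor above, y = (1 - h)e and z y = e, the identity e z = z gives (y z)(y z) =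
y e z = y z. So y z is an idempotent equivalent to e that avoids the dropped coordinate. -/
theorem mul_factor_of_one_sub_pivot (he : e * e = e) :
    e * ((1 + e * B) * e * (1 - h)) = (1 + e * B) * e * (1 - h) := by
  calc e * ((1 + e * B) * e * (1 - h)) = (e * e + (e * e) * B * e) * (1 - h) := by noncomm_ring
    _ = _ := by rw [he]; noncomm_ring

/-- Splitting off the pivot: `e - e U e` is an idempotent orthogonal to the pivot. -/
theorem idempotent_sub_pivot (he : e * e = e) (hU : B * e * B = B) :
    (e - e * B * e) * (e - e * B * e) = e - e * B * e := by
  calc (e - e * B * e) * (e - e * B * e)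
      = e * e - (e * e) * B * e - e * B * (e * e) + e * B * (e * e) * B * e := by noncomm_ring
    _ = e - e * B * e - e * B * e + e * (B * e * B) * e := by rw [he]; noncomm_ring
    _ = _ := by rw [hU]; noncomm_ring

/-- A splitting of `e - e U e` and the pivot give a splitting of `e`. -/
theorem splitting_of_sub_pivot {a b p : M} (he : e * e = e) (hhB : h * B = B)
    (hBe : B * e * h = h) (hpp : p * p = p) (hph : p * h = 0) (hhp : h * p = 0)
    (hab : a * b = e - e * B * e) (hba : b * a = p) :
    (a * b * a + e * h) * (b * a * b + B * e) = e ∧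
      (b * a * b + B * e) * (a * b * a + e * h) = p + h := by
  have hU : B * e * B = B := by
    calc B * e * B = (B * e * h) * B := by rw [mul_assoc, mul_assoc, hhB, ← mul_assoc]
      _ = B := by rw [hBe, hhB]
  have h2 : a * b * a * B = 0 := by
    rw [mul_assoc a, hba, ← hhB, mul_assoc, ← mul_assoc p, hph, zero_mul, mul_zero]
  have h3 : h * (b * a * b) = 0 := by
    rw [hba, ← mul_assoc, hhp, zero_mul]
  have h4 : (a * b) * (a * b) = a * b := by
    rw [hab]; exact idempotent_sub_pivot he hU
  have h6 : (a * b) * (e * h) = 0 := by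
    calc (a * b) * (e * h) = (e * e) * h - e * B * (e * e) * h := by rw [hab]; noncomm_ring
      _ = e * h - e * (B * e * h) := by rw [he]; noncomm_ring
      _ = 0 := by rw [hBe, sub_self]
  have h7 : B * e * (a * b) = 0 := by
    calc B * e * (a * b) = B * (e * e) - B * (e * e) * B * e := by rw [hab]; noncomm_ring
      _ = B * e - (B * e * B) * e := by rw [he]
      _ = 0 := by rw [hU, sub_self]
  -- The factors a and b are first replaced by a b a and b a b, which are supported on the
  -- idempotents a b and p; this makes the cross terms with the pivot vanish.
  constructor
  · calc (a * b * a + e * h) * (b * a * b + B * e)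
        = (a * b) * (a * b) * (a * b) + (a * b * a * B) * e + e * (h * (b * a * b)) +
          e * (h * B) * e := by noncomm_ring
      _ = e := by rw [h4, h4, h2, h3, hhB, hab]; noncomm_ring
  · calc (b * a * b + B * e) * (a * b * a + e * h)
        = (b * a) * (b * a) * (b * a) + b * ((a * b) * (e * h)) + (B * e * (a * b)) * a +
          B * (e * e) * h := by noncomm_ring
      _ = p + h := by rw [hba, hpp, hpp, h6, h7, he, hBe, mul_zero, zero_mul, add_zero, add_zero]

end Idempotents

end

/-! ### Sections of the structure sheaf and local splitting of idempotent matrices. -/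

section

namespace RingedSuperspace

variable (X : RingedSuperspace.{u})

/-- Restriction of sections of the structure sheaf. -/
def res {U V : Opens X.space} (h : V ≤ U) : X.O.obj (op U) →+* X.O.obj (op V) :=
  (X.O.map (homOfLE h).op).hom

variable {X} {U V W : Opens X.space}

theorem res_res (h : V ≤ U) (h' : W ≤ V) (a : X.O.obj (op U)) :
    X.res h' (X.res h a) = X.res (h'.trans h) a :=
  (congrArg (fun g : X.O.obj (op U) ⟶ X.O.obj (op W) => g a)
    (X.O.map_comp (homOfLE h).op (homOfLE h').op)).symm

theorem res_self (h : U ≤ U) (a : X.O.obj (op U)) : X.res h a = a :=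
  congrArg (fun g : X.O.obj (op U) ⟶ X.O.obj (op U) => g a) (X.O.map_id (op U))

theorem res_mem (h : V ≤ U) {i : ZMod 2} {a : X.O.obj (op U)} (ha : a ∈ X.gr (op U) i) :
    X.res h a ∈ X.gr (op V) i := X.map_mem _ ha

theorem germ_res (h : V ≤ U) {x : X.space} (hx : x ∈ V) (a : X.O.obj (op U)) :
    X.O.germ V x hx (X.res h a) = X.O.germ U x (h hx) a :=
  TopCat.Presheaf.germ_res_apply X.O (homOfLE h) x hx a

theorem exists_res_eq_of_germ_eq {x : X.space} (hx : x ∈ U) {a b : X.O.obj (op U)}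
    (h : X.O.germ U x hx a = X.O.germ U x hx b) :
    ∃ (V : Opens X.space) (h : V ≤ U), x ∈ V ∧ X.res h a = X.res h b := by
  obtain ⟨V, hV, i, i', e⟩ := X.O.germ_eq x hx hx _ _ h
  exact ⟨V, i.le, hV, e⟩

theorem eq_of_locally_eq {a b : X.O.obj (op U)}
    (h : ∀ x ∈ U, ∃ (V : Opens X.space) (h : V ≤ U), x ∈ V ∧ X.res h a = X.res h b) : a = b := by
  refine X.ringSheaf.eq_of_locally_eq' (ι := U) (fun x => (h x x.2).choose) U
    (fun x => homOfLE (h x x.2).choose_spec.choose) ?_ a b ?_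
  · intro x hx
    exact Opens.mem_iSup.2 ⟨⟨x, hx⟩, (h x hx).choose_spec.choose_spec.1⟩
  · exact fun x => (h x x.2).choose_spec.choose_spec.2

/-- Gluing of sections of the structure sheaf that are characterised by a relation. -/
theorem exists_glue (R : ∀ V : Opens X.space, V ≤ U → X.O.obj (op V) → Prop)
    (hloc : ∀ x ∈ U, ∃ (V : Opens X.space) (h : V ≤ U) (a : X.O.obj (op V)), x ∈ V ∧ R V h a)
    (huniq : ∀ V h a V' h' a', R V h a → R V' h' a' →
      X.res (inf_le_left : V ⊓ V' ≤ V) a = X.res inf_le_right a') :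
    ∃! a : X.O.obj (op U), ∀ V h a', R V h a' → X.res h a = a' := by
  -- Gluing over all pairs that satisfy the relation, rather than over a chosen cover, makes the
  -- glued section restrict to every admissible local section.
  let ι := {p : Σ V : Opens X.space, X.O.obj (op V) // ∃ h, R p.1 h p.2}
  have hcov : U ≤ ⨆ i : ι, i.1.1 := by
    intro x hx
    obtain ⟨V, h, a, hxV, hR⟩ := hloc x hx
    exact Opens.mem_iSup.2 ⟨⟨⟨V, a⟩, h, hR⟩, hxV⟩
  obtain ⟨a, ha, huniq⟩ := X.ringSheaf.existsUnique_gluing' (fun i : ι => i.1.1) U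
    (fun i => homOfLE i.2.choose) hcov (fun i => i.1.2)
    (fun i j => huniq _ _ _ _ _ _ i.2.choose_spec j.2.choose_spec)
  refine ⟨a, fun V h a' hR => ha ⟨⟨V, a'⟩, h, hR⟩, fun b hb => huniq b fun i => ?_⟩
  exact hb _ _ _ i.2.choose_spec

/-- An inverse of the germ spreads to a section c with c a = 1 near x. Taking degree-0 components,
with a even, shows that the even part of c is already an inverse. -/
theorem exists_even_inverse {x : X.space} (hx : x ∈ U) {a : X.O.obj (op U)}
    (ha : a ∈ X.gr (op U) 0) (h : IsUnit (X.O.germ U x hx a)) :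
    ∃ (V : Opens X.space) (hV : V ≤ U) (b : X.O.obj (op V)), x ∈ V ∧ b ∈ X.gr (op V) 0 ∧
      b * X.res hV a = 1 ∧ X.res hV a * b = 1 := by
  obtain ⟨t, ht⟩ := h.exists_left_inv
  obtain ⟨V, hVU, hV, c, rfl⟩ := X.O.exists_le_germ_eq t hx
  rw [← germ_res hVU hV, ← map_mul, ← map_one (X.O.germ V x hV).hom] at ht
  obtain ⟨W, hWV, hW, e⟩ := exists_res_eq_of_germ_eq hV ht
  rw [map_mul, map_one, res_res] at e
  have hWU := hWV.trans hVU
  have h1 := (X.isSuperRing (op W)).isInternal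
  have h2 := res_mem hWU ha
  have h3 : homPart h1 0 (X.res hWV c) * X.res hWU a = 1 := by
    have := homPart_mul_of_mem (X.isSuperRing (op W)) (i := 0) (X.res hWV c) h2
    rw [e, homPart_of_mem h1 (X.isSuperRing (op W)).one_mem, add_zero] at this
    exact this.symm
  exact ⟨W, hWU, _, hW, homPart_mem h1 0 _, h3,
    (mul_comm_of_even (X.isSuperRing (op W)) h2 _).trans h3⟩

variable {K : Type*}

theorem map_res_res (h : V ≤ U) (h' : W ≤ V) (e : Matrix K K (X.O.obj (op U))) :
    (e.map (X.res h)).map (X.res h') = e.map (X.res (h'.trans h)) := by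
  ext i j; exact res_res h h' _

variable [Fintype K] [DecidableEq K] (ε : K → ZMod 2)

theorem map_res_mem_gradedMatrix (h : V ≤ U) {e : Matrix K K (X.O.obj (op U))}
    (he : e ∈ gradedMatrix (X.isSuperRing (op U)) ε) :
    e.map (X.res h) ∈ gradedMatrix (X.isSuperRing (op V)) ε :=
  fun i j => res_mem h (he i j)

/-- An idempotent matrix over a ring of sections of a locally ringed superspace splits locally. -/
theorem exists_local_splitting (hX : X.IsLocallyRinged) {x : X.space} (S : Finset K) :
    ∀ (U : Opens X.space), x ∈ U → ∀ e ∈ gradedMatrix (X.isSuperRing (op U)) ε,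
    e * e = e → diagProj _ S * e = e → e * diagProj _ S = e →
    ∃ (V : Opens X.space) (hV : V ≤ U) (T : Finset K),
      ∃ a ∈ gradedMatrix (X.isSuperRing (op V)) ε, ∃ b ∈ gradedMatrix (X.isSuperRing (op V)) ε,
      x ∈ V ∧ T ⊆ S ∧ a * b = e.map (X.res hV) ∧ b * a = diagProj _ T := by
  induction S using Finset.induction_on with
  | empty =>
    intro U hU e he hee h1 h2
    have h0 : e = 0 := by rw [← h1]; ext i j; simp [diagProj]
    refine ⟨U, le_rfl, ∅, 0, zero_mem _, 0, zero_mem _, hU, subset_rfl, ?_, ?_⟩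
    · subst h0; ext i j; simp
    · ext i j; simp [diagProj]
  | insert k S hk ih =>
    intro U hU e he hee h1 h2
    have hα : e k k ∈ X.gr (op U) 0 := by simpa [zmod_two_add_self] using he k k
    have hloc := (hX x).isUnit_or_isUnit_one_sub (X.germ_mem_stalkGr U hU hα)
    rcases hloc with hu | hu
    -- The diagonal entry is a unit near x and serves as pivot. With B its inverse placed at (k,k),
    -- e B e is an idempotent equivalent to E_kk, and e - e B e is the complementary summand of e.
    · obtain ⟨V, hVU, b, hxV, hb, hb1, hb2⟩ := exists_even_inverse hU hα hu
      have hR := X.isSuperRing (op V)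
      set e' : Matrix K K (X.O.obj (op V)) := e.map (X.res hVU) with he'
      have hα' : e' k k = X.res hVU (e k k) := rfl
      have h1' : diagProj _ (insert k S) * e' = e' := by
        rw [he', ← diagProj_map (X.res hVU), ← Matrix.map_mul, h1]
      have h2' : e' * diagProj _ (insert k S) = e' := by
        rw [he', ← diagProj_map (X.res hVU), ← Matrix.map_mul, h2]
      have hee' : e' * e' = e' := by rw [he', ← Matrix.map_mul, hee]
      have hgr' : e' ∈ gradedMatrix hR ε := map_res_mem_gradedMatrix ε hVU he
      set h : Matrix K K (X.O.obj (op V)) := diagProj _ {k} with hh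
      set B : Matrix K K (X.O.obj (op V)) := Matrix.single k k b with hB
      have hhs : h = Matrix.single k k 1 := diagProj_singleton k
      have hBh : B * h = B := by rw [hhs, hB, Matrix.single_mul_single_same, mul_one]
      have hhB : h * B = B := by rw [hhs, hB, Matrix.single_mul_single_same, one_mul]
      have hheh : h * e' * h = Matrix.single k k (e' k k) := diagProj_mul_mul_single e' k
      have hhh : h * h = h := by rw [hh, diagProj_mul, Finset.inter_self]
      have hBe : B * e' * h = h := by
        calc B * e' * h = B * (h * e' * h) := by rw [← mul_assoc, ← mul_assoc, hBh]
          _ = h := by rw [hheh, hB, Matrix.single_mul_single_same, hα', hb1, ← hhs]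
      have heB : h * e' * B = h := by
        calc h * e' * B = (h * e' * h) * B := by rw [mul_assoc (h * e'), hhB]
          _ = h := by rw [hheh, hB, Matrix.single_mul_single_same, hα', hb2, ← hhs]
      have hhgr : h ∈ gradedMatrix hR ε := diagProj_mem_gradedMatrix hR ε _
      have hBgr : B ∈ gradedMatrix hR ε := single_mem_gradedMatrix hR ε k hb
      have hUe : B * e' * B = B := by
        calc B * e' * B = (B * e' * h) * B := by rw [mul_assoc (B * e'), hhB]
          _ = B := by rw [hBe, hhB]
      have hS : diagProj (X.O.obj (op V)) (insert k S) = diagProj _ S + h :=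
        diagProj_insert hk
      -- Row k of the remainder vanishes here, and column k in `hz2`; so the remainder is supported
      -- on `S` and the induction hypothesis applies.
      have hz1 : h * (e' - e' * B * e') = 0 := by
        calc h * (e' - e' * B * e') = h * e' - (h * e' * B) * e' := by noncomm_ring
          _ = 0 := by rw [heB, sub_self]
      have hz2 : (e' - e' * B * e') * h = 0 := by
        calc (e' - e' * B * e') * h = e' * h - e' * (B * e' * h) := by noncomm_ring
          _ = 0 := by rw [hBe, sub_self]
      obtain ⟨W, hWV, T, a, ha, b', hb', hxW, hTS, hab, hba⟩ := ih V hxV (e' - e' * B * e')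
        (sub_mem hgr' (mul_mem (mul_mem hgr' hBgr) hgr')) (idempotent_sub_pivot hee' hUe)
        (by
          have : diagProj _ (insert k S) * (e' - e' * B * e') = e' - e' * B * e' := by
            rw [mul_sub, ← mul_assoc, ← mul_assoc, h1']
          rwa [hS, add_mul, hz1, add_zero] at this)
        (by
          have : (e' - e' * B * e') * diagProj _ (insert k S) = e' - e' * B * e' := by
            rw [sub_mul, mul_assoc, h2']
          rwa [hS, mul_add, hz2, add_zero] at this)
      let r : Matrix K K (X.O.obj (op V)) →+* Matrix K K (X.O.obj (op W)) :=
        (X.res hWV).mapMatrix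
      have hr : ∀ m ∈ gradedMatrix hR ε, r m ∈ gradedMatrix (X.isSuperRing (op W)) ε :=
        fun m hm => map_res_mem_gradedMatrix ε hWV hm
      have hrh : r h = diagProj _ {k} := diagProj_map (X.res hWV) _
      -- This is why the induction also records `T ⊆ S`: the new coordinate k must be orthogonal to
      -- those already used.
      have hkT : k ∉ T := fun h => hk (hTS h)
      have hsplit := splitting_of_sub_pivot (e := r e') (h := r h) (B := r B) (p := diagProj _ T)
        (by rw [← map_mul, hee']) (by rw [← map_mul, hhB]) (by rw [← map_mul, ← map_mul, hBe])
        (by rw [diagProj_mul, Finset.inter_self])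
        (by rw [hrh]; exact diagProj_mul_singleton_of_notMem hkT)
        (by rw [hrh]; exact singleton_mul_diagProj_of_notMem hkT)
        (hab.trans (by change r _ = _; rw [map_sub, map_mul, map_mul])) hba
      refine ⟨W, hWV.trans hVU, insert k T, a * b' * a + r e' * r h, ?_, b' * a * b' + r B * r e',
        ?_, hxW, Finset.insert_subset_insert k hTS, ?_, ?_⟩
      · exact add_mem (mul_mem (mul_mem ha hb') ha) (mul_mem (hr _ hgr') (hr _ hhgr))
      · exact add_mem (mul_mem (mul_mem hb' ha) hb') (mul_mem (hr _ hBgr) (hr _ hgr'))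
      · rw [hsplit.1, ← map_res_res hVU hWV]; rfl
      · rw [hsplit.2, diagProj_insert hkT, hrh]
    · have hα1 : 1 - e k k ∈ X.gr (op U) 0 := sub_mem (X.isSuperRing (op U)).one_mem hα
      -- Now 1 - e_kk is the unit. No summand is split off: e is replaced by an equivalent
      -- idempotent y z that does not involve the coordinate k.
      obtain ⟨V, hVU, b, hxV, hb, hb1, hb2⟩ := exists_even_inverse hU hα1
        (by rw [map_sub, map_one]; exact hu)
      have hR := X.isSuperRing (op V)
      set e' : Matrix K K (X.O.obj (op V)) := e.map (X.res hVU) with he'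
      have hα' : e' k k = X.res hVU (e k k) := rfl
      have h1' : diagProj _ (insert k S) * e' = e' := by
        rw [he', ← diagProj_map (X.res hVU), ← Matrix.map_mul, h1]
      have h2' : e' * diagProj _ (insert k S) = e' := by
        rw [he', ← diagProj_map (X.res hVU), ← Matrix.map_mul, h2]
      have hee' : e' * e' = e' := by rw [he', ← Matrix.map_mul, hee]
      have hgr' : e' ∈ gradedMatrix hR ε := map_res_mem_gradedMatrix ε hVU he
      set h : Matrix K K (X.O.obj (op V)) := diagProj _ {k} with hh
      set B : Matrix K K (X.O.obj (op V)) := Matrix.single k k b with hB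
      have hhs : h = Matrix.single k k 1 := diagProj_singleton k
      have hBh : B * h = B := by rw [hhs, hB, Matrix.single_mul_single_same, mul_one]
      have hheh : h * e' * h = Matrix.single k k (e' k k) := diagProj_mul_mul_single e' k
      have hhh : h * h = h := by rw [hh, diagProj_mul, Finset.inter_self]
      have hs : ∀ p q : X.O.obj (op V), Matrix.single k k p - Matrix.single k k q =
          Matrix.single k k (p - q) :=
        fun p q => (map_sub (Matrix.singleAddMonoidHom k k) p q).symm
      have hBe : B - B * e' * h = h := by
        calc B - B * e' * h = B * h - B * (h * e' * h) := by
              rw [← mul_assoc, ← mul_assoc, hBh]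
          _ = h := by
            rw [hheh, hhs, hB, Matrix.single_mul_single_same, Matrix.single_mul_single_same, hα',
              hs, ← mul_sub, ← map_one (X.res hVU), ← map_sub, hb1, map_one]
      have hhgr : h ∈ gradedMatrix hR ε := diagProj_mem_gradedMatrix hR ε _
      have hBgr : B ∈ gradedMatrix hR ε := single_mem_gradedMatrix hR ε k hb
      have hS : diagProj (X.O.obj (op V)) (insert k S) = diagProj _ S + h :=
        diagProj_insert hk
      have hSh : diagProj (X.O.obj (op V)) S * h = 0 := diagProj_mul_singleton_of_notMem hk
      have hhS : h * diagProj (X.O.obj (op V)) S = 0 := singleton_mul_diagProj_of_notMem hk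
      set y := (1 - h) * e' with hy
      set z := (1 + e' * B) * e' * (1 - h) with hz
      have hzy : z * y = e' := factor_of_one_sub_pivot hee' hhh hBe
      have hez : e' * z = z := mul_factor_of_one_sub_pivot hee'
      have hygr : y ∈ gradedMatrix hR ε := mul_mem (sub_mem (one_mem _) hhgr) hgr'
      have hzgr : z ∈ gradedMatrix hR ε :=
        mul_mem (mul_mem (add_mem (one_mem _) (mul_mem hgr' hBgr)) hgr')
          (sub_mem (one_mem _) hhgr)
      have hSy : diagProj _ S * y = y := by
        calc diagProj _ S * y = diagProj _ (insert k S) * e' - h * e' -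
              (diagProj _ S * h) * e' := by rw [hS, hy]; noncomm_ring
          _ = y := by rw [h1', hSh, hy]; noncomm_ring
      have hzS : z * diagProj _ S = z := by
        calc z * diagProj _ S = (1 + e' * B) * (e' * diagProj _ (insert k S)) -
              (1 + e' * B) * e' * h - (1 + e' * B) * e' * (h * diagProj _ S) := by
                rw [hS, hz]; noncomm_ring
          _ = z := by rw [h2', hhS, hz]; noncomm_ring
      obtain ⟨W, hWV, T, a, ha, b', hb', hxW, hTS, hab, hba⟩ := ih V hxV (y * z)
        (mul_mem hygr hzgr)
        (by rw [mul_assoc, ← mul_assoc z, hzy, hez]) (by rw [← mul_assoc, hSy])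
        (by rw [mul_assoc, hzS])
      let r : Matrix K K (X.O.obj (op V)) →+* Matrix K K (X.O.obj (op W)) :=
        (X.res hWV).mapMatrix
      have hr : ∀ m ∈ gradedMatrix hR ε, r m ∈ gradedMatrix (X.isSuperRing (op W)) ε :=
        fun m hm => map_res_mem_gradedMatrix ε hWV hm
      have hab' : a * b' = r y * r z := hab.trans (by change r _ = _; rw [map_mul])
      have hpp : diagProj (X.O.obj (op W)) T * diagProj _ T = diagProj _ T := by
        rw [diagProj_mul, Finset.inter_self]
      -- From z y = e and the splitting a b' = y z, the pair (z a, b' y) splits e with the same set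
      -- `T`.
      refine ⟨W, hWV.trans hVU, T, r z * a, mul_mem (hr _ hzgr) ha, b' * r y,
        mul_mem hb' (hr _ hygr), hxW, hTS.trans (Finset.subset_insert k S), ?_, ?_⟩
      · rw [← map_res_res hVU hWV]
        change _ = r e'
        calc r z * a * (b' * r y) = r z * (a * b') * r y := by simp only [mul_assoc]
          _ = r z * r y * (r z * r y) := by rw [hab']; simp only [mul_assoc]
          _ = r e' := by rw [← map_mul, hzy, ← map_mul, hee']
      · calc b' * r y * (r z * a) = b' * (r y * r z) * a := by simp only [mul_assoc]
          _ = b' * a * (b' * a) := by rw [← hab']; simp only [mul_assoc]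
          _ = _ := by rw [hba, hpp]

end RingedSuperspace

end

/-! ### Dual bases of presheaves of supermodules and local freeness. -/

section

namespace SuperPresheaf

variable {X : RingedSuperspace.{u}} (F G : SuperPresheaf X) {U V W : Opens X.space}

/-- Restriction of sections. -/
def res {U V : Opens X.space} (h : V ≤ U) :
    F.presheaf.obj (op U) →+ F.presheaf.obj (op V) :=
  (F.presheaf.map (homOfLE h).op).hom

variable {F}

theorem res_res (h : V ≤ U) (h' : W ≤ V) (s : F.presheaf.obj (op U)) :
    F.res h' (F.res h s) = F.res (h'.trans h) s :=
  (congrArg (fun g : F.presheaf.obj (op U) ⟶ F.presheaf.obj (op W) => g s)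
    (F.presheaf.map_comp (homOfLE h).op (homOfLE h').op)).symm

theorem res_self (h : U ≤ U) (s : F.presheaf.obj (op U)) : F.res h s = s :=
  congrArg (fun g : F.presheaf.obj (op U) ⟶ F.presheaf.obj (op U) => g s)
    (F.presheaf.map_id (op U))

theorem res_mem (h : V ≤ U) {i : ZMod 2} {s : F.presheaf.obj (op U)} (hs : s ∈ F.gr (op U) i) :
    F.res h s ∈ F.gr (op V) i := F.map_mem _ hs

theorem res_smul (h : V ≤ U) (a : X.O.obj (op U)) (s : F.presheaf.obj (op U)) :
    F.res h (MulOpposite.op a • s) = MulOpposite.op (X.res h a) • F.res h s :=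
  F.map_smul (homOfLE h).op a s

theorem germ_res (h : V ≤ U) {x : X.space} (hx : x ∈ V) (s : F.presheaf.obj (op U)) :
    F.presheaf.germ V x hx (F.res h s) = F.presheaf.germ U x (h hx) s :=
  TopCat.Presheaf.germ_res_apply F.presheaf (homOfLE h) x hx s

theorem exists_res_eq_of_germ_eq {x : X.space} (hx : x ∈ U) {s t : F.presheaf.obj (op U)}
    (h : F.presheaf.germ U x hx s = F.presheaf.germ U x hx t) :
    ∃ (V : Opens X.space) (h : V ≤ U), x ∈ V ∧ F.res h s = F.res h t := by
  obtain ⟨V, hV, i, i', e⟩ := F.presheaf.germ_eq x hx hx _ _ h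
  exact ⟨V, i.le, hV, e⟩

variable (F)

/-- A finite homogeneous dual basis of `F` over `U`: homogeneous sections `vec k` together with
natural right linear functionals `coord k` such that `s = ∑ vec k · coord k s`. -/
structure DualBasis (U : Opens X.space) (K : Type*) [Fintype K] (ε : K → ZMod 2) where
  vec : K → F.presheaf.obj (op U)
  vec_mem : ∀ k, vec k ∈ F.gr (op U) (ε k)
  coord : ∀ (_ : K) {V : Opens X.space}, V ≤ U → (F.presheaf.obj (op V) →+ X.O.obj (op V))
  coord_smul : ∀ k {V : Opens X.space} (h : V ≤ U) (a : X.O.obj (op V))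
    (s : F.presheaf.obj (op V)), coord k h (MulOpposite.op a • s) = coord k h s * a
  coord_mem : ∀ k {V : Opens X.space} (h : V ≤ U) {i : ZMod 2} {s : F.presheaf.obj (op V)},
    s ∈ F.gr (op V) i → coord k h s ∈ X.gr (op V) (i + ε k)
  coord_res : ∀ k {V W : Opens X.space} (h : V ≤ U) (h' : W ≤ V) (s : F.presheaf.obj (op V)),
    coord k (h'.trans h) (F.res h' s) = X.res h' (coord k h s)
  sum_eq : ∀ {V : Opens X.space} (h : V ≤ U) (s : F.presheaf.obj (op V)),
    ∑ k, MulOpposite.op (coord k h s) • F.res h (vec k) = s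

namespace DualBasis

variable {F G} {K L : Type*} [Fintype K] [Fintype L] {ε : K → ZMod 2} {δ : L → ZMod 2}

/-- The matrix of the values of the functionals on the vectors. -/
def gram (D : F.DualBasis U K ε) : Matrix K K (X.O.obj (op U)) :=
  fun k l => D.coord k le_rfl (D.vec l)

theorem coord_vec (D : F.DualBasis U K ε) (h : V ≤ U) (k l : K) :
    D.coord k h (F.res h (D.vec l)) = X.res h (D.gram k l) :=
  D.coord_res k le_rfl h (D.vec l)

theorem gram_mem [DecidableEq K] (D : F.DualBasis U K ε) : D.gram ∈ gradedMatrix (X.isSuperRing (op U)) ε :=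
  fun i j => by
    rw [add_comm]; exact D.coord_mem i le_rfl (D.vec_mem j)

theorem coord_sum_smul (D : F.DualBasis U K ε) (h : V ≤ U) (k : K) {ι : Type*} (S : Finset ι)
    (a : ι → X.O.obj (op V)) (s : ι → F.presheaf.obj (op V)) :
    D.coord k h (∑ i ∈ S, MulOpposite.op (a i) • s i) = ∑ i ∈ S, D.coord k h (s i) * a i := by
  rw [map_sum]
  exact Finset.sum_congr rfl fun i _ => D.coord_smul k h _ _

/-- Applying a functional to the expansion of s shows that the coordinate vector of s is fixed by
the Gram matrix. This places F inside the image of the matrix in O^K, and idempotency is the special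
case of the basis sections. -/
theorem gram_mulVec_coord (D : F.DualBasis U K ε) (h : V ≤ U) (k : K)
    (s : F.presheaf.obj (op V)) :
    ∑ l, X.res h (D.gram k l) * D.coord l h s = D.coord k h s := by
  conv_rhs => rw [← D.sum_eq h s]
  rw [D.coord_sum_smul]
  exact Finset.sum_congr rfl fun l _ => by rw [D.coord_vec]

theorem gram_mul_gram (D : F.DualBasis U K ε) : D.gram * D.gram = D.gram := by
  ext i j
  rw [Matrix.mul_apply]
  have := D.gram_mulVec_coord le_rfl i (D.vec j)
  simp only [RingedSuperspace.res_self] at this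
  exact this

/-- Restriction of a dual basis to a smaller open set. -/
def restrict (D : F.DualBasis U K ε) (hV : V ≤ U) : F.DualBasis V K ε where
  vec k := F.res hV (D.vec k)
  vec_mem k := res_mem hV (D.vec_mem k)
  coord k _ h := D.coord k (h.trans hV)
  coord_smul k _ h := D.coord_smul k (h.trans hV)
  coord_mem k _ h := D.coord_mem k (h.trans hV)
  coord_res k _ _ h := D.coord_res k (h.trans hV)
  sum_eq h s := by
    simp only [res_res]; exact D.sum_eq (h.trans hV) s

theorem restrict_gram (D : F.DualBasis U K ε) (hV : V ≤ U) :
    (D.restrict hV).gram = D.gram.map (X.res hV) := by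
  ext i j; exact D.coord_vec hV i j

/-- Change of a dual basis along a factorisation of its Gram matrix. -/
def change (D : F.DualBasis U K ε) (a : Matrix K L (X.O.obj (op U)))
    (b : Matrix L K (X.O.obj (op U))) (ha : ∀ k l, a k l ∈ X.gr (op U) (ε k + δ l))
    (hb : ∀ l k, b l k ∈ X.gr (op U) (δ l + ε k)) (hab : a * b = D.gram) :
    F.DualBasis U L δ where
  vec l := ∑ k, MulOpposite.op (a k l) • D.vec k
  vec_mem l := sum_mem fun k _ => by
    have := (F.isSuperModule (op U)).smul_mem (D.vec_mem k) (ha k l)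
    rwa [← add_assoc, zmod_two_add_self, zero_add] at this
  coord l _ h := ∑ k, (AddMonoidHom.mulLeft (X.res h (b l k))).comp (D.coord k h)
  coord_smul l _ h c s := by
    simp only [AddMonoidHom.finsetSum_apply, AddMonoidHom.comp_apply, AddMonoidHom.coe_mulLeft,
      D.coord_smul, Finset.sum_mul, mul_assoc]
  coord_mem l _ h i s hs := by
    simp only [AddMonoidHom.finsetSum_apply, AddMonoidHom.comp_apply, AddMonoidHom.coe_mulLeft]
    refine sum_mem fun k _ => ?_
    have := (X.isSuperRing _).mul_mem (RingedSuperspace.res_mem h (hb l k)) (D.coord_mem k h hs)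
    rwa [show δ l + ε k + (i + ε k) = i + δ l by
      rw [add_add_add_comm, zmod_two_add_self, add_zero, add_comm]] at this
  coord_res l _ _ h h' s := by
    simp only [AddMonoidHom.finsetSum_apply, AddMonoidHom.comp_apply, AddMonoidHom.coe_mulLeft,
      map_sum, map_mul, RingedSuperspace.res_res]
    exact Finset.sum_congr rfl fun k _ => congrArg _ (D.coord_res k h h' s)
  sum_eq {V} h s := by
    simp only [AddMonoidHom.finsetSum_apply, AddMonoidHom.comp_apply, AddMonoidHom.coe_mulLeft,
      map_sum, res_smul, Finset.smul_sum, ← mul_smul, ← MulOpposite.op_mul]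
    rw [Finset.sum_comm]
    conv_rhs => rw [← D.sum_eq h s]
    refine Finset.sum_congr rfl fun k _ => ?_
    -- Coordinate vectors are fixed by the Gram matrix a b; this is all that is needed, and b a need
    -- not be the identity.
    rw [← D.gram_mulVec_coord h k s, ← Finset.sum_smul, ← Finset.op_sum]
    congr 2
    simp only [← hab, Matrix.mul_apply, map_sum, map_mul, Finset.mul_sum, Finset.sum_mul,
      mul_assoc]
    rw [Finset.sum_comm]

/-- The new Gram matrix is b g a with g = a b. It is the identity as soon as b a = 1, the case used
for local freeness. -/
theorem change_gram (D : F.DualBasis U K ε) (a : Matrix K L (X.O.obj (op U)))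
    (b : Matrix L K (X.O.obj (op U))) (ha : ∀ k l, a k l ∈ X.gr (op U) (ε k + δ l))
    (hb : ∀ l k, b l k ∈ X.gr (op U) (δ l + ε k)) (hab : a * b = D.gram) :
    (D.change a b ha hb hab).gram = b * a * (b * a) := by
  ext l l'
  change (∑ k, (AddMonoidHom.mulLeft (X.res le_rfl (b l k))).comp (D.coord k le_rfl))
    (∑ k, MulOpposite.op (a k l') • D.vec k) = _
  have : ∀ k, D.coord k le_rfl (∑ k, MulOpposite.op (a k l') • D.vec k) =
      (D.gram * a) k l' := fun k => by
    rw [D.coord_sum_smul, Matrix.mul_apply]; rfl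
  simp only [AddMonoidHom.finsetSum_apply, AddMonoidHom.comp_apply, AddMonoidHom.coe_mulLeft,
    this, RingedSuperspace.res_self]
  rw [← Matrix.mul_apply, ← hab, Matrix.mul_assoc, Matrix.mul_assoc]

/-- The linear map between the sections of two presheaves with dual bases. -/
def linearMap (D : F.DualBasis U K ε) (D' : G.DualBasis U K ε) (h : V ≤ U) :
    F.presheaf.obj (op V) →ₗ[(X.O.obj (op V))ᵐᵒᵖ] G.presheaf.obj (op V) where
  toFun s := ∑ k, MulOpposite.op (D.coord k h s) • G.res h (D'.vec k)
  map_add' s t := by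
    simp only [map_add, MulOpposite.op_add, add_smul, Finset.sum_add_distrib]
  map_smul' a s := by
    simp only [RingHom.id_apply, Finset.smul_sum, ← mul_smul]
    refine Finset.sum_congr rfl fun k _ => ?_
    congr 1
    exact congrArg MulOpposite.op (D.coord_smul k h a.unop s)

theorem linearMap_apply (D : F.DualBasis U K ε) (D' : G.DualBasis U K ε) (h : V ≤ U)
    (s : F.presheaf.obj (op V)) : linearMap D D' h s =
      ∑ k, MulOpposite.op (D.coord k h s) • G.res h (D'.vec k) := rfl

/-- The homomorphism between the sections of two presheaves with dual bases. -/
def homOfDualBasis (D : F.DualBasis U K ε) (D' : G.DualBasis U K ε) (h : V ≤ U) :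
    F.sections (op V) ⟶ G.sections (op V) where
  hom := linearMap D D' h
  map_mem {i s} hs := sum_mem fun k _ => by
    have := (G.isSuperModule (op V)).smul_mem (res_mem h (D'.vec_mem k)) (D.coord_mem k h hs)
    rwa [add_comm, zmod_two_add_add_cancel] at this

/-- The coordinates of the image of s are the Gram matrix of `D'` applied to the coordinates of s.
When the Gram matrices agree these are the coordinates of s itself, so the return map reassembles s.
-/
theorem linearMap_linearMap (D : F.DualBasis U K ε) (D' : G.DualBasis U K ε)
    (e : D.gram = D'.gram) (h : V ≤ U) (s : F.presheaf.obj (op V)) :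
    linearMap D' D h (linearMap D D' h s) = s := by
  refine Eq.trans ?_ (D.sum_eq h s)
  rw [linearMap_apply, linearMap_apply]
  refine Finset.sum_congr rfl fun k _ => ?_
  rw [D'.coord_sum_smul, ← D.gram_mulVec_coord h k s, e]
  simp only [D'.coord_vec]

theorem homOfDualBasis_comp (D : F.DualBasis U K ε) (D' : G.DualBasis U K ε)
    (e : D.gram = D'.gram) (h : V ≤ U) :
    homOfDualBasis D D' h ≫ homOfDualBasis D' D h = 𝟙 (F.sections (op V)) :=
  SuperModule.Hom.ext (LinearMap.ext fun s => linearMap_linearMap D D' e h s)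

/-- Two presheaves with dual bases that have the same Gram matrix are isomorphic. -/
def isoOn (D : F.DualBasis U K ε) (D' : G.DualBasis U K ε) (e : D.gram = D'.gram) :
    IsoOn U F G where
  iso V h :=
    { hom := homOfDualBasis D D' h
      inv := homOfDualBasis D' D h
      hom_inv_id := homOfDualBasis_comp D D' e h
      inv_hom_id := homOfDualBasis_comp D' D e.symm h }
  map_iso {V W} h i s := by
    change G.res i.le (linearMap D D' h s) = linearMap D D' (i.le.trans h) (F.res i.le s)
    rw [linearMap_apply, linearMap_apply, map_sum]
    simp only [res_smul, res_res]
    refine Finset.sum_congr rfl fun k _ => ?_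
    rw [← D.coord_res k h i.le s]

/-- A dual basis on an isomorphic presheaf. -/
def transport (D : G.DualBasis U K ε) (φ : IsoOn U F G) : F.DualBasis U K ε where
  vec k := (φ.iso U le_rfl).inv.hom (D.vec k)
  vec_mem k := (φ.iso U le_rfl).inv.map_mem (D.vec_mem k)
  coord k V h := (D.coord k h).comp (φ.iso V h).hom.hom.toAddMonoidHom
  coord_smul k V h a s := by
    refine Eq.trans ?_ (D.coord_smul k h a ((φ.iso V h).hom.hom s))
    exact congrArg (D.coord k h) ((φ.iso V h).hom.hom.map_smul (MulOpposite.op a) s)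
  coord_mem k V h i s hs := D.coord_mem k h ((φ.iso V h).hom.map_mem hs)
  coord_res k V W h h' s := by
    refine Eq.trans ?_ (D.coord_res k h h' ((φ.iso V h).hom.hom s))
    exact congrArg (D.coord k (h'.trans h)) (φ.map_iso h (homOfLE h') s).symm
  sum_eq {V} h s := by
    have hinj : Function.Injective (φ.iso V h).hom.hom := fun s t hst => by
      have h1 : ∀ s, (φ.iso V h).inv.hom ((φ.iso V h).hom.hom s) = s := fun s =>
        LinearMap.congr_fun (congrArg SuperModule.Hom.hom (φ.iso V h).hom_inv_id) s
      rw [← h1 s, hst, h1 t]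
    apply hinj
    refine Eq.trans ?_ (D.sum_eq h ((φ.iso V h).hom.hom s))
    refine (map_sum (φ.iso V h).hom.hom _ _).trans (Finset.sum_congr rfl fun k _ => ?_)
    refine ((φ.iso V h).hom.hom.map_smul _ _).trans (congrArg _ ?_)
    refine (φ.map_iso le_rfl (homOfLE h) _).symm.trans ?_
    exact congrArg (G.res h) (LinearMap.congr_fun
      (congrArg SuperModule.Hom.hom (φ.iso U le_rfl).inv_hom_id) (D.vec k))

end DualBasis

theorem sum_single_prod_sum_single {R I J : Type*} [Ring R] [Fintype I] [Fintype J] (s : I →₀ R)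
    (t : J →₀ R) : ((∑ i, (Finsupp.single i (s i), 0)) + ∑ j, (0, Finsupp.single j (t j)) :
      (I →₀ R) × (J →₀ R)) = (s, t) := by
  refine Prod.ext ?_ ?_
  · simp [Prod.fst_sum, Finsupp.univ_sum_single]
  · simp [Prod.snd_sum, Finsupp.univ_sum_single]

/-- The standard dual basis of `O_X^(I|J)`. -/
def freeDualBasis (X : RingedSuperspace.{u}) (U : Opens X.space) (I J : Type u) [Fintype I]
    [Fintype J] : (free X I J).DualBasis U (I ⊕ J) (Sum.elim (fun _ => 0) (fun _ => 1)) where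
  vec := Sum.elim (fun i => (Finsupp.single i 1, 0)) (fun j => (0, Finsupp.single j 1))
  vec_mem k := by
    have h1 : (1 : X.O.obj (op U)) ∈ X.gr (op U) 0 := (X.isSuperRing _).one_mem
    rcases k with i | j
    · refine ⟨fun k => ?_, fun k => zero_mem _⟩
      classical
      change Finsupp.single i (1 : X.O.obj (op U)) k ∈ X.gr (op U) 0
      rw [Finsupp.single_apply]
      split_ifs
      exacts [h1, zero_mem _]
    · refine ⟨fun k => zero_mem _, fun k => ?_⟩
      classical
      change Finsupp.single j (1 : X.O.obj (op U)) k ∈ X.gr (op U) (1 + 1)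
      rw [Finsupp.single_apply, zmod_two_add_self]
      split_ifs
      exacts [h1, zero_mem _]
  coord k V _ :=
    { toFun := fun s : (I →₀ X.O.obj (op V)) × (J →₀ X.O.obj (op V)) =>
        k.elim (fun i => s.1 i) (fun j => s.2 j)
      map_zero' := by rcases k with i | j <;> rfl
      map_add' := fun s t => by rcases k with i | j <;> rfl }
  coord_smul k V _ a s := by rcases k with i | j <;> rfl
  coord_mem k V _ i s hs := by
    rcases k with k | k
    · have := hs.1 k
      rwa [← add_zero i] at this
    · exact hs.2 k
  coord_res k V W _ h s := by rcases k with i | j <;> rfl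
  sum_eq {V} h s := by
    obtain ⟨s, t⟩ := s
    have h1 : ∀ i, MulOpposite.op (α := X.O.obj (op V)) (s i) • (free X I J).res h
        ((Finsupp.single i 1, 0) : (I →₀ X.O.obj (op U)) × (J →₀ X.O.obj (op U))) =
        ((Finsupp.single i (s i), 0) : (I →₀ X.O.obj (op V)) × (J →₀ X.O.obj (op V))) := by
      intro i
      refine Prod.ext ?_ ?_
      · change MulOpposite.op (α := X.O.obj (op V)) (s i) • Finsupp.mapRange (X.res h) (map_zero _) (Finsupp.single i 1) = _
        rw [Finsupp.mapRange_single, map_one, Finsupp.smul_single]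
        exact congrArg (Finsupp.single i) (one_mul (M := X.O.obj (op V)) (s i))
      · change MulOpposite.op (α := X.O.obj (op V)) (s i) • Finsupp.mapRange (X.res h) (map_zero _) 0 = _
        rw [Finsupp.mapRange_zero, smul_zero]
    have h2 : ∀ j, MulOpposite.op (α := X.O.obj (op V)) (t j) • (free X I J).res h
        ((0, Finsupp.single j 1) : (I →₀ X.O.obj (op U)) × (J →₀ X.O.obj (op U))) =
        ((0, Finsupp.single j (t j)) : (I →₀ X.O.obj (op V)) × (J →₀ X.O.obj (op V))) := by
      intro i
      refine Prod.ext ?_ ?_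
      · change MulOpposite.op (α := X.O.obj (op V)) (t i) • Finsupp.mapRange (X.res h) (map_zero _) 0 = _
        rw [Finsupp.mapRange_zero, smul_zero]
      · change MulOpposite.op (α := X.O.obj (op V)) (t i) • Finsupp.mapRange (X.res h) (map_zero _) (Finsupp.single i 1) = _
        rw [Finsupp.mapRange_single, map_one, Finsupp.smul_single]
        exact congrArg (Finsupp.single i) (one_mul (M := X.O.obj (op V)) (t i))
    rw [Fintype.sum_sum_type]
    refine (congrArg₂ (· + ·) (Finset.sum_congr rfl fun i _ => h1 i)
      (Finset.sum_congr rfl fun j _ => h2 j)).trans ?_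
    exact sum_single_prod_sum_single (R := X.O.obj (op V)) s t

theorem freeDualBasis_gram (X : RingedSuperspace.{u}) (U : Opens X.space) (I J : Type u) [Fintype I]
    [Fintype J] [DecidableEq I] [DecidableEq J] : (freeDualBasis X U I J).gram = 1 := by
  have h : ∀ {I : Type u} [DecidableEq I] (k l : I),
      Finsupp.single l (1 : X.O.obj (op U)) k = if k = l then 1 else 0 := by
    intro I _ k l
    rw [Finsupp.single_apply]
    simp only [eq_comm]
  ext k l
  rw [Matrix.one_apply]
  rcases k with k | k <;> rcases l with l | l
  · refine (h k l).trans ?_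
    simp only [Sum.inl.injEq]
  · rw [if_neg Sum.inl_ne_inr]; rfl
  · rw [if_neg Sum.inr_ne_inl]; rfl
  · refine (h k l).trans ?_
    simp only [Sum.inr.injEq]

/-- A presheaf with a finite dual basis is locally free. -/
theorem DualBasis.exists_isoOn_free {F : SuperPresheaf X} (hX : X.IsLocallyRinged) {K : Type u}
    [Fintype K] {ε : K → ZMod 2} (D : F.DualBasis U K ε) {x : X.space} (hx : x ∈ U) :
    ∃ (V : Opens X.space) (_ : V ≤ U) (_ : x ∈ V) (I J : Type u) (_ : Finite I) (_ : Finite J),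
      Nat.card I + Nat.card J ≤ Fintype.card K ∧ Nonempty (IsoOn V F (free X I J)) := by
  classical
  -- Starting from all coordinates, the support conditions of the splitting are vacuous. The even
  -- and odd indices in `T` become I and J, so |I| + |J| = |T| ≤ |K|.
  obtain ⟨V, hV, T, a, ha, b, hb, hxV, -, hab, hba⟩ :=
    RingedSuperspace.exists_local_splitting ε hX Finset.univ U hx D.gram D.gram_mem D.gram_mul_gram
      (by simp [diagProj]) (by simp [diagProj])
  let I := {k : T // ε k = 0}
  let J := {k : T // ¬ ε k = 0}
  let e : I ⊕ J ≃ T := Equiv.sumCompl fun k : T => ε k = 0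
  have he : ∀ l : I ⊕ J, Sum.elim (fun _ => (0 : ZMod 2)) (fun _ => 1) l = ε (e l) := by
    rintro (⟨k, hk⟩ | ⟨k, hk⟩)
    · exact hk.symm
    · exact ((zmod_two_cases _).resolve_left hk).symm
  have hT : ∀ k k', (a * diagProj (X.O.obj (op V)) T * b) k k' = ∑ l : I ⊕ J, a k (e l) * b (e l) k' := by
    intro k k'
    rw [Equiv.sum_comp e fun t : T => a k t * b t k', Finset.sum_coe_sort T
      fun t => a k t * b t k', Matrix.mul_apply]
    simp only [diagProj, Matrix.mul_diagonal]
    simp [Finset.sum_ite_mem]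
  have hgram := D.restrict_gram hV
  let D' := (D.restrict hV).change (δ := Sum.elim (fun _ => 0) (fun _ => 1))
    (Matrix.of fun k (l : I ⊕ J) => a k (e l)) (Matrix.of fun (l : I ⊕ J) k => b (e l) k)
    (fun k l => by rw [he]; exact ha _ _) (fun l k => by rw [he]; exact hb _ _)
    (by
      -- Discarding the columns of a and the rows of b outside `T` does no harm: b a is the
      -- projection onto `T`, so the truncated product is a(b a)b = (a b)², which is the Gram matrix
      -- again.
      have h2 : D.gram.map (X.res hV) * D.gram.map (X.res hV) = D.gram.map (X.res hV) := by
        rw [← Matrix.map_mul, D.gram_mul_gram]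
      rw [hgram, ← h2, ← hab]
      ext k k'
      rw [Matrix.mul_assoc a b, ← Matrix.mul_assoc b a, hba, ← Matrix.mul_assoc, hT]
      rfl)
  have hba' : Matrix.of (fun (l : I ⊕ J) k => b (e l) k) * Matrix.of (fun k l => a k (e l)) =
      1 := by
    ext l l'
    have : (b * a) (e l) (e l') = (1 : Matrix (I ⊕ J) (I ⊕ J) (X.O.obj (op V))) l l' := by
      rw [hba, diagProj_apply, Matrix.one_apply]
      simp only [Subtype.coe_inj, e.injective.eq_iff, (e l).2, and_true]
    exact this
  refine ⟨V, hV, hxV, I, J, inferInstance, inferInstance, ?_,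
    ⟨isoOn D' (freeDualBasis X V I J) ?_⟩⟩
  · rw [← Nat.card_sum, Nat.card_congr e]
    simpa using T.card_le_univ
  · rw [freeDualBasis_gram, DualBasis.change_gram, hba', mul_one]

/-- A presheaf of supermodules that is isomorphic to a free one over `U` has a dual basis. -/
theorem IsoOn.exists_dualBasis {F : SuperPresheaf X} {I J : Type u} [Finite I] [Finite J]
    (φ : IsoOn U F (free X I J)) :
    ∃ (L : Type u) (_ : Fintype L) (δ : L → ZMod 2), Nonempty (F.DualBasis U L δ) := by
  have := Fintype.ofFinite I
  have := Fintype.ofFinite J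
  exact ⟨I ⊕ J, inferInstance, _, ⟨(freeDualBasis X U I J).transport φ⟩⟩

/-- An isomorphism over the whole space is an isomorphism of presheaves. -/
def IsoOn.toIso {F G : SuperPresheaf X} (φ : IsoOn ⊤ F G) : F ≅ G where
  hom :=
    { hom :=
        { app := fun V => AddCommGrpCat.ofHom (φ.iso V.unop le_top).hom.hom.toAddMonoidHom
          naturality := fun V W f => by
            ext s
            exact (φ.map_iso (V := V.unop) (W := W.unop) le_top f.unop s).symm }
      map_smul := fun V a s => (φ.iso V.unop le_top).hom.hom.map_smul (MulOpposite.op a) s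
      map_mem := fun {V _ _} h => (φ.iso V.unop le_top).hom.map_mem h }
  inv :=
    { hom :=
        { app := fun V => AddCommGrpCat.ofHom (φ.iso V.unop le_top).inv.hom.toAddMonoidHom
          naturality := fun V W f => by
            have h1 : ∀ (V : Opens X.space) s, (φ.iso V le_top).inv.hom
              ((φ.iso V le_top).hom.hom s) = s := fun V s =>
              LinearMap.congr_fun (congrArg SuperModule.Hom.hom (φ.iso V le_top).hom_inv_id) s
            have h2 : ∀ (V : Opens X.space) s, (φ.iso V le_top).hom.hom
              ((φ.iso V le_top).inv.hom s) = s := fun V s =>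
              LinearMap.congr_fun (congrArg SuperModule.Hom.hom (φ.iso V le_top).inv_hom_id) s
            ext s
            have h3 := φ.map_iso (V := V.unop) (W := W.unop) le_top f.unop
              ((φ.iso V.unop le_top).inv.hom s)
            -- `IsoOn` records compatibility with restrictions only for the forward maps; for the
            -- inverses it follows by conjugation.
            have h4 := congrArg (φ.iso W.unop le_top).inv.hom h3
            refine Eq.trans ?_ (h4.trans (h1 W.unop _))
            exact congrArg (fun t => (φ.iso W.unop le_top).inv.hom (G.presheaf.map f t))
              (h2 V.unop s).symm }
      map_smul := fun V a s => (φ.iso V.unop le_top).inv.hom.map_smul (MulOpposite.op a) s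
      map_mem := fun {V _ _} h => (φ.iso V.unop le_top).inv.map_mem h }
  hom_inv_id := Hom.ext (NatTrans.ext (funext fun V => by
    ext s
    exact LinearMap.congr_fun
      (congrArg SuperModule.Hom.hom (φ.iso V.unop le_top).hom_inv_id) s))
  inv_hom_id := Hom.ext (NatTrans.ext (funext fun V => by
    ext s
    exact LinearMap.congr_fun
      (congrArg SuperModule.Hom.hom (φ.iso V.unop le_top).inv_hom_id) s))

end SuperPresheaf

end

/-! ### Dual bases of supermodules, and sheafification of presheaves with dual bases. -/

section

namespace SuperModule

variable {A : SuperRing.{u}}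

/-- A finite homogeneous dual basis of a right supermodule. -/
structure DualBasis (M : SuperModule A) (K : Type*) [Fintype K] (ε : K → ZMod 2) where
  vec : K → M
  vec_mem : ∀ k, vec k ∈ M.gr (ε k)
  coord : K → (M →+ A)
  coord_smul : ∀ k (a : A) (m : M), coord k (MulOpposite.op a • m) = coord k m * a
  coord_mem : ∀ k {i : ZMod 2} {m : M}, m ∈ M.gr i → coord k m ∈ A.gr (i + ε k)
  sum_eq : ∀ m : M, ∑ k, MulOpposite.op (coord k m) • vec k = m

/-- The standard basis of A^(I|J) and its coordinates pass to a retract. Although I and J may be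
infinite, finitely many generators of M involve only finitely many coordinates, and the others
vanish on all of M. -/
theorem exists_dualBasis_of_fgsp {M : SuperModule A} (hM : fgsp A M) :
    ∃ (K : Type u) (_ : Fintype K) (ε : K → ZMod 2), Nonempty (M.DualBasis K ε) := by
  classical
  obtain ⟨⟨S, hS⟩, I, J, ⟨r⟩⟩ := hM
  let i : M →ₗ[Aᵐᵒᵖ] ((I →₀ A) × (J →₀ A)) := r.i.hom
  let p : ((I →₀ A) × (J →₀ A)) →ₗ[Aᵐᵒᵖ] M := r.r.hom
  have hpi : ∀ m, p (i m) = m := fun m =>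
    LinearMap.congr_fun (congrArg SuperModule.Hom.hom r.retract) m
  let I' : Finset I := S.biUnion fun m => (i m).1.support
  let J' : Finset J := S.biUnion fun m => (i m).2.support
  have key : ∀ m, (i m).1.support ⊆ I' ∧ (i m).2.support ⊆ J' := by
    intro m
    have hm : m ∈ Submodule.span Aᵐᵒᵖ (S : Set M) := hS ▸ Submodule.mem_top
    induction hm using Submodule.span_induction with
    | mem m hm =>
      exact ⟨Finset.subset_biUnion_of_mem (fun m => (i m).1.support) hm,
        Finset.subset_biUnion_of_mem (fun m => (i m).2.support) hm⟩
    | zero => simp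
    | add a b _ _ ha hb =>
      rw [map_add]
      exact ⟨Finsupp.support_add.trans (Finset.union_subset ha.1 hb.1),
        Finsupp.support_add.trans (Finset.union_subset ha.2 hb.2)⟩
    | smul c a _ ha =>
      rw [map_smul]
      exact ⟨Finsupp.support_smul.trans ha.1, Finsupp.support_smul.trans ha.2⟩
  refine ⟨I' ⊕ J', inferInstance, Sum.elim (fun _ => 0) (fun _ => 1), ⟨{
    vec := Sum.elim (fun k => p (Finsupp.single k.1 1, 0)) (fun k => p (0, Finsupp.single k.1 1))
    vec_mem := ?_
    coord := Sum.elim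
      (fun k => ((Finsupp.applyAddHom k.1).comp (AddMonoidHom.fst _ _)).comp i.toAddMonoidHom)
      (fun k => ((Finsupp.applyAddHom k.1).comp (AddMonoidHom.snd _ _)).comp i.toAddMonoidHom)
    coord_smul := ?_
    coord_mem := ?_
    sum_eq := ?_ }⟩⟩
  · rintro (k | k)
    · refine r.r.map_mem ⟨fun j => ?_, fun j => zero_mem _⟩
      change Finsupp.single k.1 (1 : A) j ∈ A.gr 0
      rw [Finsupp.single_apply]
      split_ifs
      exacts [A.isSuperRing.one_mem, zero_mem _]
    · refine r.r.map_mem ⟨fun j => zero_mem _, fun j => ?_⟩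
      change Finsupp.single k.1 (1 : A) j ∈ A.gr (1 + 1)
      rw [Finsupp.single_apply, zmod_two_add_self]
      split_ifs
      exacts [A.isSuperRing.one_mem, zero_mem _]
  · rintro (k | k) a m
    · change (i (MulOpposite.op a • m)).1 k = (i m).1 k * a
      rw [map_smul]; rfl
    · change (i (MulOpposite.op a • m)).2 k = (i m).2 k * a
      rw [map_smul]; rfl
  · rintro (k | k) d m hm
    · have := (r.i.map_mem hm).1 k
      rwa [← add_zero d] at this
    · exact (r.i.map_mem hm).2 k
  · intro m
    rw [Fintype.sum_sum_type]
    change ∑ k : I', MulOpposite.op ((i m).1 k) • p (Finsupp.single k.1 1, 0) +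
      ∑ k : J', MulOpposite.op ((i m).2 k) • p (0, Finsupp.single k.1 1) = m
    rw [Finset.sum_coe_sort I' fun k => MulOpposite.op ((i m).1 k) • p (Finsupp.single k 1, 0),
      Finset.sum_coe_sort J' fun k => MulOpposite.op ((i m).2 k) • p (0, Finsupp.single k 1)]
    simp only [← map_smul]
    rw [← map_sum, ← map_sum, ← map_add]
    refine (congrArg p ?_).trans (hpi m)
    refine Prod.ext ?_ ?_
    · have := Finsupp.sum_of_support_subset (i m).1 (key m).1 Finsupp.single (by simp)
      rw [Finsupp.sum_single] at this
      rw [Prod.fst_add, Prod.fst_sum, Prod.fst_sum]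
      simp [← this]
    · have := Finsupp.sum_of_support_subset (i m).2 (key m).2 Finsupp.single (by simp)
      rw [Finsupp.sum_single] at this
      rw [Prod.snd_add, Prod.snd_sum, Prod.snd_sum]
      simp [← this]

/-- The coordinates embed M into A^(I|J) and the basis vectors give the retraction. Indexing by `I ⊕
J` with parities 0 and 1 matches the shape of `free`. -/
theorem DualBasis.fgsp {M : SuperModule A} {I J : Type u} [Fintype I] [Fintype J]
    (D : M.DualBasis (I ⊕ J) (Sum.elim (fun _ => 0) (fun _ => 1))) : fgsp A M := by
  classical
  constructor
  · refine ⟨⟨Finset.univ.image D.vec, ?_⟩⟩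
    rw [eq_top_iff]
    intro m _
    rw [← D.sum_eq m]
    exact sum_mem fun k _ => Submodule.smul_mem _ _ (Submodule.subset_span (by simp))
  · let i : M →ₗ[Aᵐᵒᵖ] ((I →₀ A) × (J →₀ A)) :=
      { toFun := fun m => (Finsupp.equivFunOnFinite.symm fun k => D.coord (Sum.inl k) m,
          Finsupp.equivFunOnFinite.symm fun k => D.coord (Sum.inr k) m)
        map_add' := fun m n => by
          refine Prod.ext (Finsupp.ext fun k => ?_) (Finsupp.ext fun k => ?_)
          · exact map_add (D.coord (Sum.inl k)) m n
          · exact map_add (D.coord (Sum.inr k)) m n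
        map_smul' := fun a m => by
          refine Prod.ext (Finsupp.ext fun k => ?_) (Finsupp.ext fun k => ?_)
          · exact D.coord_smul (Sum.inl k) a.unop m
          · exact D.coord_smul (Sum.inr k) a.unop m }
    let p : ((I →₀ A) × (J →₀ A)) →ₗ[Aᵐᵒᵖ] M :=
      { toFun := fun v => ∑ k, MulOpposite.op (v.1 k) • D.vec (Sum.inl k) +
          ∑ k, MulOpposite.op (v.2 k) • D.vec (Sum.inr k)
        map_add' := fun v w => by
          simp only [Prod.fst_add, Prod.snd_add, Finsupp.add_apply, MulOpposite.op_add, add_smul,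
            Finset.sum_add_distrib]
          abel
        map_smul' := fun a v => by
          rw [RingHom.id_apply, smul_add, Finset.smul_sum, Finset.smul_sum]
          simp only [← mul_smul]
          rfl }
    refine ⟨I, J, ⟨{ i := ⟨i, ?_⟩, r := ⟨p, ?_⟩, retract := ?_ }⟩⟩
    · intro d m hm
      refine ⟨fun k => ?_, fun k => D.coord_mem (Sum.inr k) hm⟩
      have := D.coord_mem (Sum.inl k) hm
      change D.coord (Sum.inl k) m ∈ A.gr d
      rwa [Sum.elim_inl, add_zero] at this
    · intro d v hv
      refine add_mem (sum_mem fun k _ => ?_) (sum_mem fun k _ => ?_)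
      · have := M.isSuperModule.smul_mem (D.vec_mem (Sum.inl k)) (hv.1 k)
        rwa [Sum.elim_inl, zero_add] at this
      · have := M.isSuperModule.smul_mem (D.vec_mem (Sum.inr k)) (hv.2 k)
        rwa [Sum.elim_inr, add_comm, zmod_two_add_add_cancel] at this
    · refine SuperModule.Hom.ext (LinearMap.ext fun m => ?_)
      refine Eq.trans ?_ (D.sum_eq m)
      rw [Fintype.sum_sum_type]
      rfl

end SuperModule

namespace SuperPresheaf

variable {X : RingedSuperspace.{u}} {F G : SuperPresheaf X} {U V W : Opens X.space}

/-- The only point beyond linear algebra is that the inverse preserves parity; an injective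
parity-preserving map commutes with the projections onto components and hence reflects parity. -/
theorem isIso_of_bijective (f : F ⟶ G) (hf : ∀ U, Function.Bijective (f.hom.app U)) :
    IsIso f := by
  let e : ∀ U, F.presheaf.obj U ≃+ G.presheaf.obj U := fun U =>
    AddEquiv.ofBijective (f.hom.app U).hom (hf U)
  have he : ∀ U s, f.hom.app U ((e U).symm s) = s := fun U s => (e U).apply_symm_apply s
  have he' : ∀ U s, (e U).symm (f.hom.app U s) = s := fun U s => (e U).symm_apply_apply s
  refine ⟨⟨{ hom := { app := fun U => AddCommGrpCat.ofHom (e U).symm.toAddMonoidHom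
                      naturality := ?_ }, map_smul := ?_, map_mem := ?_ }, ?_, ?_⟩⟩
  · intro U V g
    ext s
    change (e V).symm (G.presheaf.map g s) = F.presheaf.map g ((e U).symm s)
    apply (hf V).1
    rw [he]
    refine Eq.trans ?_ (NatTrans.naturality_apply f.hom g _).symm
    exact congrArg (G.presheaf.map g) (he U s).symm
  · intro U a s
    change (e U).symm (MulOpposite.op a • s) = MulOpposite.op a • (e U).symm s
    apply (hf U).1
    rw [he, f.map_smul, he]
  · intro U i s hs
    refine mem_of_map_mem (F.isSuperModule U).isInternal (G.isSuperModule U).isInternal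
      (f.hom.app U).hom (fun _ _ => f.map_mem) (hf U).1 ?_
    have := he U s
    exact this.symm ▸ hs
  · refine Hom.ext (NatTrans.ext (funext fun U => ?_))
    ext s
    exact he' U s
  · refine Hom.ext (NatTrans.ext (funext fun U => ?_))
    ext s
    exact he U s

variable (F) in
/-- The canonical homomorphism to the sheafification. -/
def toSheafify : F ⟶ F.sheafify where
  hom :=
    { app := fun U => AddCommGrpCat.ofHom
        { toFun := fun s => ⟨fun x => F.presheaf.germ U.unop (x : X.space) x.2 s,
            fun x => ⟨U.unop, x.2, le_rfl, s, fun _ => rfl⟩⟩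
          map_zero' := Subtype.ext (funext fun _ => map_zero _)
          map_add' := fun _ _ => Subtype.ext (funext fun _ => map_add _ _ _) }
      naturality := fun U V f => by
        ext s
        exact Subtype.ext (funext fun x =>
          TopCat.Presheaf.germ_res_apply F.presheaf f.unop (x : X.space) x.2 s) }
  map_smul U a s := Subtype.ext (funext fun x => F.germ_smul U.unop x.2 a s)
  map_mem {U _ _} h := fun x => F.germ_mem_stalkGr U.unop x.2 h

theorem toSheafify_naturality (f : F ⟶ G) :
    f ≫ toSheafify G = toSheafify F ≫ sheafifyMap f := by
  refine Hom.ext (NatTrans.ext (funext fun U => ?_))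
  ext s
  exact Subtype.ext (funext fun x => (stalkMap_germ f U.unop (x : X.space) x.2 s).symm)

/-- A section is determined by its coordinates, which live in the sheaf O_X. So a presheaf with a
dual basis is separated, even without being assumed a sheaf. -/
theorem DualBasis.eq_of_germ_eq {K : Type*} [Fintype K] {ε : K → ZMod 2} (D : F.DualBasis U K ε)
    (h : V ≤ U) {s t : F.presheaf.obj (op V)}
    (hst : ∀ x (hx : x ∈ V), F.presheaf.germ V x hx s = F.presheaf.germ V x hx t) : s = t := by
  rw [← D.sum_eq h s, ← D.sum_eq h t]
  refine Finset.sum_congr rfl fun k _ => ?_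
  congr 2
  refine RingedSuperspace.eq_of_locally_eq fun x hx => ?_
  obtain ⟨W, hW, hxW, e⟩ := exists_res_eq_of_germ_eq hx (hst x hx)
  exact ⟨W, hW, hxW, by rw [← D.coord_res k h hW, ← D.coord_res k h hW, e]⟩

/-- A presheaf with a dual basis over the whole space is a sheaf. -/
theorem DualBasis.isIso_toSheafify {K : Type*} [Fintype K] {ε : K → ZMod 2}
    (D : F.DualBasis ⊤ K ε) : IsIso (toSheafify F) := by
  refine isIso_of_bijective _ fun U => ⟨fun s t hst => ?_, fun θ => ?_⟩
  · refine D.eq_of_germ_eq (V := U.unop) le_top fun x hx => ?_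
    exact congrFun (congrArg Subtype.val hst) ⟨x, hx⟩
  -- Local representatives of the family θ are unique by separatedness, so their k-th coordinates
  -- glue in O_X; recombining the glued coordinates with the basis sections gives the preimage of θ.
  · let R : K → ∀ V : Opens X.space, V ≤ U.unop → X.O.obj (op V) → Prop := fun k V h a =>
      ∃ s : F.presheaf.obj (op V), (∀ y : V, θ.1 ⟨y, h y.2⟩ = F.presheaf.germ V y y.2 s) ∧
        D.coord k le_top s = a
    have hR : ∀ k, ∃! a : X.O.obj (op U.unop), ∀ V h a', R k V h a' → X.res h a = a' := by
      intro k
      refine RingedSuperspace.exists_glue (R k) ?_ ?_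
      · intro x hx
        obtain ⟨V, hV, hVU, s, hs⟩ := θ.2 ⟨x, hx⟩
        exact ⟨V, hVU, _, hV, s, hs, rfl⟩
      · rintro V h a V' h' a' ⟨s, hs, rfl⟩ ⟨s', hs', rfl⟩
        have : F.res (inf_le_left : V ⊓ V' ≤ V) s = F.res inf_le_right s' := by
          refine D.eq_of_germ_eq (V := V ⊓ V') le_top fun x hx => ?_
          rw [germ_res, germ_res]
          exact (hs ⟨x, hx.1⟩).symm.trans (hs' ⟨x, hx.2⟩)
        rw [← D.coord_res k le_top, ← D.coord_res k le_top, this]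
    choose a ha _ using hR
    refine ⟨∑ k, MulOpposite.op (a k) • F.res (V := U.unop) le_top (D.vec k), ?_⟩
    refine Subtype.ext (funext fun x => ?_)
    obtain ⟨V, hV, hVU, s, hs⟩ := θ.2 x
    have h1 : F.res hVU (∑ k, MulOpposite.op (a k) • F.res (V := U.unop) le_top (D.vec k)) = s := by
      rw [map_sum]
      refine Eq.trans (Finset.sum_congr rfl fun k _ => ?_) (D.sum_eq le_top s)
      rw [res_smul, res_res, ha k V hVU _ ⟨s, hs, rfl⟩]
    refine Eq.trans ?_ (hs ⟨x, hV⟩).symm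
    rw [← h1, germ_res]
    rfl

end SuperPresheaf

end

/-! ### Tensor presheaves: dual bases and full faithfulness before sheafification. -/

section

variable {X : RingedSuperspace.{u}}

theorem resTop_top (a : X.O.obj (op ⊤)) : resTop X (op ⊤) a = a :=
  resHom_id X (op ⊤) a

section Tensor

variable {A B M N : Type u} [Ring A] [Ring B] [AddCommGroup M] [Module Aᵐᵒᵖ M]

/-- The additive map `M ⊗_A B → B`, `m ⊗ b ↦ f m b`, for a right linear map `f : M → A`. -/
def tensorFunctional (φ : A →+* B) (f : M →+ A)
    (hf : ∀ (a : A) (m : M), f (MulOpposite.op a • m) = f m * a) : Tensor M φ →+ B :=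
  tensorLift φ (TensorProduct.liftAddHom
    ((AddMonoidHom.mul.comp (φ.toAddMonoidHom.comp f)).flip) (fun r b m => by
      change φ (f m) * (r • b) = φ (f (r • m)) * b
      rw [map_zsmul, map_zsmul, mul_smul_comm, smul_mul_assoc]))
    (fun m a b => by
      change φ (f _) * b = φ (f m) * (φ a * b)
      rw [hf, map_mul, mul_assoc])

theorem tensorFunctional_tmk (φ : A →+* B) (f : M →+ A)
    (hf : ∀ (a : A) (m : M), f (MulOpposite.op a • m) = f m * a) (m : M) (b : B) :
    tensorFunctional φ f hf (tmk φ m b) = φ (f m) * b := rfl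

theorem tensorFunctional_smul (φ : A →+* B) (f : M →+ A)
    (hf : ∀ (a : A) (m : M), f (MulOpposite.op a • m) = f m * a) (b : B) (t : Tensor M φ) :
    tensorFunctional φ f hf (MulOpposite.op b • t) = tensorFunctional φ f hf t * b := by
  induction t using tensor_induction with
  | h0 => rw [smul_zero, map_zero, zero_mul]
  | hadd x y hx hy => rw [smul_add, map_add, hx, hy, map_add, add_mul]
  | h m c => rw [tmk_smul, tensorFunctional_tmk, tensorFunctional_tmk, mul_assoc]

theorem tensorFunctional_mem (φ : A →+* B) (f : M →+ A)
    (hf : ∀ (a : A) (m : M), f (MulOpposite.op a • m) = f m * a) {grA : ZMod 2 → AddSubgroup A}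
    {grM : ZMod 2 → AddSubgroup M} {grB : ZMod 2 → AddSubgroup B} (hB : IsSuperRing grB)
    (hφ : ∀ {i a}, a ∈ grA i → φ a ∈ grB i) {d : ZMod 2}
    (hfd : ∀ {i m}, m ∈ grM i → f m ∈ grA (i + d)) {i : ZMod 2} {t : Tensor M φ}
    (ht : t ∈ tensorGr φ grM grB i) : tensorFunctional φ f hf t ∈ grB (i + d) := by
  induction ht using AddSubgroup.closure_induction with
  | mem x hx =>
    obtain ⟨i, j, rfl, m, hm, b, hb, rfl⟩ := hx
    have := hB.mul_mem (hφ (hfd hm)) hb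
    rw [add_right_comm] at this
    exact this
  | zero => rw [map_zero]; exact zero_mem _
  | add x y _ _ hx hy => rw [map_add]; exact add_mem hx hy
  | neg x _ hx => rw [map_neg]; exact neg_mem hx

theorem tensorFunctional_tensorMap {B' : Type u} [Ring B'] (φ : A →+* B) (φ' : A →+* B')
    (g : B →+* B') (h : g.comp φ = φ') (f : M →+ A)
    (hf : ∀ (a : A) (m : M), f (MulOpposite.op a • m) = f m * a) (t : Tensor M φ) :
    tensorFunctional φ' f hf (tensorMap LinearMap.id g h t) = g (tensorFunctional φ f hf t) := by
  subst h
  induction t using tensor_induction with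
  | h0 => simp only [map_zero]
  | hadd x y hx hy => simp only [map_add, hx, hy]
  | h m c => rw [tensorMap_tmk, tensorFunctional_tmk, tensorFunctional_tmk, map_mul]; rfl

theorem sum_tmk_tensorFunctional {K : Type*} [Fintype K] (φ : A →+* B) (f : K → (M →+ A))
    (hf : ∀ k (a : A) (m : M), f k (MulOpposite.op a • m) = f k m * a) (v : K → M)
    (hv : ∀ m, ∑ k, MulOpposite.op (f k m) • v k = m) (t : Tensor M φ) :
    ∑ k, tmk φ (v k) (tensorFunctional φ (f k) (hf k) t) = t := by
  have h0 : ∀ m : M, tmk φ m (0 : B) = 0 := fun m => by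
    have := tmk_add φ m (0 : B) 0
    simpa using this
  have h0' : ∀ b : B, tmk φ (0 : M) b = 0 := fun b => by
    have := add_tmk φ (0 : M) 0 b
    simpa using this
  induction t using tensor_induction with
  | h0 => simp only [map_zero, h0, Finset.sum_const_zero]
  | hadd x y hx hy => simp only [map_add, tmk_add, Finset.sum_add_distrib, hx, hy]
  | h m b =>
    -- Applying m ↦ m ⊗ b to the expansion of m and moving the scalars across the tensor sign gives
    -- the claim.
    let ψ : M →+ Tensor M φ :=
      { toFun := fun m => tmk φ m b
        map_zero' := h0' b
        map_add' := fun m m' => add_tmk _ m m' b }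
    refine Eq.trans ?_ (congrArg ψ (hv m))
    rw [map_sum]
    exact Finset.sum_congr rfl fun k _ => (smul_tmk φ (v k) (f k m) b).symm

/-- The canonical map `M ⊗_A A → M`. -/
def tensorSelf (φ : A →+* A) (hφ : ∀ a, φ a = a) : Tensor M φ →+ M :=
  tensorLift φ (TensorProduct.liftAddHom
    (((smulAddHom Aᵐᵒᵖ M).comp (MulOpposite.opAddEquiv : A ≃+ Aᵐᵒᵖ).toAddMonoidHom))
      (fun r b m => by
      change MulOpposite.op (r • b) • m = MulOpposite.op b • (r • m)
      rw [MulOpposite.op_smul, smul_assoc, smul_comm]))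
    (fun m a b => by
      change MulOpposite.op b • MulOpposite.op a • m = MulOpposite.op (φ a * b) • m
      rw [hφ, MulOpposite.op_mul, mul_smul])

theorem tensorSelf_tmk (φ : A →+* A) (hφ : ∀ a, φ a = a) (m : M) (b : A) :
    tensorSelf φ hφ (tmk φ m b) = MulOpposite.op b • m := rfl

theorem tmk_tensorSelf (φ : A →+* A) (hφ : ∀ a, φ a = a) (t : Tensor M φ) :
    tmk φ (tensorSelf φ hφ t) 1 = t := by
  induction t using tensor_induction with
  | h0 =>
    rw [map_zero]
    have := add_tmk φ (0 : M) 0 1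
    simpa using this
  | hadd x y hx hy => rw [map_add, add_tmk, hx, hy]
  | h m b => rw [tensorSelf_tmk, smul_tmk, hφ, mul_one]

end Tensor

/-- The dual basis of the presheaf `U ↦ M ⊗_A O_X(U)` induced by a dual basis of `M`. -/
def SuperModule.DualBasis.tensor {M : SuperModule X.globalSections} {K : Type*} [Fintype K]
    {ε : K → ZMod 2} (D : M.DualBasis K ε) : (tensorPresheaf X M).DualBasis ⊤ K ε where
  vec k := tmk (resTop X (op ⊤)) (D.vec k) 1
  vec_mem k := tmk_mem_tensorGr _ (add_zero _) (D.vec_mem k) (X.isSuperRing _).one_mem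
  coord k V _ := tensorFunctional (resTop X (op V)) (D.coord k) (D.coord_smul k)
  coord_smul k V _ a s := tensorFunctional_smul (resTop X (op V)) (D.coord k) (D.coord_smul k) a s
  coord_mem k V _ i s hs := tensorFunctional_mem (resTop X (op V)) (D.coord k) (D.coord_smul k)
    (X.isSuperRing (op V)) (resHom_mem X _) (D.coord_mem k) hs
  coord_res k V W _ h s := tensorFunctional_tensorMap (resTop X (op V)) (resTop X (op W))
    (X.res h) (resHom_comp_resTop X (homOfLE h).op) (D.coord k) (D.coord_smul k) s
  sum_eq {V} h s := by
    refine Eq.trans (Finset.sum_congr rfl fun k _ => ?_)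
      (sum_tmk_tensorFunctional (resTop X (op V)) D.coord D.coord_smul D.vec D.sum_eq s)
    refine congrArg (tmk (resTop X (op V)) (D.vec k)) ?_
    change X.res h 1 * _ = _
    rw [map_one]
    exact one_mul _

/-- The Gram matrix is formed over the whole space, where the map from A to the sections is the
identity. Thus tensoring keeps the Gram matrix, which is what recovers F from its global sections.
-/
theorem SuperModule.DualBasis.tensor_gram {M : SuperModule X.globalSections} {K : Type*}
    [Fintype K] {ε : K → ZMod 2} (D : M.DualBasis K ε) (k l : K) :
    D.tensor.gram k l = D.coord k (D.vec l) := by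
  change resTop X (op ⊤) (D.coord k (D.vec l)) * 1 = _
  rw [mul_one]
  exact resTop_top _

/-- The supermodule of global sections inherits a dual basis. -/
def SuperPresheaf.DualBasis.globalSections {F : SuperPresheaf X} {K : Type*} [Fintype K]
    {ε : K → ZMod 2} (D : F.DualBasis ⊤ K ε) :
    SuperModule.DualBasis (A := X.globalSections) (F.sections (op ⊤)) K ε where
  vec := D.vec
  vec_mem := D.vec_mem
  coord k := D.coord k le_rfl
  coord_smul k := D.coord_smul k le_rfl
  coord_mem k _ _ := D.coord_mem k le_rfl
  sum_eq s := by
    refine Eq.trans (Finset.sum_congr rfl fun k _ => ?_) (D.sum_eq le_rfl s)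
    exact congrArg (fun t : F.presheaf.obj (op ⊤) => MulOpposite.op (D.coord k le_rfl s) • t)
      (SuperPresheaf.res_self le_rfl (D.vec k)).symm

/-- A presheaf with a dual basis over `X` comes from its supermodule of global sections. -/
theorem SuperPresheaf.DualBasis.exists_iso {F : SuperPresheaf X} {K : Type*} [Fintype K]
    {ε : K → ZMod 2} (D : F.DualBasis ⊤ K ε) :
    Nonempty (tensorPresheaf X (F.sections (op ⊤)) ≅ F) := by
  refine ⟨(SuperPresheaf.DualBasis.isoOn D.globalSections.tensor D ?_).toIso⟩
  ext k l
  exact D.globalSections.tensor_gram k l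

section FullyFaithful

variable {M N : SuperModule X.globalSections}

/-- Every tensor over U is built by scalars from restrictions of the global tensors m ⊗ 1. Hence a
homomorphism out of the tensor presheaf is determined by its values on these. -/
theorem tmk_eq_smul_res {U : Opens X.space} (m : M) (b : X.O.obj (op U)) :
    (tmk (resTop X (op U)) m b : Tensor M (resTop X (op U))) =
      ((MulOpposite.op b • (tensorPresheaf X M).res (V := U) le_top
        (tmk (resTop X (op ⊤)) m (1 : X.sections (op ⊤))) :
          (tensorPresheaf X M).presheaf.obj (op U))) := by
  change _ = tmk (resTop X (op U)) m (X.res le_top 1 * b)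
  rw [map_one]
  exact congrArg (tmk (resTop X (op U)) m) (one_mul b).symm

theorem tensorPresheaf_hom_ext {G : SuperPresheaf X} {f g : tensorPresheaf X M ⟶ G}
    (h : ∀ m : M, f.hom.app (op ⊤) (tmk (resTop X (op ⊤)) m (1 : X.sections (op ⊤))) =
      g.hom.app (op ⊤) (tmk (resTop X (op ⊤)) m (1 : X.sections (op ⊤)))) : f = g := by
  refine SuperPresheaf.Hom.ext (NatTrans.ext (funext fun U => ?_))
  refine AddCommGrpCat.hom_ext (tensorSections_hom_ext X fun m b => ?_)
  have key : ∀ f : tensorPresheaf X M ⟶ G, f.hom.app U (tmk (resTop X U) m b) =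
      MulOpposite.op (α := X.O.obj U) b • G.res (V := U.unop) le_top
        (f.hom.app (op ⊤) (tmk (resTop X (op ⊤)) m (1 : X.sections (op ⊤)))) := by
    intro f
    refine (congrArg (f.hom.app U) (tmk_eq_smul_res (U := U.unop) m b)).trans ?_
    refine (f.map_smul U b _).trans (congrArg _ ?_)
    exact NatTrans.naturality_apply f.hom (homOfLE le_top : U.unop ⟶ ⊤).op _
  refine (key f).trans ((congrArg _ ?_).trans (key g).symm)
  exact congrArg _ (h m)

theorem tensorFunctor_map_app_top (u : M ⟶ N) (m : M) :
    ((tensorFunctor X).map u).hom.app (op ⊤) (tmk (resTop X (op ⊤)) m (1 : X.sections (op ⊤))) =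
      tmk (resTop X (op ⊤)) (u.hom m) (1 : X.sections (op ⊤)) := rfl

theorem tmk_one_injective :
    Function.Injective fun m : M => tmk (resTop X (op ⊤)) m (1 : X.sections (op ⊤)) := by
  intro m m' h
  have := congrArg (tensorSelf (resTop X (op ⊤)) resTop_top) h
  exact ((one_smul (X.globalSections)ᵐᵒᵖ m).symm.trans this).trans (one_smul _ m')

theorem tensorFunctor_map_injective :
    Function.Injective ((tensorFunctor X).map : (M ⟶ N) → _) := by
  intro u v h
  refine SuperModule.Hom.ext (LinearMap.ext fun m => tmk_one_injective ?_)
  change tmk (resTop X (op ⊤)) (u.hom m) (1 : X.sections (op ⊤)) = tmk _ (v.hom m) _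
  rw [← tensorFunctor_map_app_top, ← tensorFunctor_map_app_top, h]

/-- Through the isomorphisms M ≅ M ⊗_A A and N ≅ N ⊗_A A, the global sections of `f` yield a map u :
M → N. Both `f` and the map induced by u agree on the tensors m ⊗ 1, so they coincide. -/
theorem tensorFunctor_map_surjective :
    Function.Surjective
      ((tensorFunctor X).map : (M ⟶ N) → (tensorPresheaf X M ⟶ tensorPresheaf X N)) := by
  intro f
  let η : ∀ M : SuperModule X.globalSections, M →ₗ[(X.globalSections)ᵐᵒᵖ]
      Tensor M (resTop X (op ⊤)) := fun M =>
    { toFun := fun m => tmk (resTop X (op ⊤)) m (1 : X.sections (op ⊤))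
      map_add' := fun m m' => add_tmk _ m m' _
      map_smul' := fun a m => by
        have h1 : resTop X (op ⊤) a.unop = a.unop := resTop_top a.unop
        refine (smul_tmk (resTop X (op ⊤)) m a.unop 1).trans ?_
        rw [h1, mul_one]
        exact congrArg (tmk _ m) (one_mul a.unop).symm }
  have hη : ∀ M, Function.Bijective (η M) := fun M =>
    ⟨tmk_one_injective, fun t => ⟨_, tmk_tensorSelf (resTop X (op ⊤)) resTop_top t⟩⟩
  let e := LinearEquiv.ofBijective (η N) (hη N)
  let g : Tensor M (resTop X (op ⊤)) →ₗ[(X.globalSections)ᵐᵒᵖ] Tensor N (resTop X (op ⊤)) :=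
    { toFun := f.hom.app (op ⊤)
      map_add' := map_add (f.hom.app (op ⊤)).hom
      map_smul' := fun a s => f.map_smul (op ⊤) a.unop s }
  have hmem : ∀ (M : SuperModule X.globalSections) {i : ZMod 2} {m : M}, m ∈ M.gr i →
      η M m ∈ (tensorPresheaf X M).gr (op ⊤) i := fun M i m hm =>
    tmk_mem_tensorGr _ (add_zero _) hm (X.isSuperRing _).one_mem
  let u : M ⟶ N := ⟨e.symm.toLinearMap.comp (g.comp (η M)), fun {i m} hm => by
    -- The map n ↦ n ⊗ 1 is injective and parity-preserving, so parity can be checked after applying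
    -- it.
    refine mem_of_map_mem N.isSuperModule.isInternal
      ((tensorPresheaf X N).isSuperModule (op ⊤)).isInternal (η N).toAddMonoidHom
      (fun i x hx => hmem N hx) (hη N).1 ?_
    have h1 : η N (e.symm (g (η M m))) = g (η M m) := e.apply_symm_apply _
    refine Set.mem_of_eq_of_mem h1 ?_
    exact f.map_mem (hmem M hm)⟩
  refine ⟨u, tensorPresheaf_hom_ext fun m => ?_⟩
  exact e.apply_symm_apply (g (η M m))

end FullyFaithful

section FunctorS

/-- When both tensor presheaves are already sheaves, S on morphisms is the fully faithful tensor
functor conjugated by the canonical isomorphisms to the sheafifications. -/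
theorem functorS_map_bijective {M N : SuperModule X.globalSections}
    [IsIso (SuperPresheaf.toSheafify (tensorPresheaf X M))]
    [IsIso (SuperPresheaf.toSheafify (tensorPresheaf X N))] :
    Function.Bijective ((functorS X).map : (M ⟶ N) → _) := by
  let τ := fun M : SuperModule X.globalSections => SuperPresheaf.toSheafify (tensorPresheaf X M)
  have hM : IsIso (τ M) := ‹_›
  have hN : IsIso (τ N) := ‹_›
  obtain ⟨ρ, hρ, hρ'⟩ := hN.out
  have hτ : ∀ u : M ⟶ N, (tensorFunctor X).map u ≫ τ N = τ M ≫ ((functorS X).map u).hom :=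
    fun u => SuperPresheaf.toSheafify_naturality _
  constructor
  · intro u v h
    apply tensorFunctor_map_injective
    have : (tensorFunctor X).map u ≫ τ N = (tensorFunctor X).map v ≫ τ N := by
      rw [hτ, hτ, h]
    exact (cancel_mono (τ N)).1 this
  · intro g
    obtain ⟨u, hu⟩ := tensorFunctor_map_surjective (τ M ≫ g.hom ≫ ρ)
    refine ⟨u, ObjectProperty.hom_ext _ ?_⟩
    apply (cancel_epi (τ M)).1
    rw [← hτ, hu]
    refine (Category.assoc _ _ _).trans (congrArg (τ M ≫ ·) ?_)
    refine (Category.assoc _ _ _).trans ?_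
    exact (congrArg (g.hom ≫ ·) hρ').trans (Category.comp_id _)

end FunctorS

end

/-! ### Global lifting from the vanishing of the first cohomology group. -/

section

section Cohomology

variable {X : TopCat.{u}} {H E : TopCat.Sheaf AddCommGrpCat.{u} X}

/-- Taking sections over U is left exact: it is the forgetful functor to presheaves followed by
evaluation, both of which preserve finite limits. -/
theorem exact_sections_of_exact (S : ShortComplex (TopCat.Sheaf AddCommGrpCat.{u} X))
    (hS : S.ShortExact) (U : Opens X) (s : S.X₂.1.obj (op U)) (hs : S.g.hom.app (op U) s = 0) :
    ∃ t : S.X₁.1.obj (op U), S.f.hom.app (op U) t = s := by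
  let G : TopCat.Sheaf AddCommGrpCat.{u} X ⥤ AddCommGrpCat.{u} :=
    TopCat.Sheaf.forget _ _ ⋙ (evaluation _ _).obj (op U)
  have : Limits.PreservesFiniteLimits (TopCat.Sheaf.forget AddCommGrpCat.{u} X) :=
    inferInstanceAs (Limits.PreservesFiniteLimits (sheafToPresheaf _ _))
  have : Limits.PreservesFiniteLimits
      ((evaluation (Opens X)ᵒᵖ AddCommGrpCat.{u}).obj (op U)) := ⟨fun J _ _ => inferInstance⟩
  have : Limits.PreservesFiniteLimits G := Limits.comp_preservesFiniteLimits _ _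
  have : G.PreservesZeroMorphisms := inferInstance
  have h := hS.exact.map_of_mono_of_preservesKernel G hS.mono_f inferInstance
  rw [ShortComplex.ab_exact_iff] at h
  exact h s hs

/-- If `H¹(X, H) = 0`, then local sections of a sheaf `E` that differ by sections of the subsheaf
`H` come from a global section of `E`, up to sections of `H`. -/
theorem exists_global_section_of_subsingleton_H (ι : H ⟶ E) [Mono ι]
    (h : Subsingleton (Sheaf.H H 1)) (U : X → Opens X) (hU : ∀ x, x ∈ U x)
    (e : ∀ x, E.1.obj (op (U x)))
    (he : ∀ x y, ∃ t : H.1.obj (op (U x ⊓ U y)), ι.hom.app _ t =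
      E.1.map (Opens.infLELeft (U x) (U y)).op (e x) -
        E.1.map (Opens.infLERight (U x) (U y)).op (e y)) :
    ∃ s : E.1.obj (op ⊤), ∀ x, ∃ t : H.1.obj (op (U x)),
      ι.hom.app _ t = E.1.map (homOfLE le_top : U x ⟶ ⊤).op s - e x := by
  let π := Limits.cokernel.π ι
  let S : ShortComplex (TopCat.Sheaf AddCommGrpCat.{u} X) :=
    ShortComplex.mk ι π (Limits.cokernel.condition ι)
  have hS : S.ShortExact :=
    { exact := ShortComplex.exact_cokernel ι
      mono_f := inferInstanceAs (Mono ι)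
      epi_g := inferInstanceAs (Epi (Limits.cokernel.π ι)) }
  have hzero : ∀ V t, π.hom.app V (ι.hom.app V t) = 0 := fun V t =>
    congrArg (fun f : H ⟶ Limits.cokernel ι => f.hom.app V t) (Limits.cokernel.condition ι)
  have hnat : ∀ {V W : (Opens X)ᵒᵖ} (f : V ⟶ W) t, π.hom.app W (E.1.map f t) =
      (Limits.cokernel ι).1.map f (π.hom.app V t) := fun f t =>
    NatTrans.naturality_apply π.hom f t
  -- On overlaps the local sections differ by sections of H, so their classes in E/H glue to a
  -- global class q.
  obtain ⟨q, hq, -⟩ := TopCat.Sheaf.existsUnique_gluing' (Limits.cokernel ι) U ⊤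
    (fun x => homOfLE le_top) (fun x _ => Opens.mem_iSup.2 ⟨x, hU x⟩)
    (fun x => π.hom.app (op (U x)) (e x)) (by
      intro x y
      obtain ⟨t, ht⟩ := he x y
      rw [← sub_eq_zero, ← hnat, ← hnat, ← map_sub, ← ht]
      exact hzero _ t)
  have hT : Limits.IsTerminal (⊤ : Opens X) := Limits.isTerminalTop
  -- The obstruction to lifting q to a global section of E is its image under the connecting map, in
  -- H¹(X, H) = 0.
  obtain ⟨z, hz⟩ := Abelian.Ext.covariant_sequence_exact₃ _ hS
    ((Sheaf.H.equiv₀ (Limits.cokernel ι) hT).symm q) (n₁ := 1) rfl (h.elim _ _)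
  refine ⟨Sheaf.H.equiv₀ E hT z, fun x => ?_⟩
  have hs : π.hom.app (op ⊤) (Sheaf.H.equiv₀ E hT z) = q := by
    refine (Sheaf.H.equiv₀_naturality hT π z).trans ?_
    refine (congrArg (Sheaf.H.equiv₀ (Limits.cokernel ι) hT) hz).trans ?_
    exact AddEquiv.apply_symm_apply _ q
  refine exact_sections_of_exact S hS (U x) _ ?_
  change π.hom.app (op (U x)) _ = 0
  rw [map_sub, hnat, hs, hq, sub_self]

end Cohomology

end

/-! ### The supersheaf of homomorphisms from F to the relations between generators. -/

section

theorem homPart_add_homPart_shift {M : Type*} [AddCommGroup M] {gr : ZMod 2 → AddSubgroup M}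
    (h : DirectSum.IsInternal gr) (i : ZMod 2) (x : M) :
    homPart h (0 + i) x + homPart h (1 + i) x = x := by
  rcases zmod_two_cases i with rfl | rfl
  · rw [add_zero, add_zero, homPart_zero_add_one]
  · rw [zero_add, zmod_two_add_self, add_comm, homPart_zero_add_one]

variable {X : RingedSuperspace.{u}}

theorem RingedSuperspace.res_homPart {U V : Opens X.space} (h : V ≤ U) (i : ZMod 2)
    (a : X.O.obj (op U)) : X.res h (homPart (X.isSuperRing (op U)).isInternal i a) =
      homPart (X.isSuperRing (op V)).isInternal i (X.res h a) :=
  map_homPart _ _ (X.res h).toAddMonoidHom (fun _ _ => res_mem h) i a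

theorem RingedSuperspace.res_twist {U V : Opens X.space} (h : V ≤ U) (i : ZMod 2)
    (a : X.O.obj (op U)) : X.res h (twist (X.isSuperRing (op U)) i a) =
      twist (X.isSuperRing (op V)) i (X.res h a) :=
  map_twist _ _ (X.res h) (fun _ _ => res_mem h) i a

/-- Homogeneity means being equal to one's own component, and components commute with restriction,
so this is an equality of sections and hence local. -/
theorem RingedSuperspace.mem_gr_of_locally {U : Opens X.space} {i : ZMod 2} {a : X.O.obj (op U)}
    (h : ∀ x ∈ U, ∃ (V : Opens X.space) (h : V ≤ U), x ∈ V ∧ X.res h a ∈ X.gr (op V) i) :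
    a ∈ X.gr (op U) i := by
  have : homPart (X.isSuperRing (op U)).isInternal i a = a := by
    refine eq_of_locally_eq fun x hx => ?_
    obtain ⟨V, hV, hxV, hmem⟩ := h x hx
    exact ⟨V, hV, hxV, by rw [res_homPart, homPart_of_mem _ hmem]⟩
  rw [← this]
  exact homPart_mem _ _ _

/-- A presheaf of abelian groups that embeds into the matrices over the structure sheaf as a
subpresheaf defined by a local condition is a sheaf. -/
theorem isSheaf_of_local_matrices {K : Type u} (P : TopCat.Presheaf AddCommGrpCat.{u} X.space)
    (j : ∀ U : Opens X.space, P.obj (op U) → K → K → X.O.obj (op U))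
    (hinj : ∀ U, Function.Injective (j U))
    (hnat : ∀ {U V : Opens X.space} (f : V ⟶ U) s k l,
      j V (P.map f.op s) k l = X.res f.le (j U s k l))
    (hloc : ∀ (U : Opens X.space) (m : K → K → X.O.obj (op U)),
      (∀ x ∈ U, ∃ (V : Opens X.space) (h : V ≤ U), x ∈ V ∧ ∃ s, ∀ k l,
        j V s k l = X.res h (m k l)) → ∃ s, j U s = m) : P.IsSheaf := by
  rw [TopCat.Presheaf.isSheaf_iff_isSheafUniqueGluing]
  intro ι U sf hsf
  have h1 : ∀ k l, ∃! a : X.O.obj (op (iSup U)), ∀ i, X.res (le_iSup U i) a = j (U i) (sf i) k l := by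
    intro k l
    refine X.ringSheaf.existsUnique_gluing' U (iSup U) (fun i => homOfLE (le_iSup U i)) le_rfl
      (fun i => j (U i) (sf i) k l) fun i i' => ?_
    refine (hnat (Opens.infLELeft (U i) (U i')) (sf i) k l).symm.trans ?_
    refine Eq.trans ?_ (hnat (Opens.infLERight (U i) (U i')) (sf i') k l)
    exact congrArg (fun t => j _ t k l) (hsf i i')
  choose a ha huniq using h1
  obtain ⟨s, hs⟩ := hloc (iSup U) a fun x hx => by
    obtain ⟨i, hi⟩ := Opens.mem_iSup.1 hx
    exact ⟨U i, le_iSup U i, hi, sf i, fun k l => (ha k l i).symm⟩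
  refine ⟨s, fun i => hinj _ (funext fun k => funext fun l => ?_), fun t ht => hinj _ ?_⟩
  · refine (hnat (Opens.leSupr U i) s k l).trans ?_
    rw [hs]
    exact ha k l i
  · rw [hs]
    refine funext fun k => funext fun l => huniq k l _ fun i => ?_
    refine (hnat (Opens.leSupr U i) t k l).symm.trans ?_
    exact congrArg (fun t => j _ t k l) (ht i)

namespace SuperPresheaf

/-- The presheaf of matrices over the structure sheaf. -/
def matrixPresheaf (X : RingedSuperspace.{u}) (K : Type u) : TopCat.Presheaf AddCommGrpCat.{u} X.space where
  obj U := AddCommGrpCat.of (K → K → X.O.obj (op U.unop))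
  map f := AddCommGrpCat.ofHom
    { toFun := fun h i j => X.res f.unop.le (h i j)
      map_zero' := funext fun i => funext fun j => map_zero _
      map_add' := fun _ _ => funext fun i => funext fun j => map_add _ _ _ }
  map_id U := by
    refine AddCommGrpCat.hom_ext (AddMonoidHom.ext fun h => ?_)
    exact funext fun i => funext fun j => RingedSuperspace.res_self le_rfl (h i j)
  map_comp f g := by
    refine AddCommGrpCat.hom_ext (AddMonoidHom.ext fun h => ?_)
    exact funext fun i => funext fun j =>
      (RingedSuperspace.res_res f.unop.le g.unop.le (h i j)).symm

theorem matrixPresheaf_isSheaf (K : Type u) : (matrixPresheaf X K).IsSheaf :=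
  isSheaf_of_local_matrices _ (fun _ h => h) (fun _ => Function.injective_id)
    (fun _ _ _ _ => rfl) (fun _ m _ => ⟨m, rfl⟩)

variable {F : SuperPresheaf X} {U V W : Opens X.space}

theorem eq_of_locally_eq (hF : F.presheaf.IsSheaf) {s t : F.presheaf.obj (op U)}
    (h : ∀ x ∈ U, ∃ (V : Opens X.space) (h : V ≤ U), x ∈ V ∧ F.res h s = F.res h t) : s = t := by
  refine TopCat.Sheaf.eq_of_locally_eq' (ι := U) (⟨F.presheaf, hF⟩ : TopCat.Sheaf _ X.space)
    (fun x => (h x x.2).choose) U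
    (fun x => homOfLE (h x x.2).choose_spec.choose) ?_ s t ?_
  · intro x hx
    exact Opens.mem_iSup.2 ⟨⟨x, hx⟩, (h x hx).choose_spec.choose_spec.1⟩
  · exact fun x => (h x x.2).choose_spec.choose_spec.2

variable {K : Type u} [Fintype K] {ε : K → ZMod 2} (p : K → F.presheaf.obj (op ⊤))

/-- The linear combination `∑ p k · v k` over an open set `V` of global sections `p k`. -/
def comb (V : Opens X.space) : (K → X.O.obj (op V)) →+ F.presheaf.obj (op V) where
  toFun v := ∑ k, MulOpposite.op (v k) • F.res le_top (p k)
  map_zero' := by simp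
  map_add' v w := by simp [add_smul, Finset.sum_add_distrib]

theorem comb_apply (v : K → X.O.obj (op V)) :
    comb p V v = ∑ k, MulOpposite.op (v k) • F.res le_top (p k) := rfl

theorem res_comb (h : W ≤ V) (v : K → X.O.obj (op V)) :
    F.res h (comb p V v) = comb p W (fun k => X.res h (v k)) := by
  simp only [comb_apply, map_sum, res_smul, res_res]

theorem comb_mul (v : K → X.O.obj (op V)) (a : X.O.obj (op V)) :
    comb p V (fun k => v k * a) = MulOpposite.op a • comb p V v := by
  simp only [comb_apply, Finset.smul_sum, ← mul_smul, MulOpposite.op_mul]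

/-- Since each `p k` is homogeneous, the epimorphism O^K → F preserves degrees once the k-th
coordinate is shifted by `ε k`. In particular the homogeneous components of a relation are
relations. -/
theorem comb_homPart (hp : ∀ k, p k ∈ F.gr (op ⊤) (ε k)) (v : K → X.O.obj (op V)) (d : ZMod 2) :
    comb p V (fun k => homPart (X.isSuperRing (op V)).isInternal (d + ε k) (v k)) =
      homPart (F.isSuperModule (op V)).isInternal d (comb p V v) := by
  rw [comb_apply, comb_apply, map_sum]
  exact Finset.sum_congr rfl fun k _ =>
    (homPart_smul (X.isSuperRing (op V)) (F.isSuperModule (op V)) (res_mem le_top (hp k)) _).symm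

/-- The endomorphism of `O_V^K` defined by the matrix `h` vanishes on the relations between the
sections `p k`. -/
def KillsRelations (U : Opens X.space) (h : K → K → X.O.obj (op U)) : Prop :=
  ∀ (V : Opens X.space) (hV : V ≤ U) (v : K → X.O.obj (op V)), comb p V v = 0 →
    ∀ i, ∑ j, X.res hV (h i j) * v j = 0

variable {p} in
theorem killsRelations_of_homogeneous (hp : ∀ k, p k ∈ F.gr (op ⊤) (ε k))
    {h : K → K → X.O.obj (op U)}
    (hh : ∀ (V : Opens X.space) (hV : V ≤ U) (c : ZMod 2) (v : K → X.O.obj (op V)),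
      (∀ k, v k ∈ X.gr (op V) (c + ε k)) → comb p V v = 0 →
        ∀ i, ∑ j, X.res hV (h i j) * v j = 0) : KillsRelations p U h := by
  intro V hV v hv i
  have key := fun c => hh V hV c
    (fun k => homPart (X.isSuperRing (op V)).isInternal (c + ε k) (v k))
    (fun k => homPart_mem _ _ _) (by rw [comb_homPart p hp, hv, map_zero]) i
  have := congrArg₂ (· + ·) (key 0) (key 1)
  simp only [← Finset.sum_add_distrib, ← mul_add, homPart_add_homPart_shift, add_zero] at this
  exact this

variable {p} in
theorem KillsRelations.homPart (hp : ∀ k, p k ∈ F.gr (op ⊤) (ε k))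
    {h : K → K → X.O.obj (op U)} (hh : KillsRelations p U h) (d : ZMod 2) :
    KillsRelations p U
      (fun i j => homPart (X.isSuperRing (op U)).isInternal (d + ε i + ε j) (h i j)) := by
  refine killsRelations_of_homogeneous hp fun V hV c v hv hv0 i => ?_
  have := congrArg (Super.homPart (X.isSuperRing (op V)).isInternal (d + ε i + c))
    (hh V hV v hv0 i)
  rw [map_sum, map_zero] at this
  rw [← this]
  refine Finset.sum_congr rfl fun j _ => ?_
  rw [homPart_mul_of_mem (X.isSuperRing (op V)) _ (hv j), RingedSuperspace.res_homPart,
    ← add_assoc (d + ε i + c), zmod_two_add_add_cancel]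

variable {p} in
-- Plain right multiplication of the entries by `a` would not preserve the condition. For a relation
-- of degree c, moving the twisted scalar past v_j, of degree c + ε_j, leaves a twist by c alone;
-- this does not depend on j and factors out of the sum.
theorem KillsRelations.mul_twist (hp : ∀ k, p k ∈ F.gr (op ⊤) (ε k))
    {h : K → K → X.O.obj (op U)} (hh : KillsRelations p U h) (a : X.O.obj (op U)) :
    KillsRelations p U (fun i j => h i j * twist (X.isSuperRing (op U)) (ε j) a) := by
  refine killsRelations_of_homogeneous hp fun V hV c v hv hv0 i => ?_
  have := hh V hV v hv0 i
  rw [← zero_mul (twist (X.isSuperRing (op V)) c (X.res hV a)), ← this, Finset.sum_mul]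
  refine Finset.sum_congr rfl fun j _ => ?_
  rw [map_mul, mul_assoc, mul_assoc, RingedSuperspace.res_twist,
    mul_eq_mul_twist (X.isSuperRing (op V)) _ (hv j), twist_twist, zmod_two_add_add_cancel]

variable {p} in
theorem KillsRelations.res {h : K → K → X.O.obj (op U)} (hh : KillsRelations p U h) (hV : V ≤ U) :
    KillsRelations p V (fun i j => X.res hV (h i j)) := by
  intro W hW v hv i
  simp only [RingedSuperspace.res_res]
  exact hh W (hW.trans hV) v hv i

variable {p} in
theorem KillsRelations.sub {h h' : K → K → X.O.obj (op U)} (hh : KillsRelations p U h)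
    (hh' : KillsRelations p U h') : KillsRelations p U (fun i j => h i j - h' i j) := by
  intro W hW v hv i
  simp only [map_sub, sub_mul, Finset.sum_sub_distrib, hh W hW v hv i, hh' W hW v hv i, sub_zero]

variable {p} in
theorem KillsRelations.add {h h' : K → K → X.O.obj (op U)} (hh : KillsRelations p U h)
    (hh' : KillsRelations p U h') : KillsRelations p U (fun i j => h i j + h' i j) := by
  intro W hW v hv i
  simp only [map_add, add_mul, Finset.sum_add_distrib, hh W hW v hv i, hh' W hW v hv i, add_zero]

theorem killsRelations_zero : KillsRelations p U (fun _ _ => 0) := by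
  intro W hW v hv i
  simp

variable {p} in
theorem killsRelations_of_locally {h : K → K → X.O.obj (op U)}
    (hh : ∀ x ∈ U, ∃ (V : Opens X.space) (hV : V ≤ U), x ∈ V ∧
      KillsRelations p V (fun i j => X.res hV (h i j))) : KillsRelations p U h := by
  intro W hW v hv i
  refine RingedSuperspace.eq_of_locally_eq fun x hx => ?_
  obtain ⟨V, hV, hxV, hkill⟩ := hh x (hW hx)
  refine ⟨W ⊓ V, inf_le_left, ⟨hx, hxV⟩, ?_⟩
  have := hkill (W ⊓ V) inf_le_right (fun k => X.res inf_le_left (v k))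
    (by rw [← res_comb, hv, map_zero]) i
  rw [map_sum, map_zero, ← this]
  simp only [map_mul, RingedSuperspace.res_res]

variable (U) in
/-- The matrices whose columns are relations between the sections `p k` and that vanish on the
relations: the homomorphisms from the supersheaf generated by the `p k` to the supersheaf of
relations. -/
def relationHom : AddSubgroup (K → K → X.O.obj (op U)) where
  carrier := {h | (∀ j, comb p U (fun k => h k j) = 0) ∧ KillsRelations p U h}
  zero_mem' := ⟨fun _ => map_zero (comb p U), killsRelations_zero p⟩
  add_mem' := fun {h h'} hh hh' => ⟨fun j => by
    refine (map_add (comb p U) (fun k => h k j) (fun k => h' k j)).trans ?_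
    rw [hh.1, hh'.1, add_zero], hh.2.add hh'.2⟩
  neg_mem' := fun {h} hh => ⟨fun j => by
    refine (map_neg (comb p U) (fun k => h k j)).trans ?_
    rw [hh.1, neg_zero], fun V hV v hv i => by
      have := hh.2 V hV v hv i
      simp only [Pi.neg_apply, map_neg, neg_mul, Finset.sum_neg_distrib, this, neg_zero]⟩

/-- The right action on `relationHom`, twisted by the parities of the columns. -/
@[reducible]
def relationHomModule (hp : ∀ k, p k ∈ F.gr (op ⊤) (ε k)) (U : Opens X.space) :
    Module (X.O.obj (op U))ᵐᵒᵖ (relationHom U p) where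
  smul a h := ⟨fun i j => h.1 i j * twist (X.isSuperRing (op U)) (ε j) a.unop,
    fun j => by rw [comb_mul p (fun k => h.1 k j), h.2.1, smul_zero], h.2.2.mul_twist hp a.unop⟩
  one_smul h := Subtype.ext (funext fun i => funext fun j => by
    change h.1 i j * twist _ _ 1 = _
    rw [map_one, mul_one])
  mul_smul a b h := Subtype.ext (funext fun i => funext fun j => by
    change h.1 i j * twist _ _ (b.unop * a.unop) = h.1 i j * twist _ _ b.unop * twist _ _ a.unop
    rw [map_mul, mul_assoc])
  smul_zero a := Subtype.ext (funext fun i => funext fun j => zero_mul _)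
  smul_add a h h' := Subtype.ext (funext fun i => funext fun j => add_mul _ _ _)
  add_smul a b h := Subtype.ext (funext fun i => funext fun j => by
    change h.1 i j * twist _ _ (a.unop + b.unop) = h.1 i j * twist _ _ a.unop +
      h.1 i j * twist _ _ b.unop
    rw [map_add, mul_add])
  zero_smul h := Subtype.ext (funext fun i => funext fun j => by
    change h.1 i j * twist _ _ 0 = 0
    rw [map_zero, mul_zero])

/-- The homogeneous components of `relationHom`. -/
def relationHomGr (ε : K → ZMod 2) (U : Opens X.space) (d : ZMod 2) :
    AddSubgroup (relationHom U p) :=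
    { carrier := {h : relationHom U p |
        ∀ i j, h.1 i j ∈ X.gr (op U) (d + ε i + ε j)}
      zero_mem' := fun _ _ => zero_mem _
      add_mem' := fun h h' i j => add_mem (h i j) (h' i j)
      neg_mem' := fun h i j => neg_mem (h i j) }

theorem isSuperModule_relationHom (hp : ∀ k, p k ∈ F.gr (op ⊤) (ε k)) (U : Opens X.space) :
    letI := relationHomModule p hp U
    IsSuperModule (X.gr (op U)) (relationHomGr p ε U) :=
  letI := relationHomModule p hp U;
    { isInternal := by
        have hU := (X.isSuperRing (op U)).isInternal
        refine isInternal_of_forall ?_ ?_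
        · intro h
          let part : ZMod 2 → relationHom U p := fun d =>
            ⟨fun i j => homPart hU (d + ε i + ε j) (h.1 i j), fun j => by
              have h1 := comb_homPart p hp (fun k => h.1 k j) (d + ε j)
              rw [h.2.1, map_zero] at h1
              rw [← h1]
              simp only [add_right_comm], h.2.2.homPart hp d⟩
          refine ⟨part 0, fun i j => homPart_mem _ _ _, part 1, fun i j => homPart_mem _ _ _, ?_⟩
          refine Subtype.ext (funext fun i => funext fun j => ?_)
          change homPart hU (0 + ε i + ε j) (h.1 i j) + homPart hU (1 + ε i + ε j) (h.1 i j) = _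
          rw [add_assoc, add_assoc, homPart_add_homPart_shift]
        · intro h h0 h1
          refine Subtype.ext (funext fun i => funext fun j => ?_)
          have e0 := h0 i j
          have e1 := h1 i j
          rw [add_assoc] at e0 e1
          -- Each entry lies in two components of opposite parity; which one is the even one depends
          -- on the parity of its position.
          rcases zmod_two_cases (ε i + ε j) with e | e <;> rw [e] at e0 e1
          · exact eq_zero_of_mem hU e0 e1
          · exact eq_zero_of_mem hU e1 e0
      smul_mem := by
        intro d e h a hh ha i j
        have := (X.isSuperRing (op U)).mul_mem (hh i j)
          (twist_mem (X.isSuperRing (op U)) (ε := ε j) ha)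
        rw [show d + ε i + ε j + e = d + e + ε i + ε j by abel] at this
        exact this }

/-- The presheaf of supermodules `relationHom`. -/
def relationHomPresheaf (hp : ∀ k, p k ∈ F.gr (op ⊤) (ε k)) : SuperPresheaf X where
  presheaf :=
    { obj := fun U => AddCommGrpCat.of (relationHom U.unop p)
      map := fun {U V} f => AddCommGrpCat.ofHom
        { toFun := fun h => ⟨fun i j => X.res f.unop.le (h.1 i j), fun j => by
            rw [← res_comb p f.unop.le (fun k => h.1 k j), h.2.1, map_zero], h.2.2.res f.unop.le⟩
          map_zero' := Subtype.ext (funext fun i => funext fun j => map_zero _)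
          map_add' := fun _ _ => Subtype.ext (funext fun i => funext fun j => map_add _ _ _) }
      map_id := fun U => by
        refine AddCommGrpCat.hom_ext (AddMonoidHom.ext fun h => ?_)
        exact Subtype.ext (funext fun i => funext fun j =>
          RingedSuperspace.res_self le_rfl (h.1 i j))
      map_comp := fun f g => by
        refine AddCommGrpCat.hom_ext (AddMonoidHom.ext fun h => ?_)
        exact Subtype.ext (funext fun i => funext fun j =>
          (RingedSuperspace.res_res f.unop.le g.unop.le (h.1 i j)).symm) }
  module U := relationHomModule p hp U.unop
  map_smul {U V} f a h := Subtype.ext (funext fun i => funext fun j => by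
    change X.res f.unop.le (h.1 i j * twist _ _ a) =
      X.res f.unop.le (h.1 i j) * twist _ _ (X.res f.unop.le a)
    rw [map_mul, RingedSuperspace.res_twist])
  gr U := relationHomGr p ε U.unop
  isSuperModule U := isSuperModule_relationHom p hp U.unop
  map_mem f _ _ hh i j := RingedSuperspace.res_mem f.unop.le (hh i j)

theorem relationHomPresheaf_isSheaf (hF : F.presheaf.IsSheaf)
    (hp : ∀ k, p k ∈ F.gr (op ⊤) (ε k)) : (relationHomPresheaf p hp).presheaf.IsSheaf := by
  refine isSheaf_of_local_matrices _ (fun U (h : relationHom U p) => h.1)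
    (fun U => Subtype.val_injective) (fun f s k l => rfl) ?_
  intro U m hm
  refine ⟨(⟨m, fun j => ?_, killsRelations_of_locally fun x hx => ?_⟩ : relationHom U p), rfl⟩
  · refine eq_of_locally_eq hF fun x hx => ?_
    obtain ⟨V, hV, hxV, s, hs⟩ := hm x hx
    refine ⟨V, hV, hxV, ?_⟩
    rw [res_comb, map_zero]
    simp only [← hs]
    exact s.2.1 j
  · obtain ⟨V, hV, hxV, s, hs⟩ := hm x hx
    refine ⟨V, hV, hxV, ?_⟩
    simp only [← hs]
    exact s.2.2

end SuperPresheaf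

end

/-! ### Gram matrices and local dual bases of the homomorphism sheaf. -/

section

namespace SuperPresheaf

variable {X : RingedSuperspace.{u}} {F : SuperPresheaf X} {U V W : Opens X.space}
  {K : Type u} [Fintype K] {ε : K → ZMod 2} {p : K → F.presheaf.obj (op ⊤)}

variable (p ε) in
/-- The matrix `g` of even degree defines an idempotent endomorphism of `O_U^K` whose kernel
consists of the relations between the sections `p k`. -/
structure IsGram (U : Opens X.space) (g : K → K → X.O.obj (op U)) : Prop where
  mem : ∀ i j, g i j ∈ X.gr (op U) (ε i + ε j)
  comb_eq : ∀ j, comb p U (fun k => g k j) = F.res le_top (p j)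
  kills : KillsRelations p U g

theorem IsGram.res {g : K → K → X.O.obj (op U)} (hg : IsGram ε p U g) (h : V ≤ U) :
    IsGram ε p V (fun i j => X.res h (g i j)) where
  mem i j := RingedSuperspace.res_mem h (hg.mem i j)
  comb_eq j := by rw [← res_comb p h (fun k => g k j), hg.comb_eq, res_res]
  kills := hg.kills.res h

theorem comb_single [DecidableEq K] (j : K) :
    comb p V (fun k => if k = j then 1 else 0) = F.res le_top (p j) := by
  rw [comb_apply, Finset.sum_eq_single j]
  · rw [if_pos rfl, MulOpposite.op_one, one_smul]
  · intro k _ hk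
    rw [if_neg hk, MulOpposite.op_zero, zero_smul]
  · intro h
    exact absurd (Finset.mem_univ j) h

theorem IsGram.comb_one_sub [DecidableEq K] {g : K → K → X.O.obj (op U)} (hg : IsGram ε p U g)
    (j : K) : comb p U (fun k => (if k = j then 1 else 0) - g k j) = 0 := by
  refine (map_sub (comb p U) (fun k => if k = j then 1 else 0) (fun k => g k j)).trans ?_
  rw [comb_single, hg.comb_eq, sub_self]

/-- The columns of 1 - g are relations, so h(1 - g) = 0. For h = g this says that g is idempotent.
-/
theorem IsGram.mul_eq_self {g : K → K → X.O.obj (op U)} (hg : IsGram ε p U g)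
    {h : K → K → X.O.obj (op U)} (hh : KillsRelations p U h) (i l : K) :
    ∑ j, h i j * g j l = h i l := by
  classical
  have := hh U le_rfl _ (hg.comb_one_sub l) i
  simp only [RingedSuperspace.res_self, mul_sub, Finset.sum_sub_distrib, mul_ite, mul_one,
    mul_zero, Finset.sum_ite_eq', Finset.mem_univ, if_true] at this
  exact (sub_eq_zero.1 this).symm

/-- The columns of h are relations and g kills relations. With `mul_eq_self` this gives h = (1 - g)
h g, the Peirce description of `relationHom`. -/
theorem IsGram.mul_eq_zero {g : K → K → X.O.obj (op U)} (hg : IsGram ε p U g)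
    {h : K → K → X.O.obj (op U)} (hh : h ∈ relationHom U p) (i l : K) :
    ∑ j, g i j * h j l = 0 := by
  have := hg.kills U le_rfl _ (hh.1 l) i
  simpa only [RingedSuperspace.res_self] using this

/-- The elementary elements of `relationHom`. -/
def IsGram.elementary [DecidableEq K] {g : K → K → X.O.obj (op U)} (hg : IsGram ε p U g)
    (i j : K) : relationHom U p :=
  ⟨fun k l => ((if k = i then 1 else 0) - g k i) * g j l, fun l => by
    rw [comb_mul p (fun k => (if k = i then 1 else 0) - g k i), hg.comb_one_sub, smul_zero],
   fun V hV v hv k => by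
    simp only [map_mul, mul_assoc]
    rw [← Finset.mul_sum, hg.kills V hV v hv, mul_zero]⟩

/-- This is h = (1 - g) h g expanded along the matrices (1 - g) E_ij g. The coefficient h_ij acts
from the right; the twists by `ε l` (from the action) and `ε j` (from the coordinate) add up to the
degree of g_jl and carry h_ij back to its left. -/
theorem IsGram.sum_elementary [DecidableEq K] {g : K → K → X.O.obj (op U)}
    (hg : IsGram ε p U g) {h : K → K → X.O.obj (op U)} (hh : h ∈ relationHom U p) (k l : K) :
    ∑ ij : K × K, ((if k = ij.1 then 1 else 0) - g k ij.1) * g ij.2 l *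
      twist (X.isSuperRing (op U)) (ε l) (twist (X.isSuperRing (op U)) (ε ij.2) (h ij.1 ij.2)) =
      h k l := by
  have e : ∀ i j, g j l *
      twist (X.isSuperRing (op U)) (ε l) (twist (X.isSuperRing (op U)) (ε j) (h i j)) =
      h i j * g j l := fun i j => by
    rw [mul_eq_mul_twist (X.isSuperRing (op U)) (h i j) (hg.mem j l), twist_twist, add_comm (ε l)]
  simp only [mul_assoc, e, Fintype.sum_prod_type]
  refine (Finset.sum_congr rfl fun i _ =>
    (Finset.mul_sum Finset.univ (fun j => h i j * g j l)
      ((if k = i then 1 else 0) - g k i)).symm).trans ?_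
  simp only [hg.mul_eq_self hh.2, sub_mul, Finset.sum_sub_distrib, hg.mul_eq_zero hh, ite_mul,
    one_mul, zero_mul, Finset.sum_ite_eq, Finset.mem_univ, if_true, sub_zero]

/-- A dual basis of `relationHom` over an open set over which there is a Gram matrix. -/
def IsGram.dualBasis [DecidableEq K] {g : K → K → X.O.obj (op U)} (hg : IsGram ε p U g)
    (hp : ∀ k, p k ∈ F.gr (op ⊤) (ε k)) :
    (relationHomPresheaf p hp).DualBasis U (K × K) (fun ij => ε ij.1 + ε ij.2) where
  vec ij := hg.elementary ij.1 ij.2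
  vec_mem ij k l := by
    have h1 : (if k = ij.1 then 1 else 0) - g k ij.1 ∈ X.gr (op U) (ε k + ε ij.1) := by
      refine sub_mem ?_ (hg.mem k ij.1)
      split_ifs with h
      · rw [h, zmod_two_add_self]; exact (X.isSuperRing _).one_mem
      · exact zero_mem _
    have := (X.isSuperRing (op U)).mul_mem h1 (hg.mem ij.2 l)
    rwa [show ε k + ε ij.1 + (ε ij.2 + ε l) = ε ij.1 + ε ij.2 + ε k + ε l by abel] at this
  coord ij V _ :=
    { toFun := fun h : relationHom V p =>
        twist (X.isSuperRing (op V)) (ε ij.2) (h.1 ij.1 ij.2)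
      map_zero' := map_zero _
      map_add' := fun _ _ => map_add _ _ _ }
  coord_smul ij V _ a h := by
    have hV := X.isSuperRing (op V)
    change twist hV _ (h.1 ij.1 ij.2 * twist hV _ a) = twist hV _ (h.1 ij.1 ij.2) * a
    rw [map_mul, twist_twist, zmod_two_add_self, twist_zero]
  coord_mem ij V _ d h hh := by
    have := twist_mem (X.isSuperRing (op V)) (ε := ε ij.2) (hh ij.1 ij.2)
    rwa [add_assoc] at this
  coord_res ij V W _ h' h := (RingedSuperspace.res_twist h' _ _).symm
  sum_eq {V} hV h := by
    refine Subtype.ext (funext fun k => funext fun l => ?_)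
    let ev : relationHom V p →+ X.O.obj (op V) :=
      ((Pi.evalAddMonoidHom _ l).comp (Pi.evalAddMonoidHom _ k)).comp (relationHom V p).subtype
    change ev _ = h.1 k l
    refine (map_sum ev _ _).trans ?_
    refine Eq.trans ?_ ((hg.res hV).sum_elementary h.2 k l)
    refine Finset.sum_congr rfl fun ij _ => ?_
    change X.res hV (((if k = ij.1 then 1 else 0) - g k ij.1) * g ij.2 l) * twist (X.isSuperRing (op V)) _ _ = _
    rw [map_mul, map_sub]
    congr 3
    split_ifs
    · exact map_one _
    · exact map_zero _

end SuperPresheaf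

end

/-! ### Homogeneous generators, local Gram matrices and the passage to a global one. -/

section

namespace SuperPresheaf

variable {X : RingedSuperspace.{u}} {F : SuperPresheaf X} {U V W : Opens X.space}

/-- The homogeneous components of the elements of a set of global sections. -/
def homogeneousParts (S : Set (F.presheaf.obj (op ⊤))) : S ⊕ S → F.presheaf.obj (op ⊤) :=
  Sum.elim (fun s => homPart (F.isSuperModule (op ⊤)).isInternal 0 s.1)
    (fun s => homPart (F.isSuperModule (op ⊤)).isInternal 1 s.1)

theorem homogeneousParts_mem (S : Set (F.presheaf.obj (op ⊤))) (k : S ⊕ S) :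
    homogeneousParts S k ∈
      F.gr (op ⊤) (Sum.elim (fun _ => (0 : ZMod 2)) (fun _ => 1) k) := by
  rcases k with k | k <;> exact homPart_mem _ _ _

/-- If the germs of `S` at `x` generate the stalk, then the homogeneous components of the elements
of `S` generate every section near `x`. -/
theorem exists_comb_eq (S : Set (F.presheaf.obj (op ⊤))) [Fintype S] {x : X.space}
    (hS : Submodule.span (X.O.stalk x)ᵐᵒᵖ
      ((fun s => F.presheaf.germ ⊤ x trivial s) '' S) = ⊤) (hx : x ∈ U)
    (s : F.presheaf.obj (op U)) :
    ∃ (V : Opens X.space) (hV : V ≤ U) (_ : x ∈ V) (v : S ⊕ S → X.O.obj (op V)),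
      comb (homogeneousParts S) V v = F.res hV s := by
  classical
  have key : ∀ θ : F.presheaf.stalk x, ∃ (V : Opens X.space) (hV : x ∈ V)
      (v : S ⊕ S → X.O.obj (op V)),
      F.presheaf.germ V x hV (comb (homogeneousParts S) V v) = θ := by
    intro θ
    have hθ : θ ∈ Submodule.span (X.O.stalk x)ᵐᵒᵖ
      ((fun s => F.presheaf.germ ⊤ x trivial s) '' S) := hS ▸ Submodule.mem_top
    induction hθ using Submodule.span_induction with
    | mem θ hθ =>
      obtain ⟨t, ht, rfl⟩ := hθ
      -- A generator is the sum of its even and its odd part, both of which belong to the family of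
      -- homogeneous parts.
      refine ⟨⊤, trivial, (fun k => if k = Sum.inl ⟨t, ht⟩ then 1 else 0) +
        (fun k => if k = Sum.inr ⟨t, ht⟩ then 1 else 0), congrArg _ ?_⟩
      rw [map_add, comb_single, comb_single, res_self, res_self]
      exact homPart_zero_add_one _ t
    | zero => exact ⟨⊤, trivial, 0, by rw [map_zero, map_zero]⟩
    | add θ η _ _ hθ hη =>
      obtain ⟨V, hV, v, rfl⟩ := hθ
      obtain ⟨W, hW, w, rfl⟩ := hη
      have hVW : x ∈ V ⊓ W := ⟨hV, hW⟩
      refine ⟨V ⊓ W, hVW, (fun k => X.res inf_le_left (v k)) +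
        (fun k => X.res inf_le_right (w k)), ?_⟩
      rw [map_add, ← res_comb, ← res_comb, map_add, germ_res, germ_res]
    | smul a θ _ hθ =>
      obtain ⟨V, hV, v, rfl⟩ := hθ
      obtain ⟨W, hW, b, hb⟩ := X.O.exists_germ_eq a.unop
      have hVW : x ∈ V ⊓ W := ⟨hV, hW⟩
      refine ⟨V ⊓ W, hVW, fun k => X.res inf_le_left (v k) * X.res inf_le_right b, ?_⟩
      rw [comb_mul, ← res_comb, germ_smul, germ_res, RingedSuperspace.germ_res]
      exact congrArg (fun c => MulOpposite.op c • _) hb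
  obtain ⟨V, hV, v, hv⟩ := key (F.presheaf.germ U x hx s)
  have hVU : x ∈ V ⊓ U := ⟨hV, hx⟩
  have h1 : F.presheaf.germ (V ⊓ U) x hVU (F.res inf_le_left
      (comb (homogeneousParts S) V v)) = F.presheaf.germ (V ⊓ U) x hVU
      (F.res inf_le_right s) := by
    rw [germ_res, germ_res, hv]
  obtain ⟨W, hW, hxW, e⟩ := exists_res_eq_of_germ_eq _ h1
  rw [res_res, res_res, res_comb] at e
  exact ⟨W, _, hxW, _, e⟩

variable {K : Type u} [Fintype K] {ε : K → ZMod 2} {p : K → F.presheaf.obj (op ⊤)}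

variable (p) in
/-- The sections `p k` generate `F` locally. -/
def Generates : Prop :=
  ∀ (U : Opens X.space) (s : F.presheaf.obj (op U)), ∀ x ∈ U,
    ∃ (V : Opens X.space) (hV : V ≤ U) (_ : x ∈ V) (v : K → X.O.obj (op V)),
      comb p V v = F.res hV s

theorem Generates.exists_homogeneous (hgen : Generates p) (hp : ∀ k, p k ∈ F.gr (op ⊤) (ε k))
    {d : ZMod 2} {s : F.presheaf.obj (op U)} (hs : s ∈ F.gr (op U) d) {x : X.space} (hx : x ∈ U) :
    ∃ (V : Opens X.space) (hV : V ≤ U) (_ : x ∈ V) (v : K → X.O.obj (op V)),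
      (∀ k, v k ∈ X.gr (op V) (d + ε k)) ∧ comb p V v = F.res hV s := by
  obtain ⟨V, hV, hxV, v, hv⟩ := hgen U s x hx
  refine ⟨V, hV, hxV, fun k => homPart (X.isSuperRing (op V)).isInternal (d + ε k) (v k),
    fun k => homPart_mem _ _ _, ?_⟩
  rw [comb_homPart p hp, hv, homPart_of_mem _ (res_mem hV hs)]

/-- Finiteness of `L` makes the intersection of the individual neighbourhoods open. -/
theorem Generates.exists_homogeneous_family (hgen : Generates p)
    (hp : ∀ k, p k ∈ F.gr (op ⊤) (ε k)) {L : Type u} [Finite L] {δ : L → ZMod 2}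
    {s : L → F.presheaf.obj (op U)} (hs : ∀ l, s l ∈ F.gr (op U) (δ l)) {x : X.space}
    (hx : x ∈ U) :
    ∃ (V : Opens X.space) (hV : V ≤ U) (_ : x ∈ V) (c : L → K → X.O.obj (op V)),
      (∀ l k, c l k ∈ X.gr (op V) (δ l + ε k)) ∧ ∀ l, comb p V (c l) = F.res hV (s l) := by
  choose V hV hxV v hv hc using fun l => hgen.exists_homogeneous hp (hs l) hx
  refine ⟨U ⊓ ⨅ l, V l, inf_le_left, ⟨hx, ?_⟩, fun l k =>
    X.res (inf_le_right.trans (iInf_le V l)) (v l k), fun l k =>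
    RingedSuperspace.res_mem _ (hv l k), fun l => ?_⟩
  · rw [Opens.coe_iInf]
    exact Set.mem_iInter.2 hxV
  · rw [← res_comb p _ (v l), hc, res_res]

/-- A locally free presheaf has local Gram matrices with respect to homogeneous generators. -/
theorem DualBasis.exists_isGram {L : Type u} [Fintype L] {δ : L → ZMod 2}
    (D : F.DualBasis U L δ) (hgen : Generates p) (hp : ∀ k, p k ∈ F.gr (op ⊤) (ε k))
    {x : X.space} (hx : x ∈ U) :
    ∃ (V : Opens X.space) (_ : x ∈ V) (g : K → K → X.O.obj (op V)), IsGram ε p V g := by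
  obtain ⟨V, hV, hxV, c, hc, hcomb⟩ := hgen.exists_homogeneous_family hp D.vec_mem hx
  -- The lifts c_l of the basis sections define a right inverse s ↦ Σ c_l f_l(s) of the map O^K → F.
  -- The matrix is this map after O^K → F: it fixes each p_j modulo relations and kills relations.
  refine ⟨V, hxV, fun k j => ∑ l, c l k * D.coord l hV (F.res le_top (p j)), ?_, ?_, ?_⟩
  · intro k j
    refine sum_mem fun l _ => ?_
    have := (X.isSuperRing (op V)).mul_mem (hc l k) (D.coord_mem l hV (res_mem le_top (hp j)))
    rwa [show δ l + ε k + (ε j + δ l) = ε k + ε j + δ l + δ l by abel,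
      zmod_two_add_add_cancel] at this
  · intro j
    have h1 : (fun k => ∑ l, c l k * D.coord l hV (F.res le_top (p j))) =
        ∑ l, fun k => c l k * D.coord l hV (F.res le_top (p j)) := by
      funext k
      rw [Finset.sum_apply]
    rw [h1, map_sum]
    simp only [comb_mul, hcomb]
    exact D.sum_eq hV _
  · intro W hW v hv k
    have h1 : ∀ l, ∑ j, X.res hW (D.coord l hV (F.res le_top (p j))) * v j = 0 := by
      intro l
      rw [← map_zero (D.coord l (hW.trans hV)), ← hv, comb_apply, D.coord_sum_smul]
      refine Finset.sum_congr rfl fun j _ => ?_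
      rw [← D.coord_res, res_res]
    simp only [map_sum, map_mul, Finset.sum_mul, mul_assoc]
    rw [Finset.sum_comm]
    simp only [← Finset.mul_sum, h1, mul_zero, Finset.sum_const_zero]

variable (p) in
/-- The inclusion of `relationHom` into the matrices. -/
def relationHomInclusion (hF : F.presheaf.IsSheaf) (hp : ∀ k, p k ∈ F.gr (op ⊤) (ε k)) :
    (⟨(relationHomPresheaf p hp).presheaf, relationHomPresheaf_isSheaf p hF hp⟩ :
      TopCat.Sheaf AddCommGrpCat.{u} X.space) ⟶ ⟨matrixPresheaf X K, matrixPresheaf_isSheaf K⟩ :=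
  ⟨{ app := fun V => AddCommGrpCat.ofHom (relationHom V.unop p).subtype
     naturality := fun _ _ _ => rfl }⟩

theorem mono_relationHomInclusion (hF : F.presheaf.IsSheaf)
    (hp : ∀ k, p k ∈ F.gr (op ⊤) (ε k)) : Mono (relationHomInclusion p hF hp) := by
  constructor
  intro Z f g hfg
  apply Sheaf.hom_ext
  refine NatTrans.ext (funext fun V => AddCommGrpCat.hom_ext (AddMonoidHom.ext fun z => ?_))
  refine Subtype.ext ?_
  exact congrArg (fun φ : Z ⟶ (⟨matrixPresheaf X K, matrixPresheaf_isSheaf K⟩ :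
    TopCat.Sheaf AddCommGrpCat.{u} X.space) => φ.hom.app V z) hfg

/-- Splittings of an epimorphism form a torsor under homomorphisms to its kernel. Gram matrices are
not a subgroup of the matrices, but their differences lie in `relationHom`, so the matrix sheaf can
serve as the ambient E in the cohomological argument. -/
theorem IsGram.sub_mem {g g' : K → K → X.O.obj (op U)} (hg : IsGram ε p U g)
    (hg' : IsGram ε p U g') : (fun i j => g i j - g' i j) ∈ relationHom U p := by
  refine ⟨fun j => ?_, hg.kills.sub hg'.kills⟩
  refine (map_sub (comb p U) (fun k => g k j) (fun k => g' k j)).trans ?_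
  rw [hg.comb_eq, hg'.comb_eq, sub_self]

/-- Local Gram matrices can be replaced by a global one if the first cohomology group of
`relationHom` vanishes. -/
theorem exists_isGram_top (hF : F.presheaf.IsSheaf) (hp : ∀ k, p k ∈ F.gr (op ⊤) (ε k))
    (hH : Subsingleton (Sheaf.H (⟨(relationHomPresheaf p hp).presheaf,
      relationHomPresheaf_isSheaf p hF hp⟩ : TopCat.Sheaf AddCommGrpCat.{u} X.space) 1))
    (hloc : ∀ x : X.space, ∃ (V : Opens X.space) (_ : x ∈ V) (g : K → K → X.O.obj (op V)),
      IsGram ε p V g) : ∃ g : K → K → X.O.obj (op ⊤), IsGram ε p ⊤ g := by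
  choose U hU g hg using hloc
  -- The global matrix s differs from each local Gram matrix by a section of `relationHom`. It
  -- therefore fixes the p_j modulo relations and kills relations, but its entries need not be
  -- homogeneous.
  obtain ⟨s, hs⟩ := @exists_global_section_of_subsingleton_H X.space _ _
    (relationHomInclusion p hF hp) (mono_relationHomInclusion hF hp) hH U hU g fun x y => ⟨⟨_, ((hg x).res (inf_le_left : U x ⊓ U y ≤ U x)).sub_mem
      ((hg y).res inf_le_right)⟩, rfl⟩
  have hs' : ∀ x, (fun i j => X.res le_top (s i j) - g x i j) ∈ relationHom (U x) p := by
    intro x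
    obtain ⟨t, ht⟩ := hs x
    have : t.1 = fun i j => X.res le_top (s i j) - g x i j := ht
    rw [← this]
    exact t.2
  have hcomb : ∀ j, comb p ⊤ (fun k => s k j) = p j := by
    intro j
    refine eq_of_locally_eq hF fun x _ => ⟨U x, le_top, hU x, ?_⟩
    rw [res_comb, ← (hg x).comb_eq, ← sub_eq_zero, ← map_sub]
    exact (hs' x).1 j
  have hkill : KillsRelations p ⊤ s := by
    refine killsRelations_of_locally fun x _ => ⟨U x, le_top, hU x, ?_⟩
    have := (hs' x).2.add (hg x).kills
    simpa only [sub_add_cancel] using this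
  -- Passing to the component of degree 0 makes the matrix even; the other two conditions survive
  -- because the p_j are homogeneous.
  refine ⟨fun i j => homPart (X.isSuperRing (op ⊤)).isInternal (0 + ε i + ε j) (s i j),
    fun i j => ?_, fun j => ?_, hkill.homPart hp 0⟩
  · have := homPart_mem (X.isSuperRing (op ⊤)).isInternal (0 + ε i + ε j) (s i j)
    rwa [zero_add] at this ⊢
  · have := comb_homPart p hp (fun k => s k j) (ε j)
    rw [hcomb, homPart_of_mem _ (hp j)] at this
    rw [res_self]
    refine Eq.trans ?_ this
    congr 1
    funext k
    rw [zero_add, add_comm]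

end SuperPresheaf

end

/-! ### From a global Gram matrix to a global dual basis. -/

section

namespace SuperPresheaf

variable {X : RingedSuperspace.{u}} {F : SuperPresheaf X} {V W : Opens X.space}
  {K : Type u} [Fintype K] {ε : K → ZMod 2} {p : K → F.presheaf.obj (op ⊤)}
  {g : K → K → X.O.obj (op ⊤)}

/-- Locally s is a combination of the generators with coefficients v, and its coordinate is the k-th
entry of g v. This does not depend on v, since g kills relations, so the local values glue. -/
theorem IsGram.exists_coord (hg : IsGram ε p ⊤ g) (hgen : Generates p) (k : K)
    (s : F.presheaf.obj (op V)) :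
    ∃ a : X.O.obj (op V), ∀ (W : Opens X.space) (hW : W ≤ V) (v : K → X.O.obj (op W)),
      comb p W v = F.res hW s → X.res hW a = ∑ j, X.res le_top (g k j) * v j := by
  obtain ⟨a, ha, -⟩ := RingedSuperspace.exists_glue (U := V)
    (fun W hW a => ∃ v : K → X.O.obj (op W), comb p W v = F.res hW s ∧
      a = ∑ j, X.res le_top (g k j) * v j)
    (fun x hx => by
      obtain ⟨W, hW, hxW, v, hv⟩ := hgen V s x hx
      exact ⟨W, hW, _, hxW, v, hv, rfl⟩)
    (by
      rintro W hW _ W' hW' _ ⟨v, hv, rfl⟩ ⟨v', hv', rfl⟩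
      have := hg.kills (W ⊓ W') le_top
        ((fun k => X.res inf_le_left (v k)) - fun k => X.res inf_le_right (v' k))
        (by rw [map_sub, ← res_comb, ← res_comb, hv, hv', res_res, res_res, sub_self]) k
      simp only [Pi.sub_apply, mul_sub, Finset.sum_sub_distrib, sub_eq_zero] at this
      simpa only [map_sum, map_mul, RingedSuperspace.res_res] using this)
  exact ⟨a, fun W hW v hv => ha W hW _ ⟨v, hv, rfl⟩⟩

/-- The functional defined by the `k`-th row of a Gram matrix. -/
def IsGram.coord (hg : IsGram ε p ⊤ g) (hgen : Generates p) (k : K)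
    (s : F.presheaf.obj (op V)) : X.O.obj (op V) :=
  (hg.exists_coord hgen k s).choose

theorem IsGram.res_coord (hg : IsGram ε p ⊤ g) (hgen : Generates p) (k : K)
    (s : F.presheaf.obj (op V)) (hW : W ≤ V) (v : K → X.O.obj (op W))
    (hv : comb p W v = F.res hW s) :
    X.res hW (hg.coord hgen k s) = ∑ j, X.res le_top (g k j) * v j :=
  (hg.exists_coord hgen k s).choose_spec W hW v hv

theorem IsGram.coord_res (hg : IsGram ε p ⊤ g) (hgen : Generates p) (k : K)
    (s : F.presheaf.obj (op V)) (hW : W ≤ V) :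
    hg.coord hgen k (F.res hW s) = X.res hW (hg.coord hgen k s) := by
  refine RingedSuperspace.eq_of_locally_eq fun x hx => ?_
  obtain ⟨W', hW', hx', v, hv⟩ := hgen W (F.res hW s) x hx
  refine ⟨W', hW', hx', ?_⟩
  rw [hg.res_coord hgen k _ hW' v hv, RingedSuperspace.res_res,
    hg.res_coord hgen k s _ v (hv.trans (res_res _ _ _))]

theorem IsGram.coord_add (hg : IsGram ε p ⊤ g) (hgen : Generates p) (k : K)
    (s t : F.presheaf.obj (op V)) :
    hg.coord hgen k (s + t) = hg.coord hgen k s + hg.coord hgen k t := by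
  refine RingedSuperspace.eq_of_locally_eq fun x hx => ?_
  obtain ⟨W, hW, hx', v, hv⟩ := hgen V s x hx
  obtain ⟨W', hW', hx'', w, hw⟩ := hgen W (F.res hW t) x hx'
  have hv' : comb p W' (fun k => X.res hW' (v k)) = F.res (hW'.trans hW) s := by
    rw [← res_comb, hv, res_res]
  rw [res_res] at hw
  refine ⟨W', hW'.trans hW, hx'', ?_⟩
  rw [map_add, hg.res_coord hgen k s _ _ hv', hg.res_coord hgen k t _ _ hw,
    hg.res_coord hgen k (s + t) _ ((fun k => X.res hW' (v k)) + w) (by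
      rw [map_add, map_add, hv', hw])]
  simp only [Pi.add_apply, mul_add, Finset.sum_add_distrib]

/-- A Gram matrix over the whole space defines a dual basis. -/
def IsGram.dualBasisTop (hg : IsGram ε p ⊤ g) (hF : F.presheaf.IsSheaf) (hgen : Generates p)
    (hp : ∀ k, p k ∈ F.gr (op ⊤) (ε k)) : F.DualBasis ⊤ K ε where
  vec := p
  vec_mem := hp
  coord k V _ := AddMonoidHom.mk' (hg.coord hgen k) (hg.coord_add hgen k)
  coord_smul k V _ a s := by
    refine RingedSuperspace.eq_of_locally_eq fun x hx => ?_
    obtain ⟨W, hW, hx', v, hv⟩ := hgen V s x hx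
    refine ⟨W, hW, hx', ?_⟩
    refine (hg.res_coord hgen k (MulOpposite.op a • s) hW (fun k => v k * X.res hW a) (by
      rw [comb_mul, hv, res_smul])).trans ?_
    refine Eq.trans ?_ (map_mul (X.res hW) _ _).symm
    refine Eq.trans ?_ (congrArg (· * X.res hW a) (hg.res_coord hgen k s hW v hv)).symm
    simp only [Finset.sum_mul, mul_assoc]
  coord_mem k V _ d s hs := by
    refine RingedSuperspace.mem_gr_of_locally fun x hx => ?_
    obtain ⟨W, hW, hx', v, hmem, hv⟩ := hgen.exists_homogeneous hp hs hx
    refine ⟨W, hW, hx', ?_⟩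
    have e := hg.res_coord hgen k s hW v hv
    refine (show X.res hW (hg.coord hgen k s) ∈ _ from ?_)
    rw [e]
    refine sum_mem fun j _ => ?_
    have := (X.isSuperRing (op W)).mul_mem (RingedSuperspace.res_mem le_top (hg.mem k j)) (hmem j)
    rwa [show ε k + ε j + (d + ε j) = d + ε k + ε j + ε j by abel,
      zmod_two_add_add_cancel] at this
  coord_res k V W _ h' s := hg.coord_res hgen k s h'
  sum_eq {V} _ s := by
    change comb p V (fun k => hg.coord hgen k s) = s
    refine eq_of_locally_eq hF fun x hx => ?_
    obtain ⟨W, hW, hx', v, hv⟩ := hgen V s x hx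
    refine ⟨W, hW, hx', ?_⟩
    -- The coordinates of s are g v locally, and recombining g v with the generators gives the same
    -- as recombining v, by `comb_eq`.
    have h1 : (fun k => X.res hW (hg.coord hgen k s)) =
        ∑ j, fun k => X.res le_top (g k j) * v j := by
      funext k
      rw [hg.res_coord hgen k s hW v hv, Finset.sum_apply]
    rw [res_comb, h1, map_sum, ← hv, comb_apply]
    refine Finset.sum_congr rfl fun j _ => ?_
    rw [comb_mul, ((hg.res (le_top : W ≤ ⊤)).comb_eq j)]

end SuperPresheaf

variable {X : RingedSuperspace.{u}}

/-- The dual bases may vary with the point, but they share one finite index type, and its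
cardinality is the uniform bound on the rank. -/
theorem SuperPresheaf.DualBasis.locallyFreeBounded (hX : X.IsLocallyRinged) {F : SuperSheaf X}
    {K : Type u} [Fintype K] {ε : K → ZMod 2} {U : X.space → Opens X.space} (hU : ∀ x, x ∈ U x)
    (D : ∀ x, F.obj.DualBasis (U x) K ε) : SuperSheaf.locallyFreeBounded X F := by
  refine ⟨Fintype.card K, fun x => ?_⟩
  obtain ⟨V, -, hx, I, J, hI, hJ, hn, hiso⟩ := (D x).exists_isoOn_free hX (hU x)
  exact ⟨V, hx, I, J, hI, hJ, hn, hiso⟩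

/-- If all supersheaves that are locally free of bounded rank are acyclic and finitely generated by
global sections, then they have finite dual bases over the whole space. -/
theorem SuperSheaf.exists_dualBasis (hX : X.IsLocallyRinged)
    (h : ∀ F : SuperSheaf X, SuperSheaf.locallyFreeBounded X F →
      SuperSheaf.IsAcyclic F ∧ SuperSheaf.IsFinitelyGeneratedByGlobalSections F)
    (F : SuperSheaf X) (hF : SuperSheaf.locallyFreeBounded X F) :
    ∃ (S : Type u) (_ : Fintype S), Nonempty (F.obj.DualBasis ⊤ (S ⊕ S)
      (Sum.elim (fun _ => 0) (fun _ => 1))) := by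
  classical
  obtain ⟨S, hSfin, hS⟩ := (h F hF).2
  have := hSfin.fintype
  have hp := SuperPresheaf.homogeneousParts_mem S
  have hgen : SuperPresheaf.Generates (SuperPresheaf.homogeneousParts S) := fun U s x hx =>
    SuperPresheaf.exists_comb_eq S (hS x) hx s
  have hloc : ∀ x : X.space, ∃ (V : Opens X.space) (_ : x ∈ V)
      (g : S ⊕ S → S ⊕ S → X.O.obj (op V)), SuperPresheaf.IsGram
        (Sum.elim (fun _ => 0) (fun _ => 1)) (SuperPresheaf.homogeneousParts S) V g := by
    intro x
    obtain ⟨n, hn⟩ := hF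
    obtain ⟨U, hx, I, J, hI, hJ, -, ⟨φ⟩⟩ := hn x
    obtain ⟨L, hL, δ, ⟨D⟩⟩ := φ.exists_dualBasis
    exact D.exists_isGram hgen hp hx
  -- The homomorphism sheaf has local dual bases indexed by the square of `S ⊕ S` at every point, so
  -- the acyclicity hypothesis applies to it.
  have hH : SuperSheaf.locallyFreeBounded X
      ⟨SuperPresheaf.relationHomPresheaf _ hp,
        SuperPresheaf.relationHomPresheaf_isSheaf _ F.property hp⟩ := by
    choose U hU g hg using hloc
    exact SuperPresheaf.DualBasis.locallyFreeBounded hX hU fun x => (hg x).dualBasis hp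
  obtain ⟨g, hg⟩ := SuperPresheaf.exists_isGram_top F.property hp
    ((h _ hH).1 1 one_pos) hloc
  exact ⟨S, inferInstance, ⟨hg.dualBasisTop F.property hgen hp⟩⟩

end

/-! ### The functor S on finitely generated superprojective modules, and the equivalence. -/

section

variable {X : RingedSuperspace.{u}}

namespace SuperPresheaf

variable {F G : SuperPresheaf X}

/-- The homomorphism of supermodules of sections induced by a homomorphism of presheaves. -/
def sectionsMap (f : F ⟶ G) (V : Opens X.space) : F.sections (op V) ⟶ G.sections (op V) where
  hom :=
    { toFun := f.hom.app (op V)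
      map_add' := fun s t => map_add (f.hom.app (op V)).hom s t
      map_smul' := fun a s => f.map_smul (op V) a.unop s }
  map_mem h := f.map_mem h

/-- An isomorphism of presheaves of supermodules restricts to every open set. -/
def isoOnOfIso (e : F ≅ G) (U : Opens X.space) : IsoOn U F G where
  iso V _ :=
    { hom := sectionsMap e.hom V
      inv := sectionsMap e.inv V
      hom_inv_id := SuperModule.Hom.ext (LinearMap.ext fun s =>
        congrArg (fun f : F ⟶ F => f.hom.app (op V) s) e.hom_inv_id)
      inv_hom_id := SuperModule.Hom.ext (LinearMap.ext fun s =>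
        congrArg (fun f : G ⟶ G => f.hom.app (op V) s) e.inv_hom_id) }
  map_iso _ i s := (NatTrans.naturality_apply e.hom.hom i.op s).symm

end SuperPresheaf

theorem functorS_obj_locallyFreeBounded (hX : X.IsLocallyRinged)
    {P : SuperModule X.globalSections} (hP : SuperModule.fgsp X.globalSections P) :
    SuperSheaf.locallyFreeBounded X ((functorS X).obj P) := by
  obtain ⟨K, _, ε, ⟨D⟩⟩ := SuperModule.exists_dualBasis_of_fgsp hP
  have := D.tensor.isIso_toSheafify
  let e : (tensorPresheaf X P).sheafify ≅ tensorPresheaf X P :=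
    (asIso (SuperPresheaf.toSheafify (tensorPresheaf X P))).symm
  let D' : ((functorS X).obj P).obj.DualBasis ⊤ K ε :=
    D.tensor.transport (SuperPresheaf.isoOnOfIso e ⊤)
  exact SuperPresheaf.DualBasis.locallyFreeBounded hX (U := fun _ => ⊤) (fun _ => trivial)
    fun _ => D'

theorem isIso_toSheafify_of_fgsp {P : SuperModule X.globalSections}
    (hP : SuperModule.fgsp X.globalSections P) :
    IsIso (SuperPresheaf.toSheafify (tensorPresheaf X P)) := by
  obtain ⟨K, _, ε, ⟨D⟩⟩ := SuperModule.exists_dualBasis_of_fgsp hP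
  exact D.tensor.isIso_toSheafify

/-- The tensor presheaf on F(X) is isomorphic to F, having the same Gram matrix, and is isomorphic
to its own sheafification. -/
theorem SuperPresheaf.DualBasis.exists_functorS_iso {F : SuperSheaf X} {K : Type*} [Fintype K]
    {ε : K → ZMod 2} (D : F.obj.DualBasis ⊤ K ε) :
    Nonempty ((functorS X).obj (F.obj.sections (op ⊤)) ≅ F) := by
  obtain ⟨e⟩ := D.exists_iso
  have hτ := D.globalSections.tensor.isIso_toSheafify
  let τ : tensorPresheaf X (F.obj.sections (op ⊤)) ≅
      ((functorS X).obj (F.obj.sections (op ⊤))).obj :=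
    @asIso _ _ _ _ (SuperPresheaf.toSheafify (tensorPresheaf X (F.obj.sections (op ⊤)))) hτ
  exact ⟨ObjectProperty.isoMk _ (τ.symm ≪≫ e)⟩

end

end Super

end

theorem theorem6p4 (X : Super.RingedSuperspace.{u}) (hX : X.IsLocallyRinged)
    (h : ∀ F : Super.SuperSheaf X, Super.SuperSheaf.locallyFreeBounded X F →
      Super.SuperSheaf.IsAcyclic F ∧
        Super.SuperSheaf.IsFinitelyGeneratedByGlobalSections F) :
    ∃ hS : ∀ P : (Super.SuperModule.fgsp X.globalSections).FullSubcategory,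
        Super.SuperSheaf.locallyFreeBounded X ((Super.functorS X).obj P.obj),
      ((Super.SuperSheaf.locallyFreeBounded X).lift
        ((Super.SuperModule.fgsp X.globalSections).ι ⋙ Super.functorS X) hS).IsEquivalence := by
  have hbij : ∀ P Q : (Super.SuperModule.fgsp X.globalSections).FullSubcategory,
      Function.Bijective ((Super.functorS X).map : (P.obj ⟶ Q.obj) → _) := fun P Q =>
    have := Super.isIso_toSheafify_of_fgsp P.property
    have := Super.isIso_toSheafify_of_fgsp Q.property
    Super.functorS_map_bijective
  refine ⟨fun P => Super.functorS_obj_locallyFreeBounded hX P.property,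
    { faithful := ⟨fun {P Q} f g hfg => ObjectProperty.hom_ext _ ((hbij P Q).1 ?_)⟩
      full := ⟨fun {P Q} f => ?_⟩
      essSurj := ⟨fun F => ?_⟩ }⟩
  · exact congrArg (fun φ => φ.hom) hfg
  · obtain ⟨g, hg⟩ := (hbij P Q).2 f.hom
    exact ⟨⟨g⟩, ObjectProperty.hom_ext _ hg⟩
  -- Acyclicity and global generation enter here. The preimage is the module of global sections,
  -- which is finitely generated superprojective because it inherits the dual basis.
  · obtain ⟨S, _, ⟨D⟩⟩ := Super.SuperSheaf.exists_dualBasis hX h F.obj F.property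
    obtain ⟨e⟩ := D.exists_functorS_iso
    exact ⟨⟨F.obj.obj.sections (op ⊤), D.globalSections.fgsp⟩, ⟨ObjectProperty.isoMk _ e⟩⟩
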